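/- Let $k$ be a field of characteristic $\neq 2$. "Super" means: in the symmetric tensor category of $\mathbb{Z}/2$-graded $k$-vector spaces with symmetry $v\otimes w\mapsto(-1)^{|v||w|}w\otimes v$. For a super commutative Hopf algebra $A=A_0\oplus A_1$ with counit $\varepsilon$ put $$\overline{A}:=A_0/A_1^2,\qquad W^A:=A_1/A_0^+A_1,\qquad A_0^+:=A_0\cap\operatorname{Ker}\varepsilon .$$ Here $\overline{A}$ is an ordinary commutative Hopf algebra, a quotient of $A$ through $a\mapsto\overline{a}:=[a_0]$ ($a_0$ the even component of $a$), and $A$ is a super left $\overline{A}$-comodule algebra through $a\mapsto\sum\overline{a_{(1)}}\otimes a_{(2)}$. The exterior algebra $\wedge(W^A)$ is regarded as a super algebra in which the elements of $W^A$ are odd, with the counit that vanishes on $W^A$; $\overline{A}\otimes\wedge(W^A)$ is a super left $\overline{A}$-comodule algebra through $\Delta_{\overline{A}}\otimes\mathrm{id}$, with counit $\varepsilon\otimes\varepsilon$. A map $f:A\to D$ of super commutative Hopf algebras induces maps $\overline{f}:\overline{A}\to\overline{D}$ and $W^f:W^A\to W^D$. **Theorem 4.1.** Let $A$ be a super commutative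 Hopf algebra over $k$. (1) There is a counit-preserving isomorphism $A\xrightarrow{\ \simeq\ }\overline{A}\otimes\wedge(W^A)$ of super left $\overline{A}$-comodule algebras. (2) Given a map $f:A\to D$ of super commutative Hopf algebras, isomorphisms $\varphi:A\xrightarrow{\ \simeq\ }\overline{A}\otimes\wedge(W^A)$ and $\psi:D\xrightarrow{\ \simeq\ }\overline{D}\otimes\wedge(W^D)$ as in (1) can be chosen so that $$\psi\circ f=\bigl(\overline{f}\otimes\wedge(W^f)\bigr)\circ\varphi .$$ -/

import Mathlib

open scoped TensorProduct

noncomputable section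

namespace SuperHopf

section Basic

variable {k A : Type*} [Field k] [Ring A] [Algebra k A]

/-- The component of parity `i` of `V ⊗ W`, for `ZMod 2`-graded spaces `V`, `W`: the span of all
`v ⊗ w` with `v`, `w` homogeneous and `|v| + |w| = i`. -/
def tensorParity {V W : Type*} [AddCommGroup V] [Module k V] [AddCommGroup W] [Module k W]
    (𝒱 : ZMod 2 → Submodule k V) (𝒲 : ZMod 2 → Submodule k W) (i : ZMod 2) :
    Submodule k (V ⊗[k] W) :=
  Submodule.span k {t | ∃ p q : ZMod 2, p + q = i ∧ ∃ v ∈ 𝒱 p, ∃ w ∈ 𝒲 q, v ⊗ₜ[k] w = t}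

/-- A `ZMod 2`-graded algebra is super commutative if `a b = (-1)^{|a||b|} b a` for homogeneous
elements. -/
class IsSuperCommutative (𝒜 : ZMod 2 → Submodule k A) : Prop where
  mul_comm' : ∀ (i j : ZMod 2) (a b : A), a ∈ 𝒜 i → b ∈ 𝒜 j →
    a * b = (-1 : ℤˣ) ^ (i * j) • (b * a)

/-- A super algebra `A = 𝒜 0 ⊕ 𝒜 1` which is also a coalgebra is a super Hopf algebra (a Hopf
algebra in the symmetric tensor category of super vector spaces) if the counit and the
comultiplication are parity-preserving algebra maps, where `A ⊗ A` carries the product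
`(a ⊗ b)(c ⊗ d) = (-1)^{|b||c|} ac ⊗ bd`, and there is a parity-preserving antipode. -/
class IsSuperHopfAlgebra (𝒜 : ZMod 2 → Submodule k A) [GradedAlgebra 𝒜] [Coalgebra k A] :
    Prop where
  counit_odd : ∀ a ∈ 𝒜 1, Coalgebra.counit (R := k) a = 0
  counit_one : Coalgebra.counit (R := k) (1 : A) = 1
  counit_mul : ∀ a b : A, Coalgebra.counit (R := k) (a * b) =
    Coalgebra.counit (R := k) a * Coalgebra.counit (R := k) b
  comul_parity : ∀ (i : ZMod 2), ∀ a ∈ 𝒜 i, Coalgebra.comul (R := k) a ∈ tensorParity 𝒜 𝒜 i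
  comul_one : Coalgebra.comul (R := k) (1 : A) = 1 ⊗ₜ[k] 1
  comul_mul : ∀ a b : A,
    GradedTensorProduct.of k 𝒜 𝒜 (Coalgebra.comul (R := k) (a * b)) =
      GradedTensorProduct.of k 𝒜 𝒜 (Coalgebra.comul (R := k) a) *
        GradedTensorProduct.of k 𝒜 𝒜 (Coalgebra.comul (R := k) b)
  exists_antipode : ∃ S : A →ₗ[k] A, (∀ (i : ZMod 2), ∀ a ∈ 𝒜 i, S a ∈ 𝒜 i) ∧
    LinearMap.mul' k A ∘ₗ S.rTensor A ∘ₗ Coalgebra.comul =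
      Algebra.linearMap k A ∘ₗ Coalgebra.counit ∧
    LinearMap.mul' k A ∘ₗ S.lTensor A ∘ₗ Coalgebra.comul =
      Algebra.linearMap k A ∘ₗ Coalgebra.counit

variable (𝒜 : ZMod 2 → Submodule k A)

section Algebra

variable [GradedAlgebra 𝒜]

/-- `A₁²`, the span of all products of two odd elements, as an ideal of the ring `A₀`. -/
def oddSq : Ideal (𝒜 0) where
  carrier := {x | (x : A) ∈ 𝒜 1 * 𝒜 1}
  add_mem' {a b} ha hb := (𝒜 1 * 𝒜 1).add_mem ha hb
  zero_mem' := (𝒜 1 * 𝒜 1).zero_mem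
  smul_mem' c x hx := by
    have h1 : 𝒜 0 * 𝒜 1 ≤ 𝒜 1 := Submodule.mul_le.2 fun a ha b hb => by
      simpa using SetLike.mul_mem_graded ha hb
    have h2 : (c : A) * x ∈ 𝒜 0 * (𝒜 1 * 𝒜 1) := Submodule.mul_mem_mul c.2 hx
    rw [← mul_assoc] at h2
    exact mul_le_mul' h1 le_rfl h2

lemma mem_oddSq {x : 𝒜 0} : x ∈ oddSq 𝒜 ↔ (x : A) ∈ 𝒜 1 * 𝒜 1 := .rfl

instance : (oddSq 𝒜).IsTwoSided where
  mul_mem_of_left {x} c hx := by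
    have h1 : 𝒜 1 * 𝒜 0 ≤ 𝒜 1 := Submodule.mul_le.2 fun a ha b hb => by
      simpa using SetLike.mul_mem_graded ha hb
    have h2 : (x : A) * c ∈ (𝒜 1 * 𝒜 1) * 𝒜 0 :=
      Submodule.mul_mem_mul ((mem_oddSq 𝒜).1 hx) c.2
    rw [mul_assoc] at h2
    exact mul_le_mul' le_rfl h1 h2

/-- The quotient algebra `Ā = A₀ / A₁²`. -/
abbrev Bar : Type _ := 𝒜 0 ⧸ oddSq 𝒜

/-- The linear projection `A → Ā`, `a ↦ [a₀]`, where `a₀` is the even component of `a`. -/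
def toBarLinear : A →ₗ[k] Bar 𝒜 :=
  (Ideal.Quotient.mkₐ k (oddSq 𝒜)).toLinearMap ∘ₗ
    DirectSum.component k (ZMod 2) (fun i => 𝒜 i) 0 ∘ₗ
      (DirectSum.decomposeLinearEquiv 𝒜).toLinearMap

lemma toBarLinear_even {a : A} (ha : a ∈ 𝒜 0) :
    toBarLinear 𝒜 a = Ideal.Quotient.mk (oddSq 𝒜) ⟨a, ha⟩ := by
  have : DirectSum.decompose 𝒜 a 0 = ⟨a, ha⟩ :=
    Subtype.ext (DirectSum.decompose_of_mem_same 𝒜 ha)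
  exact congrArg (Ideal.Quotient.mk (oddSq 𝒜)) this

lemma toBarLinear_odd {a : A} (ha : a ∈ 𝒜 1) : toBarLinear 𝒜 a = 0 := by
  have : DirectSum.decompose 𝒜 a 0 = 0 :=
    Subtype.ext (DirectSum.decompose_of_mem_ne 𝒜 ha (by decide))
  exact (congrArg (Ideal.Quotient.mk (oddSq 𝒜)) this).trans (map_zero _)

lemma exists_even_add_odd (a : A) : ∃ x ∈ 𝒜 0, ∃ y ∈ 𝒜 1, a = x + y := by
  refine ⟨DirectSum.decompose 𝒜 a 0, SetLike.coe_mem _, DirectSum.decompose 𝒜 a 1,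
    SetLike.coe_mem _, ?_⟩
  classical
  have h : ∑ i, (DirectSum.decompose 𝒜 a i : A) = a := by
    conv_rhs => rw [← DirectSum.sum_support_decompose 𝒜 a]
    exact (Finset.sum_subset (Finset.subset_univ _) fun i _ hi => by simpa using hi).symm
  exact h.symm.trans (Fin.sum_univ_two _)

/-- The projection `A → Ā`, `a ↦ [a₀]`, is an algebra map. -/
def toBar : A →ₐ[k] Bar 𝒜 :=
  AlgHom.ofLinearMap (toBarLinear 𝒜)
    ((toBarLinear_even 𝒜 SetLike.GradedOne.one_mem).trans (map_one (Ideal.Quotient.mk _)))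
    (by
      intro a b
      obtain ⟨a₀, ha₀, a₁, ha₁, rfl⟩ := exists_even_add_odd 𝒜 a
      obtain ⟨b₀, hb₀, b₁, hb₁, rfl⟩ := exists_even_add_odd 𝒜 b
      have h00 : a₀ * b₀ ∈ 𝒜 0 := by simpa using SetLike.mul_mem_graded ha₀ hb₀
      have h01 : a₀ * b₁ ∈ 𝒜 1 := by simpa using SetLike.mul_mem_graded ha₀ hb₁
      have h10 : a₁ * b₀ ∈ 𝒜 1 := by simpa using SetLike.mul_mem_graded ha₁ hb₀
      have h11 : a₁ * b₁ ∈ 𝒜 0 := SetLike.mul_mem_graded ha₁ hb₁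
      have e11 : toBarLinear 𝒜 (a₁ * b₁) = 0 := by
        rw [toBarLinear_even 𝒜 h11, Ideal.Quotient.eq_zero_iff_mem]
        exact Submodule.mul_mem_mul ha₁ hb₁
      simp only [add_mul, mul_add, map_add, e11, toBarLinear_odd 𝒜 h01, toBarLinear_odd 𝒜 h10,
        toBarLinear_odd 𝒜 ha₁, toBarLinear_odd 𝒜 hb₁, add_zero]
      rw [toBarLinear_even 𝒜 h00, toBarLinear_even 𝒜 ha₀, toBarLinear_even 𝒜 hb₀, ← map_mul]
      rfl)

lemma toBar_even {a : A} (ha : a ∈ 𝒜 0) :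
    toBar 𝒜 a = Ideal.Quotient.mk (oddSq 𝒜) ⟨a, ha⟩ := toBarLinear_even 𝒜 ha

lemma toBar_odd {a : A} (ha : a ∈ 𝒜 1) : toBar 𝒜 a = 0 := toBarLinear_odd 𝒜 ha

lemma toBar_surjective : Function.Surjective (toBar 𝒜) := by
  intro x
  obtain ⟨a, rfl⟩ := Ideal.Quotient.mk_surjective x
  exact ⟨a, toBar_even 𝒜 a.2⟩

/-- An algebra map out of `A` that kills the odd elements factors through `Ā`. -/
def liftBar {B : Type*} [Ring B] [Algebra k B] (g : A →ₐ[k] B) (hg : ∀ a ∈ 𝒜 1, g a = 0) :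
    Bar 𝒜 →ₐ[k] B :=
  Ideal.Quotient.liftₐ (oddSq 𝒜) (g.comp (SetLike.GradeZero.subalgebra 𝒜).val) (by
    intro a ha
    have h : 𝒜 1 * 𝒜 1 ≤ LinearMap.ker g.toLinearMap := Submodule.mul_le.2 fun x hx y _ => by
      simp [hg x hx]
    exact h ha)

lemma liftBar_toBar {B : Type*} [Ring B] [Algebra k B] (g : A →ₐ[k] B)
    (hg : ∀ a ∈ 𝒜 1, g a = 0) (a : A) : liftBar 𝒜 g hg (toBar 𝒜 a) = g a := by
  obtain ⟨a₀, ha₀, a₁, ha₁, rfl⟩ := exists_even_add_odd 𝒜 a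
  rw [map_add, toBar_odd 𝒜 ha₁, add_zero, map_add, hg _ ha₁, add_zero, toBar_even 𝒜 ha₀]
  rfl

lemma bar_algHom_ext {B : Type*} [Ring B] [Algebra k B] {g h : Bar 𝒜 →ₐ[k] B}
    (H : ∀ a, g (toBar 𝒜 a) = h (toBar 𝒜 a)) : g = h := by
  ext x
  obtain ⟨a, rfl⟩ := toBar_surjective 𝒜 x
  exact H a

/-- The algebra map `A ⊗ A → Ā ⊗ Ā`, `a ⊗ b ↦ [a₀] ⊗ [b₀]`, where `A ⊗ A` carries the signed
product. -/
def toBarTensor : GradedTensorProduct k 𝒜 𝒜 →ₐ[k] Bar 𝒜 ⊗[k] Bar 𝒜 :=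
  GradedTensorProduct.lift 𝒜 𝒜
    (Algebra.TensorProduct.includeLeft.comp (toBar 𝒜))
    (Algebra.TensorProduct.includeRight.comp (toBar 𝒜))
    (by
      intro i j a b
      fin_cases i <;> fin_cases j
      · change _ = (-1 : ℤˣ) ^ ((0 : ZMod 2) * 0) • _
        rw [mul_zero, uzpow_zero, one_smul]
        simp
      · simp [toBar_odd 𝒜 b.2]
      · simp [toBar_odd 𝒜 a.2]
      · simp [toBar_odd 𝒜 b.2])

lemma toBarTensor_of (t : A ⊗[k] A) :
    toBarTensor 𝒜 (GradedTensorProduct.of k 𝒜 𝒜 t) =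
      TensorProduct.map (toBar 𝒜).toLinearMap (toBar 𝒜).toLinearMap t := by
  induction t with
  | zero => simp
  | add x y hx hy => rw [map_add, map_add, hx, hy, map_add]
  | tmul a b =>
    refine (GradedTensorProduct.lift_tmul _ _ _ _ _ a b).trans ?_
    simp

/-- The cotangent space `W^A = A₁ / A₀⁺A₁` in odd degree, where `A₀⁺ = A₀ ∩ Ker ε`. -/
abbrev oddCotangent [Coalgebra k A] : Type _ :=
  𝒜 1 ⧸ (((𝒜 0 ⊓ LinearMap.ker (Coalgebra.counit (R := k) (A := A))) * 𝒜 1).submoduleOf (𝒜 1))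

end Algebra

section Coalgebra

variable [GradedAlgebra 𝒜] [Coalgebra k A] [IsSuperHopfAlgebra 𝒜]

/-- The counit of `A` as an algebra map. -/
def counitHom : A →ₐ[k] k :=
  AlgHom.ofLinearMap Coalgebra.counit (IsSuperHopfAlgebra.counit_one 𝒜)
    (IsSuperHopfAlgebra.counit_mul 𝒜)

/-- The comultiplication of `A` as an algebra map to `A ⊗ A` with the signed product. -/
def comulHom : A →ₐ[k] GradedTensorProduct k 𝒜 𝒜 :=
  AlgHom.ofLinearMap
    ((GradedTensorProduct.of k 𝒜 𝒜).toLinearMap ∘ₗ Coalgebra.comul)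
    (congrArg (GradedTensorProduct.of k 𝒜 𝒜) (IsSuperHopfAlgebra.comul_one 𝒜))
    (IsSuperHopfAlgebra.comul_mul (𝒜 := 𝒜))

/-- `A → Ā ⊗ Ā`, `a ↦ ∑ ā₍₁₎ ⊗ ā₍₂₎`. -/
def preBarComul : A →ₐ[k] Bar 𝒜 ⊗[k] Bar 𝒜 := (toBarTensor 𝒜).comp (comulHom 𝒜)

lemma preBarComul_apply (a : A) : preBarComul 𝒜 a =
    TensorProduct.map (toBar 𝒜).toLinearMap (toBar 𝒜).toLinearMap (Coalgebra.comul (R := k) a) :=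
  toBarTensor_of 𝒜 _

lemma preBarComul_odd (a : A) (ha : a ∈ 𝒜 1) : preBarComul 𝒜 a = 0 := by
  rw [preBarComul_apply]
  have h := IsSuperHopfAlgebra.comul_parity 1 a ha
  have hle : tensorParity 𝒜 𝒜 1 ≤ LinearMap.ker
      (TensorProduct.map (toBar 𝒜).toLinearMap (toBar 𝒜).toLinearMap) := by
    refine Submodule.span_le.2 ?_
    rintro _ ⟨p, q, hpq, v, hv, w, hw, rfl⟩
    have : ∀ p q : ZMod 2, p + q = 1 → p = 1 ∨ q = 1 := by decide
    replace this := this p q hpq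
    rcases this with rfl | rfl
    · simp [toBar_odd 𝒜 hv]
    · simp [toBar_odd 𝒜 hw]
  exact hle h

/-- The comultiplication of `Ā`, induced from that of `A`: `Δ(ā) = ∑ ā₍₁₎ ⊗ ā₍₂₎`. -/
def barComul : Bar 𝒜 →ₐ[k] Bar 𝒜 ⊗[k] Bar 𝒜 :=
  liftBar 𝒜 (preBarComul 𝒜) (preBarComul_odd 𝒜)

/-- The counit of `Ā`, induced from that of `A`: `ε(ā) = ε(a)`. -/
def barCounit : Bar 𝒜 →ₐ[k] k :=
  liftBar 𝒜 (counitHom 𝒜) IsSuperHopfAlgebra.counit_odd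

lemma barComul_toBar (a : A) : barComul 𝒜 (toBar 𝒜 a) =
    TensorProduct.map (toBar 𝒜).toLinearMap (toBar 𝒜).toLinearMap (Coalgebra.comul (R := k) a) :=
  (liftBar_toBar 𝒜 _ _ a).trans (preBarComul_apply 𝒜 a)

lemma barCounit_toBar (a : A) : barCounit 𝒜 (toBar 𝒜 a) = Coalgebra.counit (R := k) a :=
  liftBar_toBar 𝒜 _ _ a

/-- The bialgebra structure of the ordinary Hopf algebra `Ā`, the quotient of that of `A`. -/
instance : Bialgebra k (Bar 𝒜) :=
  Bialgebra.ofAlgHom (barComul 𝒜) (barCounit 𝒜)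
    (by
      refine bar_algHom_ext 𝒜 fun a => ?_
      have h := congrArg (TensorProduct.map (toBar 𝒜).toLinearMap
        (TensorProduct.map (toBar 𝒜).toLinearMap (toBar 𝒜).toLinearMap))
        (Coalgebra.coassoc_apply (R := k) a)
      simp only [AlgHom.comp_apply, barComul_toBar]
      refine Eq.trans ?_ (h.trans ?_)
      · generalize Coalgebra.comul (R := k) a = t
        induction t with
        | zero => simp
        | add x y hx hy => simp only [map_add, hx, hy]
        | tmul x y =>
          simp only [TensorProduct.map_tmul, AlgHom.toLinearMap_apply,
            Algebra.TensorProduct.map_tmul, barComul_toBar, LinearMap.rTensor_tmul]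
          generalize Coalgebra.comul (R := k) x = u
          induction u with
          | zero => simp
          | add x y hx hy => simp only [map_add, hx, hy, TensorProduct.add_tmul]
          | tmul x y => simp
      · generalize Coalgebra.comul (R := k) a = t
        induction t with
        | zero => simp
        | add x y hx hy => simp only [map_add, hx, hy]
        | tmul x y => simp [barComul_toBar])
    (by
      refine bar_algHom_ext 𝒜 fun a => ?_
      have h := congrArg ((toBar 𝒜).toLinearMap.lTensor k)
        (Coalgebra.rTensor_counit_comul (R := k) a)
      simp only [AlgHom.comp_apply, barComul_toBar]
      refine Eq.trans ?_ (h.trans ?_)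
      · generalize Coalgebra.comul (R := k) a = t
        induction t with
        | zero => simp
        | add x y hx hy => simp only [map_add, hx, hy]
        | tmul x y => simp [barCounit_toBar]
      · simp)
    (by
      refine bar_algHom_ext 𝒜 fun a => ?_
      have h := congrArg ((toBar 𝒜).toLinearMap.rTensor k)
        (Coalgebra.lTensor_counit_comul (R := k) a)
      simp only [AlgHom.comp_apply, barComul_toBar]
      refine Eq.trans ?_ (h.trans ?_)
      · generalize Coalgebra.comul (R := k) a = t
        induction t with
        | zero => simp
        | add x y hx hy => simp only [map_add, hx, hy]
        | tmul x y => simp [barCounit_toBar]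
      · simp)

/-- The left coaction `A → Ā ⊗ A`, `a ↦ ∑ ā₍₁₎ ⊗ a₍₂₎`. -/
def leftCoaction : A →ₗ[k] Bar 𝒜 ⊗[k] A :=
  (toBar 𝒜).toLinearMap.rTensor A ∘ₗ Coalgebra.comul

/-- `φ : A ≃ Ā ⊗ ⋀ W^A` is a counit-preserving isomorphism of super left `Ā`-comodule algebras.
Since `Ā` is purely even, the product of the super algebra `Ā ⊗ ⋀ W^A` involves no signs, and its
component of parity `i` is `Ā` tensored with the span of the `⋀ⁿ W^A` with `n ≡ i` mod 2; its
coaction is `Δ ⊗ id`, and its counit is `ε ⊗ ε`, where `ε` is zero on `W^A`. -/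
structure IsDecomposition
    (φ : A ≃ₐ[k] Bar 𝒜 ⊗[k] ExteriorAlgebra k (oddCotangent 𝒜)) : Prop where
  parity : ∀ (i : ZMod 2), ∀ a ∈ 𝒜 i, φ a ∈ LinearMap.range
    ((CliffordAlgebra.evenOdd (0 : QuadraticForm k (oddCotangent 𝒜)) i).subtype.lTensor (Bar 𝒜))
  colinear : ∀ a : A,
    TensorProduct.assoc k (Bar 𝒜) (Bar 𝒜) (ExteriorAlgebra k (oddCotangent 𝒜))
      ((Coalgebra.comul (R := k) (A := Bar 𝒜)).rTensor _ (φ a)) =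
    φ.toLinearMap.lTensor (Bar 𝒜) (leftCoaction 𝒜 a)
  counit : ∀ a : A,
    Algebra.TensorProduct.lmul' k (S := k) (Algebra.TensorProduct.map
      (Bialgebra.counitAlgHom k (Bar 𝒜)) ExteriorAlgebra.algebraMapInv (φ a)) =
    Coalgebra.counit (R := k) a

end Coalgebra

end Basic

section Functoriality

variable {k A D : Type*} [Field k] [Ring A] [Algebra k A] [Ring D] [Algebra k D]
  (𝒜 : ZMod 2 → Submodule k A) [GradedAlgebra 𝒜] [Coalgebra k A]
  (𝒟 : ZMod 2 → Submodule k D) [GradedAlgebra 𝒟] [Coalgebra k D]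

/-- The map `f̄ : Ā → D̄` induced by a parity-preserving algebra map `f : A → D`. -/
def barMap (f : A →ₐ[k] D) (hf : ∀ (i : ZMod 2), ∀ a ∈ 𝒜 i, f a ∈ 𝒟 i) :
    Bar 𝒜 →ₐ[k] Bar 𝒟 :=
  liftBar 𝒜 ((toBar 𝒟).comp f) fun a ha => toBar_odd 𝒟 (hf 1 a ha)

/-- The map `W^f : W^A → W^D` induced by a parity-preserving, counit-preserving algebra map
`f : A → D`. -/
def oddCotangentMap (f : A →ₐc[k] D) (hf : ∀ (i : ZMod 2), ∀ a ∈ 𝒜 i, f a ∈ 𝒟 i) :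
    oddCotangent 𝒜 →ₗ[k] oddCotangent 𝒟 :=
  Submodule.mapQ _ _ ((f : A →ₐ[k] D).toLinearMap.restrict (hf 1)) (by
    have h : (𝒜 0 ⊓ LinearMap.ker (Coalgebra.counit (R := k) (A := A))) * 𝒜 1 ≤
        ((𝒟 0 ⊓ LinearMap.ker (Coalgebra.counit (R := k) (A := D))) * 𝒟 1).comap
          (f : A →ₐ[k] D).toLinearMap := by
      refine Submodule.mul_le.2 fun a ha b hb => ?_
      have hc : Coalgebra.counit (R := k) (f a) = 0 :=
        (CoalgHomClass.counit_comp_apply f a).trans ha.2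
      have := Submodule.mul_mem_mul (M := 𝒟 0 ⊓ LinearMap.ker (Coalgebra.counit (R := k) (A := D)))
        ⟨hf 0 a ha.1, hc⟩ (hf 1 b hb)
      simpa using this
    exact fun x hx => h hx)

end Functoriality

end SuperHopf

end

open SuperHopf

/-! Regard `A` as the functions on a supergroup, let `I` be the ideal generated by the odd elements,
so that `Ā = A / I`, and write `γ` for the parity automorphism and `p` for the projection to `Ā`. A
linear form `v` on `W^A`, extended by zero to even elements, is an odd `ε`-derivation, and `D_v(a) =
∑ a₍₁₎ v(a₍₂₎)` is the corresponding left-invariant superderivation: `D_v(ab) = a D_v(b) + D_v(a)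
γ(b)`. It commutes with the left coaction.

Take an ordered basis `x_i` of `W^A` with coordinate forms `v_i` and operators `D_i`. The
isomorphism is `p` composed with the ordered product of the operators `1 + R(x_i) D_i`, where `R` is
right multiplication; it sends `a` to the sum over `i₁ < ⋯ < i_r` of `p(D_{i_r} ⋯ D_{i₁} a) ⊗
x_{i_r} ∧ ⋯ ∧ x_{i₁}`. Each factor is multiplicative because `x_i` is odd of square zero
(`partialDecomp_mul`). The basis may be infinite, but every element lies in a finite-dimensional
subcoalgebra, on which almost all `D_i` vanish; hence the finite stages are eventually constant at
each element and define an algebra map `Φ` (`exists_decompHom`).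

Injectivity: contractions on the exterior algebra show that if `Φ(a) = 0` then all ordered iterates
`D_{i_r} ⋯ D_{i₁} a` lie in `I`. The map `oddLift`, `b ↦ ∑ S(b₍₁₎) b₍₂₎` with only the odd part of
`b₍₂₎` kept, turns odd representatives of the `x_j` into elements `z_j` that generate `I` modulo
`I²` and satisfy `D_i z_j ≡ δ_ij` modulo `I`. Reading off leading coefficients, `a` lies in every
power of `I` (`IsDualList.mem_oddPow`). These powers intersect in zero
(`eq_zero_of_forall_mem_oddPow`): one passes to a finitely generated Hopf subalgebra, whose odd
ideal is nilpotent because finitely many odd elements generate it, and odd elements anticommute and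
square to zero in characteristic not 2.

Surjectivity: on a finitely generated Hopf subalgebra `B`, `Φ(b)` agrees with `p(b)` up to terms
involving the `x_i`, and `Φ(oddLift c)` is the class of `c` up to quadratic terms. Nilpotency would
then put everything in the image (`subalgebra_le_of_nilpotent`), except that the `x_i` relevant for
`B` need not be classes of elements of `B`. The basis is therefore adapted to a well-ordered
exhaustion by finite-dimensional Hopf stable subspaces, and well-founded induction applies
(`IsAdaptedSystem.mem_range`).

Naturality: simultaneous echelon reduction (`exists_isEchelon`) provides bases of `W^A` and `W^D`,
padded by zeros and indexed by the same well-ordered set, with `W^f(x_s) = x'_s` unless `x_s = 0`.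
Then `f̄ ⊗ ⋀W^f` carries the product for `A` to the product for `D` factor by factor. The first
assertion is the case of the identity map. -/

noncomputable section

namespace SuperHopf

open Coalgebra WithConv

/-! ### Parity, signs and the signed product on `A ⊗ A` -/

section Parity

variable {k A : Type*} [Field k] [Ring A] [Algebra k A]
  (𝒜 : ZMod 2 → Submodule k A) [GradedAlgebra 𝒜]

/-- The projection of a super algebra onto its component of parity `i`. -/
abbrev proj (i : ZMod 2) : A →ₗ[k] A := GradedAlgebra.proj 𝒜 i

lemma proj_mem (i : ZMod 2) (a : A) : proj 𝒜 i a ∈ 𝒜 i := SetLike.coe_mem _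

lemma proj_of_mem {i : ZMod 2} {a : A} (ha : a ∈ 𝒜 i) : proj 𝒜 i a = a :=
  DirectSum.decompose_of_mem_same 𝒜 ha

lemma proj_of_mem_ne {i j : ZMod 2} {a : A} (ha : a ∈ 𝒜 i) (h : i ≠ j) : proj 𝒜 j a = 0 :=
  DirectSum.decompose_of_mem_ne 𝒜 ha h

lemma proj_zero_of_odd {a : A} (ha : a ∈ 𝒜 1) : proj 𝒜 0 a = 0 :=
  proj_of_mem_ne 𝒜 ha (by decide)

lemma proj_one_of_even {a : A} (ha : a ∈ 𝒜 0) : proj 𝒜 1 a = 0 :=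
  proj_of_mem_ne 𝒜 ha (by decide)

lemma proj_zero_add_proj_one (a : A) : proj 𝒜 0 a + proj 𝒜 1 a = a := by
  obtain ⟨x, hx, y, hy, rfl⟩ := exists_even_add_odd 𝒜 a
  rw [map_add, map_add, proj_of_mem 𝒜 hx, proj_of_mem 𝒜 hy, proj_zero_of_odd 𝒜 hy,
    proj_one_of_even 𝒜 hx, add_zero, zero_add]

lemma proj_zero_eq (a : A) : proj 𝒜 0 a = a - proj 𝒜 1 a :=
  eq_sub_of_add_eq (proj_zero_add_proj_one 𝒜 a)

lemma mul_mem_even {a b : A} (ha : a ∈ 𝒜 0) (hb : b ∈ 𝒜 0) : a * b ∈ 𝒜 0 := by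
  simpa using SetLike.mul_mem_graded ha hb

lemma mul_mem_odd_left {a b : A} (ha : a ∈ 𝒜 1) (hb : b ∈ 𝒜 0) : a * b ∈ 𝒜 1 := by
  simpa using SetLike.mul_mem_graded ha hb

lemma mul_mem_odd_right {a b : A} (ha : a ∈ 𝒜 0) (hb : b ∈ 𝒜 1) : a * b ∈ 𝒜 1 := by
  simpa using SetLike.mul_mem_graded ha hb

lemma mul_mem_even_of_odd {a b : A} (ha : a ∈ 𝒜 1) (hb : b ∈ 𝒜 1) : a * b ∈ 𝒜 0 :=
  SetLike.mul_mem_graded ha hb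

lemma one_mem_even : (1 : A) ∈ 𝒜 0 := SetLike.GradedOne.one_mem

lemma algebraMap_mem_even (r : k) : algebraMap k A r ∈ 𝒜 0 := by
  rw [Algebra.algebraMap_eq_smul_one]; exact (𝒜 0).smul_mem _ (one_mem_even 𝒜)

/-- The parity automorphism `a ↦ (-1)^{|a|} a`. -/
def parityAut : A →ₐ[k] A :=
  AlgHom.ofLinearMap (proj 𝒜 0 - proj 𝒜 1)
    (by
      rw [LinearMap.sub_apply, proj_of_mem 𝒜 (one_mem_even 𝒜),
        proj_one_of_even 𝒜 (one_mem_even 𝒜), sub_zero])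
    (by
      intro a b
      obtain ⟨a₀, ha₀, a₁, ha₁, rfl⟩ := exists_even_add_odd 𝒜 a
      obtain ⟨b₀, hb₀, b₁, hb₁, rfl⟩ := exists_even_add_odd 𝒜 b
      have h00 := mul_mem_even 𝒜 ha₀ hb₀
      have h01 := mul_mem_odd_right 𝒜 ha₀ hb₁
      have h10 := mul_mem_odd_left 𝒜 ha₁ hb₀
      have h11 := mul_mem_even_of_odd 𝒜 ha₁ hb₁
      simp only [add_mul, mul_add, map_add, LinearMap.sub_apply, proj_of_mem 𝒜 ha₀,
        proj_of_mem 𝒜 ha₁, proj_of_mem 𝒜 hb₀, proj_of_mem 𝒜 hb₁, proj_of_mem 𝒜 h00,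
        proj_of_mem 𝒜 h01, proj_of_mem 𝒜 h10, proj_of_mem 𝒜 h11, proj_zero_of_odd 𝒜 ha₁,
        proj_zero_of_odd 𝒜 hb₁, proj_zero_of_odd 𝒜 h01, proj_zero_of_odd 𝒜 h10,
        proj_one_of_even 𝒜 ha₀, proj_one_of_even 𝒜 hb₀, proj_one_of_even 𝒜 h00,
        proj_one_of_even 𝒜 h11, sub_mul, mul_sub]
      simp only [zero_mul, mul_zero]
      abel)

lemma parityAut_apply (a : A) : parityAut 𝒜 a = proj 𝒜 0 a - proj 𝒜 1 a := rfl

lemma parityAut_even {a : A} (ha : a ∈ 𝒜 0) : parityAut 𝒜 a = a := by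
  rw [parityAut_apply, proj_of_mem 𝒜 ha, proj_one_of_even 𝒜 ha, sub_zero]

lemma parityAut_odd {a : A} (ha : a ∈ 𝒜 1) : parityAut 𝒜 a = -a := by
  rw [parityAut_apply, proj_of_mem 𝒜 ha, proj_zero_of_odd 𝒜 ha, zero_sub]

lemma parityAut_parityAut (a : A) : parityAut 𝒜 (parityAut 𝒜 a) = a := by
  rw [parityAut_apply 𝒜 a, map_sub, parityAut_even 𝒜 (proj_mem 𝒜 0 a),
    parityAut_odd 𝒜 (proj_mem 𝒜 1 a), sub_neg_eq_add, proj_zero_add_proj_one]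

lemma proj_one_parityAut (a : A) : proj 𝒜 1 (parityAut 𝒜 a) = -proj 𝒜 1 a := by
  rw [parityAut_apply, map_sub, proj_one_of_even 𝒜 (proj_mem 𝒜 0 a),
    proj_of_mem 𝒜 (proj_mem 𝒜 1 a), zero_sub]

lemma proj_zero_parityAut (a : A) : proj 𝒜 0 (parityAut 𝒜 a) = proj 𝒜 0 a := by
  rw [parityAut_apply, map_sub, proj_zero_of_odd 𝒜 (proj_mem 𝒜 1 a),
    proj_of_mem 𝒜 (proj_mem 𝒜 0 a), sub_zero]

variable {𝒜} in
lemma mem_even_of_parityAut (hk : (2 : k) ≠ 0) {a : A} (h : parityAut 𝒜 a = a) : a ∈ 𝒜 0 := by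
  have h1 : proj 𝒜 1 a = -proj 𝒜 1 a := by rw [← proj_one_parityAut, h]
  have h2 : (2 : k) • proj 𝒜 1 a = 0 := by rw [two_smul]; nth_rw 1 [h1]; simp
  rw [smul_eq_zero] at h2
  rw [← proj_zero_add_proj_one 𝒜 a, h2.resolve_left hk, add_zero]
  exact proj_mem 𝒜 0 a

variable {𝒜} in
lemma mem_odd_of_parityAut (hk : (2 : k) ≠ 0) {a : A} (h : parityAut 𝒜 a = -a) : a ∈ 𝒜 1 := by
  have h1 : -proj 𝒜 0 a = proj 𝒜 0 a := by rw [← map_neg, ← h, proj_zero_parityAut]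
  have h2 : (2 : k) • proj 𝒜 0 a = 0 := by rw [two_smul]; nth_rw 1 [← h1]; simp
  rw [smul_eq_zero] at h2
  rw [← proj_zero_add_proj_one 𝒜 a, h2.resolve_left hk, zero_add]
  exact proj_mem 𝒜 1 a

lemma two_smul_proj_one (a : A) : (2 : k) • proj 𝒜 1 a = a - parityAut 𝒜 a := by
  rw [parityAut_apply, two_smul]
  nth_rw 3 [← proj_zero_add_proj_one 𝒜 a]
  abel

/-- Twice the odd projection is `1 - γ`, so away from characteristic 2 the graded subspaces are the
`γ`-stable ones. Stability under the algebra map `γ` is easier to propagate through products and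
`Δ`. -/
lemma proj_mem_of_parityAut_mem (hk : (2 : k) ≠ 0) {P : Submodule k A}
    (hP : ∀ a ∈ P, parityAut 𝒜 a ∈ P) (i : ZMod 2) : ∀ a ∈ P, proj 𝒜 i a ∈ P := by
  have h1 : ∀ a ∈ P, proj 𝒜 1 a ∈ P := fun a ha => by
    rw [← P.smul_mem_iff hk, two_smul_proj_one]
    exact P.sub_mem ha (hP a ha)
  intro a ha
  fin_cases i
  · change proj 𝒜 0 a ∈ P
    rw [proj_zero_eq]
    exact P.sub_mem ha (h1 a ha)
  · exact h1 a ha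

section Commutative

variable [IsSuperCommutative 𝒜]

/-- Super commutativity without signs: the second factor need not be homogeneous, which lets odd
elements be moved past subspaces. -/
lemma odd_mul {z : A} (hz : z ∈ 𝒜 1) (a : A) : z * a = parityAut 𝒜 a * z := by
  rw [parityAut_apply, sub_mul]
  nth_rw 1 [← proj_zero_add_proj_one 𝒜 a]
  have h0 := IsSuperCommutative.mul_comm' (𝒜 := 𝒜) 1 0 z _ hz (proj_mem 𝒜 0 a)
  have h1 := IsSuperCommutative.mul_comm' (𝒜 := 𝒜) 1 1 z _ hz (proj_mem 𝒜 1 a)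
  rw [mul_zero, uzpow_zero, one_smul] at h0
  rw [mul_one, uzpow_one, Units.neg_smul, one_smul] at h1
  rw [mul_add, h0, h1, sub_eq_add_neg]

lemma odd_mul_odd {x y : A} (hx : x ∈ 𝒜 1) (hy : y ∈ 𝒜 1) : x * y = -(y * x) := by
  rw [odd_mul 𝒜 hx, parityAut_odd 𝒜 hy, neg_mul]

lemma even_mul {z : A} (hz : z ∈ 𝒜 0) (a : A) : z * a = a * z := by
  nth_rw 1 [← proj_zero_add_proj_one 𝒜 a]
  have h0 := IsSuperCommutative.mul_comm' (𝒜 := 𝒜) 0 0 z _ hz (proj_mem 𝒜 0 a)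
  have h1 := IsSuperCommutative.mul_comm' (𝒜 := 𝒜) 0 1 z _ hz (proj_mem 𝒜 1 a)
  rw [zero_mul, uzpow_zero, one_smul] at h0 h1
  rw [mul_add, h0, h1, ← add_mul, proj_zero_add_proj_one]

lemma odd_mul_self (hk : (2 : k) ≠ 0) {z : A} (hz : z ∈ 𝒜 1) : z * z = 0 := by
  have h := odd_mul 𝒜 hz z
  rw [parityAut_odd 𝒜 hz, neg_mul] at h
  have h2 : (2 : k) • (z * z) = 0 := by rw [two_smul]; nth_rw 1 [h]; simp
  exact (smul_eq_zero.1 h2).resolve_left hk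

end Commutative

/-- The signed product `(a ⊗ b)(c ⊗ d) = (-1)^{|b||c|} ac ⊗ bd` of `A ⊗ A`. -/
def signedMul : A ⊗[k] A →ₗ[k] A ⊗[k] A →ₗ[k] A ⊗[k] A := GradedTensorProduct.mulHom 𝒜 𝒜

lemma of_signedMul (s t : A ⊗[k] A) :
    GradedTensorProduct.of k 𝒜 𝒜 (signedMul 𝒜 s t) =
      GradedTensorProduct.of k 𝒜 𝒜 s * GradedTensorProduct.of k 𝒜 𝒜 t := rfl

lemma signedMul_even (a c d : A) {b : A} (hb : b ∈ 𝒜 0) :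
    signedMul 𝒜 (a ⊗ₜ b) (c ⊗ₜ d) = (a * c) ⊗ₜ (b * d) := by
  apply (GradedTensorProduct.of k 𝒜 𝒜).injective
  rw [of_signedMul]
  nth_rw 1 [← proj_zero_add_proj_one 𝒜 c]
  rw [TensorProduct.add_tmul, map_add, mul_add]
  refine (congrArg₂ (· + ·)
    (GradedTensorProduct.tmul_zero_coe_mul_coe_tmul 𝒜 𝒜 a ⟨b, hb⟩ ⟨_, proj_mem 𝒜 0 c⟩ d)
    (GradedTensorProduct.tmul_zero_coe_mul_coe_tmul 𝒜 𝒜 a ⟨b, hb⟩ ⟨_, proj_mem 𝒜 1 c⟩ d)).trans ?_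
  simp only
  rw [← map_add, ← TensorProduct.add_tmul, ← mul_add, proj_zero_add_proj_one]

lemma signedMul_odd (a c d : A) {b : A} (hb : b ∈ 𝒜 1) :
    signedMul 𝒜 (a ⊗ₜ b) (c ⊗ₜ d) = (a * parityAut 𝒜 c) ⊗ₜ (b * d) := by
  apply (GradedTensorProduct.of k 𝒜 𝒜).injective
  rw [of_signedMul]
  nth_rw 1 [← proj_zero_add_proj_one 𝒜 c]
  rw [TensorProduct.add_tmul, map_add, mul_add]
  refine (congrArg₂ (· + ·)
    (GradedTensorProduct.tmul_coe_mul_coe_tmul 𝒜 𝒜 a ⟨b, hb⟩ ⟨_, proj_mem 𝒜 0 c⟩ d)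
    (GradedTensorProduct.tmul_coe_mul_coe_tmul 𝒜 𝒜 a ⟨b, hb⟩ ⟨_, proj_mem 𝒜 1 c⟩ d)).trans ?_
  simp only
  rw [mul_zero, uzpow_zero, one_smul, mul_one, uzpow_one, Units.neg_smul, one_smul,
    ← sub_eq_add_neg, ← map_sub, ← TensorProduct.sub_tmul, ← mul_sub, parityAut_apply]

lemma signedMul_tmul (a b c d : A) : signedMul 𝒜 (a ⊗ₜ b) (c ⊗ₜ d) =
    (a * c) ⊗ₜ (proj 𝒜 0 b * d) + (a * parityAut 𝒜 c) ⊗ₜ (proj 𝒜 1 b * d) := by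
  nth_rw 1 [← proj_zero_add_proj_one 𝒜 b]
  rw [TensorProduct.tmul_add, map_add, LinearMap.add_apply,
    signedMul_even 𝒜 a c d (proj_mem 𝒜 0 b), signedMul_odd 𝒜 a c d (proj_mem 𝒜 1 b)]

section Hopf

variable [Coalgebra k A] [IsSuperHopfAlgebra 𝒜]

lemma counit_odd {a : A} (ha : a ∈ 𝒜 1) : counit (R := k) a = 0 :=
  IsSuperHopfAlgebra.counit_odd a ha

lemma counit_proj_one (a : A) : counit (R := k) (proj 𝒜 1 a) = 0 :=
  counit_odd 𝒜 (proj_mem 𝒜 1 a)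

lemma counit_proj_zero (a : A) : counit (R := k) (proj 𝒜 0 a) = counit (R := k) a := by
  rw [proj_zero_eq, map_sub, counit_proj_one, sub_zero]

lemma counit_parityAut (a : A) : counit (R := k) (parityAut 𝒜 a) = counit (R := k) a := by
  rw [parityAut_apply, map_sub, counit_proj_one, sub_zero, counit_proj_zero]

lemma comul_mul (a b : A) :
    comul (R := k) (a * b) = signedMul 𝒜 (comul (R := k) a) (comul (R := k) b) :=
  IsSuperHopfAlgebra.comul_mul (𝒜 := 𝒜) a b

/-- `Δ` preserves parity, and `γ ⊗ γ` acts on a tensor by the sign of its total parity. -/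
lemma comul_parityAut (a : A) : comul (R := k) (parityAut 𝒜 a) =
    TensorProduct.map (parityAut 𝒜).toLinearMap (parityAut 𝒜).toLinearMap
      (comul (R := k) a) := by
  have key : ∀ (i : ZMod 2) (t : A ⊗[k] A), t ∈ tensorParity 𝒜 𝒜 i →
      TensorProduct.map (parityAut 𝒜).toLinearMap (parityAut 𝒜).toLinearMap t =
        if i = 0 then t else -t := by
    intro i t ht
    refine Submodule.span_induction ?_ (by simp) (fun x y _ _ hx hy => ?_)
      (fun c x _ hx => ?_) ht
    · rintro _ ⟨p, q, rfl, v, hv, w, hw, rfl⟩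
      have h01 : ∀ p : ZMod 2, p = 0 ∨ p = 1 := by decide
      rcases h01 p with rfl | rfl <;> rcases h01 q with rfl | rfl
      · simp [parityAut_even 𝒜 hv, parityAut_even 𝒜 hw]
      · simp [parityAut_even 𝒜 hv, parityAut_odd 𝒜 hw, TensorProduct.tmul_neg]
      · simp [parityAut_odd 𝒜 hv, parityAut_even 𝒜 hw, TensorProduct.neg_tmul]
      · rw [if_pos (by decide), TensorProduct.map_tmul, AlgHom.toLinearMap_apply,
          AlgHom.toLinearMap_apply, parityAut_odd 𝒜 hv, parityAut_odd 𝒜 hw,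
          TensorProduct.neg_tmul, TensorProduct.tmul_neg, neg_neg]
    · rw [map_add, hx, hy]; split_ifs <;> abel
    · rw [map_smul, hx]; split_ifs <;> simp
  obtain ⟨x, hx, y, hy, rfl⟩ := exists_even_add_odd 𝒜 a
  rw [map_add, map_add, map_add, map_add, parityAut_even 𝒜 hx, parityAut_odd 𝒜 hy,
    key 0 _ (IsSuperHopfAlgebra.comul_parity 0 x hx),
    key 1 _ (IsSuperHopfAlgebra.comul_parity 1 y hy)]
  simp

end Hopf

end Parity

/-! ### Convolution products on subspaces -/

section Convolution

variable {k A R : Type*} [Field k] [AddCommGroup A] [Module k A] [Coalgebra k A] [Ring R]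
  [Algebra k R]

lemma convMul_mem {P Q : Submodule k A} {a : A}
    (ha : comul (R := k) a ∈ Submodule.map₂ (TensorProduct.mk k A A) P Q) (f g : A →ₗ[k] R) :
    (toConv f * toConv g) a ∈ P.map f * Q.map g := by
  have h : Submodule.map₂ (TensorProduct.mk k A A) P Q ≤
      (P.map f * Q.map g).comap (LinearMap.mul' k R ∘ₗ TensorProduct.map f g) :=
    Submodule.map₂_le.2 fun x hx y hy =>
      Submodule.mul_mem_mul (Submodule.mem_map_of_mem hx) (Submodule.mem_map_of_mem hy)
  exact h ha

end Convolution

/-! ### The antipode of a super commutative Hopf algebra -/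

section Antipode

variable {k A : Type*} [Field k] [Ring A] [Algebra k A]
  (𝒜 : ZMod 2 → Submodule k A) [GradedAlgebra 𝒜] [Coalgebra k A]

/-- A parity-preserving convolution inverse of the identity. -/
structure IsAntipode (S : A →ₗ[k] A) : Prop where
  map_parityAut : ∀ a, S (parityAut 𝒜 a) = parityAut 𝒜 (S a)
  left_inv : toConv S * toConv LinearMap.id = 1
  right_inv : toConv LinearMap.id * toConv S = 1

variable [IsSuperHopfAlgebra 𝒜]

lemma exists_isAntipode : ∃ S : A →ₗ[k] A, IsAntipode 𝒜 S := by
  obtain ⟨S, hS, hl, hr⟩ := IsSuperHopfAlgebra.exists_antipode (k := k) (𝒜 := 𝒜)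
  refine ⟨S, fun a => ?_, ofConv_injective hl, ofConv_injective hr⟩
  obtain ⟨x, hx, y, hy, rfl⟩ := exists_even_add_odd 𝒜 a
  simp only [map_add, parityAut_even 𝒜 hx, parityAut_odd 𝒜 hy, parityAut_even 𝒜 (hS 0 x hx),
    parityAut_odd 𝒜 (hS 1 y hy), map_neg]

/-- `a ↦ a ⊗ 1`. -/
abbrev inl : A →ₐ[k] GradedTensorProduct k 𝒜 𝒜 := GradedTensorProduct.includeLeft 𝒜 𝒜

/-- `a ↦ 1 ⊗ a`. -/
abbrev inr : A →ₐ[k] GradedTensorProduct k 𝒜 𝒜 := GradedTensorProduct.includeRight 𝒜 𝒜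

lemma inl_mul_inr (a b : A) :
    inl 𝒜 a * inr 𝒜 b = GradedTensorProduct.of k 𝒜 𝒜 (a ⊗ₜ b) := by
  refine (signedMul_even 𝒜 a 1 b (one_mem_even 𝒜)).trans ?_
  rw [mul_one, one_mul]; rfl

lemma inr_mul_inl (a b : A) : inr 𝒜 a * inl 𝒜 b = GradedTensorProduct.of k 𝒜 𝒜
    (b ⊗ₜ proj 𝒜 0 a + parityAut 𝒜 b ⊗ₜ proj 𝒜 1 a) := by
  refine (signedMul_tmul 𝒜 1 a b 1).trans ?_
  rw [mul_one, mul_one, one_mul, one_mul]; rfl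

lemma conv_inl_inr : toConv (inl 𝒜).toLinearMap * toConv (inr 𝒜).toLinearMap =
    toConv (comulHom 𝒜).toLinearMap := by
  ext a
  rw [LinearMap.convMul_apply]
  change _ = GradedTensorProduct.of k 𝒜 𝒜 (comul (R := k) a)
  generalize comul (R := k) a = t
  induction t with
  | zero => simp
  | add x y hx hy => simp only [map_add, hx, hy]
  | tmul x y =>
    simpa using inl_mul_inr 𝒜 x y

variable {𝒜} {S : A →ₗ[k] A}

lemma comp_antipode_mul {R : Type*} [Ring R] [Algebra k R] (hS : IsAntipode 𝒜 S) (g : A →ₐ[k] R) :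
    toConv (g.toLinearMap ∘ₗ S) * toConv g.toLinearMap = 1 := by
  have h := LinearMap.algHom_comp_convMul_distrib g (toConv S) (toConv LinearMap.id)
  rw [hS.left_inv] at h
  apply ofConv_injective
  refine h.symm.trans ?_
  ext a
  exact g.commutes _

lemma mul_comp_antipode {R : Type*} [Ring R] [Algebra k R] (hS : IsAntipode 𝒜 S) (g : A →ₐ[k] R) :
    toConv g.toLinearMap * toConv (g.toLinearMap ∘ₗ S) = 1 := by
  have h := LinearMap.algHom_comp_convMul_distrib g (toConv LinearMap.id) (toConv S)
  rw [hS.right_inv] at h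
  apply ofConv_injective
  refine h.symm.trans ?_
  ext a
  exact g.commutes _

/-- The antipode reverses the comultiplication. -/
lemma comul_antipode (hS : IsAntipode 𝒜 S) :
    toConv ((comulHom 𝒜).toLinearMap ∘ₗ S) =
      toConv ((inr 𝒜).toLinearMap ∘ₗ S) * toConv ((inl 𝒜).toLinearMap ∘ₗ S) := by
  -- Both sides are convolution inverses of `Δ`: the left one because `Δ` is an algebra map, the
  -- right one because `Δ` is the convolution product of `a ↦ a ⊗ 1` and `a ↦ 1 ⊗ a`.
  refine left_inv_eq_right_inv (comp_antipode_mul hS (comulHom 𝒜)) ?_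
  rw [← conv_inl_inr, mul_assoc, ← mul_assoc _ _ (toConv ((inl 𝒜).toLinearMap ∘ₗ S)),
    mul_comp_antipode hS, one_mul, mul_comp_antipode hS]

/-- Reversing the two legs of `Δ` costs a sign, which splits the leg `S(x)` into its components and
applies `γ` to `S(y)`; this is why `D` has to be graded. -/
lemma comul_antipode_mem (hS : IsAntipode 𝒜 S) {C D : Submodule k A}
    (hC : ∀ a ∈ C, comul (R := k) a ∈ Submodule.map₂ (TensorProduct.mk k A A) C C)
    (hD : ∀ i, ∀ a ∈ D, proj 𝒜 i a ∈ D) (hCD : ∀ a ∈ C, S a ∈ D) {a : A} (ha : a ∈ C) :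
    comul (R := k) (S a) ∈ Submodule.map₂ (TensorProduct.mk k A A) D D := by
  have h := convMul_mem (hC a ha) ((inr 𝒜).toLinearMap ∘ₗ S) ((inl 𝒜).toLinearMap ∘ₗ S)
  rw [← comul_antipode hS] at h
  have hle : C.map ((inr 𝒜).toLinearMap ∘ₗ S) * C.map ((inl 𝒜).toLinearMap ∘ₗ S) ≤
      (Submodule.map₂ (TensorProduct.mk k A A) D D).map
        (GradedTensorProduct.of k 𝒜 𝒜).toLinearMap := by
    refine Submodule.mul_le.2 ?_
    rintro _ ⟨x, hx, rfl⟩ _ ⟨y, hy, rfl⟩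
    refine ⟨_, ?_, (inr_mul_inl 𝒜 (S x) (S y)).symm⟩
    have hy' := hCD y hy
    have hx' := hCD x hx
    refine Submodule.add_mem _ (Submodule.apply_mem_map₂ _ hy' (hD 0 _ hx'))
      (Submodule.apply_mem_map₂ _ ?_ (hD 1 _ hx'))
    rw [parityAut_apply]
    exact D.sub_mem (hD 0 _ hy') (hD 1 _ hy')
  obtain ⟨t, ht, h'⟩ := hle h
  exact ((GradedTensorProduct.of k 𝒜 𝒜).injective h') ▸ ht

section Commutative

variable [IsSuperCommutative 𝒜]

lemma signedMul_one_tmul_even {b : A} (hb : b ∈ 𝒜 0) (t : A ⊗[k] A) :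
    signedMul 𝒜 (1 ⊗ₜ b) t = signedMul 𝒜 t (1 ⊗ₜ b) := by
  induction t with
  | zero => simp
  | add x y hx hy => simp only [map_add, hx, hy, LinearMap.add_apply]
  | tmul x y =>
    rw [signedMul_even 𝒜 1 x y hb, signedMul_tmul, even_mul 𝒜 hb, map_one, mul_one, one_mul,
      ← TensorProduct.tmul_add, ← add_mul, proj_zero_add_proj_one]

lemma signedMul_one_tmul_odd {b : A} (hb : b ∈ 𝒜 1) (t : A ⊗[k] A) :
    signedMul 𝒜 (1 ⊗ₜ b) t = signedMul 𝒜 (TensorProduct.map (parityAut 𝒜).toLinearMap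
      (parityAut 𝒜).toLinearMap t) (1 ⊗ₜ b) := by
  induction t with
  | zero => simp
  | add x y hx hy => simp only [map_add, hx, hy, LinearMap.add_apply]
  | tmul x y =>
    rw [signedMul_odd 𝒜 1 x y hb, TensorProduct.map_tmul, signedMul_tmul, odd_mul 𝒜 hb, map_one,
      mul_one, one_mul, ← TensorProduct.tmul_add, ← add_mul, proj_zero_add_proj_one]
    rfl

lemma signedMul_assoc (r s t : A ⊗[k] A) :
    signedMul 𝒜 (signedMul 𝒜 r s) t = signedMul 𝒜 r (signedMul 𝒜 s t) :=
  mul_assoc (GradedTensorProduct.of k 𝒜 𝒜 r) (GradedTensorProduct.of k 𝒜 𝒜 s)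
    (GradedTensorProduct.of k 𝒜 𝒜 t)

variable (𝒜) in
/-- The canonical Galois map `a ⊗ b ↦ ∑ a₍₁₎ ⊗ a₍₂₎ b`. -/
def galoisMap : A ⊗[k] A →ₗ[k] A ⊗[k] A :=
  TensorProduct.lift ((signedMul 𝒜).compl₁₂ comul (TensorProduct.mk k A A 1))

lemma galoisMap_tmul (a b : A) :
    galoisMap 𝒜 (a ⊗ₜ b) = signedMul 𝒜 (comul (R := k) a) (1 ⊗ₜ b) := rfl

lemma signedMul_one_tmul (t : A ⊗[k] A) (b : A) : signedMul 𝒜 t (1 ⊗ₜ b) =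
    (LinearMap.mul' k A).lTensor A (TensorProduct.assoc k A A A (t ⊗ₜ b)) := by
  induction t with
  | zero => simp
  | add x y hx hy => simp only [map_add, hx, hy, LinearMap.add_apply, TensorProduct.add_tmul]
  | tmul x y =>
    rw [signedMul_tmul, map_one, mul_one, ← TensorProduct.tmul_add, ← add_mul,
      proj_zero_add_proj_one]
    simp

/-- Super commutativity makes this work: the odd part of `1 ⊗ b` moves past `Δ(c)` at the cost of `γ
⊗ γ`, which is `Δ(γ c)`, the same sign as in the product of the source. -/
lemma galoisMap_signedMul (s t : A ⊗[k] A) :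
    galoisMap 𝒜 (signedMul 𝒜 s t) = signedMul 𝒜 (galoisMap 𝒜 s) (galoisMap 𝒜 t) := by
  induction s with
  | zero => simp
  | add x y hx hy => simp only [map_add, hx, hy, LinearMap.add_apply]
  | tmul a b =>
  induction t with
  | zero => simp
  | add x y hx hy => simp only [map_add, hx, hy]
  | tmul c d =>
    rw [signedMul_tmul, map_add, galoisMap_tmul, galoisMap_tmul, galoisMap_tmul, galoisMap_tmul]
    nth_rw 3 [← proj_zero_add_proj_one 𝒜 b]
    have e : ∀ x : A, (1 : A) ⊗ₜ[k] (x * d) = signedMul 𝒜 (1 ⊗ₜ x) (1 ⊗ₜ d) := fun x => by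
      rw [signedMul_tmul, map_one, mul_one, ← TensorProduct.tmul_add, ← add_mul,
        proj_zero_add_proj_one]
    rw [TensorProduct.tmul_add, map_add, map_add, LinearMap.add_apply, comul_mul 𝒜, comul_mul 𝒜,
      e, e, comul_parityAut, signedMul_assoc (comul (R := k) a) (1 ⊗ₜ _) _,
      signedMul_assoc (comul (R := k) a) (1 ⊗ₜ _) _,
      ← signedMul_assoc (1 ⊗ₜ _) (comul (R := k) c), ← signedMul_assoc (1 ⊗ₜ _) (comul (R := k) c),
      signedMul_one_tmul_even (proj_mem 𝒜 0 b) (comul c),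
      signedMul_one_tmul_odd (proj_mem 𝒜 1 b) (comul c)]
    simp only [signedMul_assoc]

lemma galoisMap_lTensor_antipode (hS : IsAntipode 𝒜 S) (a : A) :
    galoisMap 𝒜 (S.lTensor A (comul (R := k) a)) = a ⊗ₜ 1 := by
  have h1 : galoisMap 𝒜 ∘ₗ S.lTensor A = (LinearMap.mul' k A ∘ₗ S.lTensor A).lTensor A ∘ₗ
      (TensorProduct.assoc k A A A).toLinearMap ∘ₗ (comul (R := k)).rTensor A := by
    ext x y
    simp only [TensorProduct.AlgebraTensorModule.curry_apply, LinearMap.restrictScalars_self,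
      TensorProduct.curry_apply, LinearMap.comp_apply, LinearMap.lTensor_tmul, galoisMap_tmul,
      signedMul_one_tmul, LinearMap.rTensor_tmul]
    generalize comul (R := k) x = t
    induction t with
    | zero => simp
    | add x y hx hy => simp only [map_add, hx, hy, TensorProduct.add_tmul]
    | tmul x y => simp
  have h2 := congrArg (fun f => f (comul (R := k) a)) h1
  simp only [LinearMap.comp_apply] at h2
  rw [h2, LinearEquiv.coe_coe, coassoc_apply, ← LinearMap.comp_apply, ← LinearMap.lTensor_comp]
  have h3 : (LinearMap.mul' k A ∘ₗ S.lTensor A) ∘ₗ comul = Algebra.linearMap k A ∘ₗ counit :=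
    congrArg ofConv hS.right_inv
  rw [h3, LinearMap.lTensor_comp, LinearMap.comp_apply, lTensor_counit_comul]
  simp

/-- A left inverse is `a ⊗ b ↦ ∑ a₍₁₎ ⊗ S(a₍₂₎) b`. -/
lemma galoisMap_injective (hS : IsAntipode 𝒜 S) : Function.Injective (galoisMap 𝒜) := by
  let g : A ⊗[k] A →ₗ[k] A ⊗[k] A := (LinearMap.mul' k A ∘ₗ S.rTensor A).lTensor A ∘ₗ
      (TensorProduct.assoc k A A A).toLinearMap ∘ₗ (comul (R := k)).rTensor A
  refine Function.LeftInverse.injective (g := g) fun t => ?_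
  induction t with
  | zero => simp
  | add x y hx hy => simp only [map_add, hx, hy]
  | tmul a b =>
    have h3 : (LinearMap.mul' k A ∘ₗ S.rTensor A) ∘ₗ comul = Algebra.linearMap k A ∘ₗ counit :=
      congrArg ofConv hS.left_inv
    let q : A ⊗[k] (A ⊗[k] A) →ₗ[k] A ⊗[k] A :=
      LinearMap.lTensor A ((LinearMap.mul k A).flip b ∘ₗ LinearMap.mul' k A ∘ₗ S.rTensor A)
    have h4 : ∀ t : A ⊗[k] A, g (signedMul 𝒜 t (1 ⊗ₜ b)) =
        q (TensorProduct.assoc k A A A ((comul (R := k)).rTensor A t)) := by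
      intro t
      induction t with
      | zero => simp
      | add x y hx hy => simp only [map_add, hx, hy, LinearMap.add_apply]
      | tmul x y =>
        simp only [signedMul_one_tmul, TensorProduct.assoc_tmul, LinearMap.lTensor_tmul,
          LinearMap.mul'_apply, g, LinearMap.comp_apply, LinearMap.rTensor_tmul,
          LinearEquiv.coe_coe]
        generalize comul (R := k) x = u
        induction u with
        | zero => simp
        | add x y hx hy => simp only [map_add, hx, hy, TensorProduct.add_tmul]
        | tmul x z => simp [q, mul_assoc]
    rw [galoisMap_tmul, h4, coassoc_apply]
    simp only [q]
    rw [← LinearMap.comp_apply, ← LinearMap.lTensor_comp, LinearMap.comp_assoc, h3,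
      ← LinearMap.comp_assoc, LinearMap.lTensor_comp, LinearMap.comp_apply, lTensor_counit_comul]
    simp

/-- The element `∑ a₍₁₎ ⊗ S(a₍₂₎)` is the only preimage of `a ⊗ 1` under the Galois map, which is
injective and multiplicative; hence it is multiplicative in `a`, and applying `ε` to the first leg
recovers `S`. -/
lemma antipode_mul (hS : IsAntipode 𝒜 S) (a b : A) : S (a * b) = S a * S b := by
  have h : S.lTensor A (comul (R := k) (a * b)) =
      signedMul 𝒜 (S.lTensor A (comul (R := k) a)) (S.lTensor A (comul (R := k) b)) := by
    apply galoisMap_injective hS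
    rw [galoisMap_signedMul, galoisMap_lTensor_antipode hS, galoisMap_lTensor_antipode hS,
      galoisMap_lTensor_antipode hS, signedMul_even 𝒜 a b 1 (one_mem_even 𝒜), mul_one]
  let L : A ⊗[k] A →ₗ[k] A := (TensorProduct.lid k A).toLinearMap ∘ₗ counit.rTensor A
  have hL : ∀ s t, L (signedMul 𝒜 s t) = L s * L t := by
    intro s t
    induction s with
    | zero => simp
    | add x y hx hy => simp only [map_add, hx, hy, LinearMap.add_apply, add_mul]
    | tmul a b =>
    induction t with
    | zero => simp
    | add x y hx hy => simp only [map_add, hx, hy, mul_add]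
    | tmul c d =>
      rw [signedMul_tmul]
      simp only [L, map_add, LinearMap.comp_apply, LinearMap.rTensor_tmul, LinearEquiv.coe_coe,
        TensorProduct.lid_tmul, IsSuperHopfAlgebra.counit_mul (𝒜 := 𝒜), counit_parityAut]
      rw [← smul_add, ← add_mul, proj_zero_add_proj_one, smul_mul_smul_comm]
  have hLS : ∀ a, L (S.lTensor A (comul (R := k) a)) = S a := by
    intro a
    have e : ∀ t : A ⊗[k] A, L (S.lTensor A t) =
        S (TensorProduct.lid k A (counit.rTensor A t)) := by
      intro t
      induction t with
      | zero => simp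
      | add x y hx hy => simp only [map_add, hx, hy]
      | tmul x y => simp [L]
    rw [e, rTensor_counit_comul]; simp
  rw [← hLS, h, hL, hLS, hLS]

lemma antipode_one (hS : IsAntipode 𝒜 S) : S 1 = 1 := by
  have h := congrArg (fun f : WithConv (A →ₗ[k] A) => f.ofConv 1) hS.left_inv
  change LinearMap.mul' k A (TensorProduct.map S LinearMap.id (comul (R := k) (1 : A))) =
    algebraMap k A (counit (R := k) (1 : A)) at h
  rw [IsSuperHopfAlgebra.comul_one 𝒜, IsSuperHopfAlgebra.counit_one 𝒜] at h
  simpa using h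

/-- The antipode of a super commutative Hopf algebra as an algebra map. -/
def antipodeHom (hS : IsAntipode 𝒜 S) : A →ₐ[k] A :=
  AlgHom.ofLinearMap S (antipode_one hS) (antipode_mul hS)

/-- Since `S` is an algebra map, `S ∘ S` is a convolution inverse of `S`, and so is the identity. -/
lemma antipode_antipode (hS : IsAntipode 𝒜 S) (a : A) : S (S a) = a := by
  have h := comp_antipode_mul hS (antipodeHom hS)
  have h2 : toConv (S ∘ₗ S) = toConv LinearMap.id :=
    left_inv_eq_right_inv (a := toConv S) h hS.left_inv
  exact congrArg (fun f => f.ofConv a) h2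

end Commutative

lemma map_antipode {D : Type*} [Ring D] [Algebra k D] {𝒟 : ZMod 2 → Submodule k D}
    [GradedAlgebra 𝒟] [Coalgebra k D] [IsSuperHopfAlgebra 𝒟] {T : D →ₗ[k] D}
    (hS : IsAntipode 𝒜 S) (hT : IsAntipode 𝒟 T) (f : A →ₐc[k] D) (a : A) : f (S a) = T (f a) := by
  have h1 := comp_antipode_mul hS (f : A →ₐ[k] D)
  have h2 := LinearMap.convMul_comp_coalgHom_distrib (toConv LinearMap.id) (toConv T)
    (f : A →ₗc[k] D)
  rw [hT.right_inv] at h2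
  have h3 : toConv ((f : A →ₐ[k] D).toLinearMap) *
      toConv (T ∘ₗ (f : A →ₐ[k] D).toLinearMap) = 1 := by
    apply ofConv_injective
    refine h2.symm.trans ?_
    ext a
    simp [LinearMap.convOne_def]
  have h := left_inv_eq_right_inv h1 h3
  exact congrArg (fun g => g.ofConv a) h

end Antipode

/-! ### Local finiteness of coalgebras -/

section Finiteness

variable {k A : Type*} [Field k] [AddCommGroup A] [Module k A]

/-- `x ⊗ y ↦ g(y) x`. -/
def contractSnd (g : A →ₗ[k] k) : A ⊗[k] A →ₗ[k] A :=
  (TensorProduct.rid k A).toLinearMap ∘ₗ g.lTensor A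

/-- `x ⊗ y ↦ f(x) y`. -/
def contractFst (f : A →ₗ[k] k) : A ⊗[k] A →ₗ[k] A :=
  (TensorProduct.lid k A).toLinearMap ∘ₗ f.rTensor A

@[simp] lemma contractSnd_tmul (g : A →ₗ[k] k) (x y : A) :
    contractSnd g (x ⊗ₜ y) = g y • x := by simp [contractSnd]

@[simp] lemma contractFst_tmul (f : A →ₗ[k] k) (x y : A) :
    contractFst f (x ⊗ₜ y) = f x • y := by simp [contractFst]

lemma eq_zero_of_contractSnd {t : A ⊗[k] A} (h : ∀ g : A →ₗ[k] k, contractSnd g t = 0) :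
    t = 0 := by
  classical
  let b := Module.Basis.ofVectorSpace k A
  apply (TensorProduct.equivFinsuppOfBasisRight (M := A) b).injective
  rw [map_zero]
  ext i
  exact (TensorProduct.equivFinsuppOfBasisRight_apply b t i).trans (h _)

lemma eq_zero_of_contractFst {t : A ⊗[k] A} (h : ∀ g : A →ₗ[k] k, contractFst g t = 0) :
    t = 0 := by
  classical
  let b := Module.Basis.ofVectorSpace k A
  apply (TensorProduct.equivFinsuppOfBasisLeft (N := A) b).injective
  rw [map_zero]
  ext i
  exact (TensorProduct.equivFinsuppOfBasisLeft_apply b t i).trans (h _)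

/-- Over a field `C` is a direct summand; a projection onto `C`, applied to either leg, fixes a
tensor whose slices all lie in `C`. -/
lemma mem_map₂_of_contract {C : Submodule k A} {t : A ⊗[k] A}
    (h₁ : ∀ g : A →ₗ[k] k, contractFst g t ∈ C) (h₂ : ∀ g : A →ₗ[k] k, contractSnd g t ∈ C) :
    t ∈ Submodule.map₂ (TensorProduct.mk k A A) C C := by
  obtain ⟨q, hq⟩ := C.subtype.exists_leftInverse_of_injective C.ker_subtype
  let p : A →ₗ[k] A := C.subtype ∘ₗ q
  have hp : ∀ c ∈ C, p c = c := fun c hc =>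
    congrArg Subtype.val (congrArg (fun f => f ⟨c, hc⟩) hq)
  have hpC : ∀ a, p a ∈ C := fun a => (q a).2
  have e₁ : p.rTensor A t = t := by
    rw [← sub_eq_zero]
    refine eq_zero_of_contractSnd fun g => ?_
    have : ∀ t : A ⊗[k] A, contractSnd g (p.rTensor A t) = p (contractSnd g t) := by
      intro t
      induction t with
      | zero => simp
      | add x y hx hy => simp only [map_add, hx, hy]
      | tmul x y => simp
    rw [map_sub, this, hp _ (h₂ g), sub_self]
  have e₂ : p.lTensor A t = t := by
    rw [← sub_eq_zero]
    refine eq_zero_of_contractFst fun g => ?_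
    have : ∀ t : A ⊗[k] A, contractFst g (p.lTensor A t) = p (contractFst g t) := by
      intro t
      induction t with
      | zero => simp
      | add x y hx hy => simp only [map_add, hx, hy]
      | tmul x y => simp
    rw [map_sub, this, hp _ (h₁ g), sub_self]
  rw [← e₁, ← e₂]
  clear e₁ e₂ h₁ h₂
  induction t with
  | zero => simp
  | add x y hx hy => simp only [map_add]; exact Submodule.add_mem _ hx hy
  | tmul x y => exact Submodule.apply_mem_map₂ _ (hpC x) (hpC y)

variable [Coalgebra k A]

/-- Slicing the legs of `Δ` lets the dual space act on `A` from both sides. The two actions commute,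
and by the next two identities each of them composes through a convolution of forms. -/
lemma contractFst_comul_contractSnd (f g : A →ₗ[k] k) (a : A) :
    contractFst f (comul (R := k) (contractSnd g (comul (R := k) a))) =
      contractSnd g (comul (R := k) (contractFst f (comul (R := k) a))) := by
  let G : A ⊗[k] (A ⊗[k] A) →ₗ[k] A :=
    (TensorProduct.lid k A).toLinearMap ∘ₗ TensorProduct.map f (contractSnd g)
  have h1 : ∀ t : A ⊗[k] A, contractFst f (comul (R := k) (contractSnd g t)) =
      G (TensorProduct.assoc k A A A ((comul (R := k)).rTensor A t)) := by
    intro t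
    induction t with
    | zero => simp
    | add x y hx hy => simp only [map_add, hx, hy]
    | tmul x y =>
      simp only [contractSnd_tmul, map_smul, LinearMap.rTensor_tmul]
      generalize comul (R := k) x = u
      induction u with
      | zero => simp
      | add x y hx hy => simp only [map_add, smul_add, hx, hy, TensorProduct.add_tmul]
      | tmul x z => simp [G, smul_smul, mul_comm]
  have h2 : ∀ t : A ⊗[k] A, contractSnd g (comul (R := k) (contractFst f t)) =
      G ((comul (R := k)).lTensor A t) := by
    intro t
    induction t with
    | zero => simp
    | add x y hx hy => simp only [map_add, hx, hy]
    | tmul x y => simp [G]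
  rw [h1, h2, coassoc_apply]

lemma contractFst_comul_contractFst (f g : A →ₗ[k] k) (a : A) :
    contractFst f (comul (R := k) (contractFst g (comul (R := k) a))) =
      contractFst ((TensorProduct.lid k k).toLinearMap ∘ₗ TensorProduct.map g f ∘ₗ comul)
        (comul (R := k) a) := by
  let G : A ⊗[k] (A ⊗[k] A) →ₗ[k] A :=
    (TensorProduct.lid k A).toLinearMap ∘ₗ TensorProduct.map g (contractFst f)
  have h1 : ∀ t : A ⊗[k] A, contractFst f (comul (R := k) (contractFst g t)) =
      G ((comul (R := k)).lTensor A t) := by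
    intro t
    induction t with
    | zero => simp
    | add x y hx hy => simp only [map_add, hx, hy]
    | tmul x y => simp [G]
  have h2 : ∀ t : A ⊗[k] A,
      contractFst ((TensorProduct.lid k k).toLinearMap ∘ₗ TensorProduct.map g f ∘ₗ comul) t =
      G (TensorProduct.assoc k A A A ((comul (R := k)).rTensor A t)) := by
    intro t
    induction t with
    | zero => simp
    | add x y hx hy => simp only [map_add, hx, hy]
    | tmul x y =>
      simp only [contractFst_tmul, LinearMap.rTensor_tmul, LinearMap.comp_apply]
      generalize comul (R := k) x = u
      induction u with
      | zero => simp
      | add x y hx hy => simp only [map_add, add_smul, hx, hy, TensorProduct.add_tmul]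
      | tmul x z => simp [G, smul_smul, mul_comm]
  rw [h1, h2, coassoc_apply]

lemma contractSnd_comul_contractSnd (f g : A →ₗ[k] k) (a : A) :
    contractSnd f (comul (R := k) (contractSnd g (comul (R := k) a))) =
      contractSnd ((TensorProduct.lid k k).toLinearMap ∘ₗ TensorProduct.map f g ∘ₗ comul)
        (comul (R := k) a) := by
  let G : A ⊗[k] (A ⊗[k] A) →ₗ[k] A := (TensorProduct.rid k A).toLinearMap ∘ₗ
    ((TensorProduct.lid k k).toLinearMap ∘ₗ TensorProduct.map f g).lTensor A
  have h1 : ∀ t : A ⊗[k] A, contractSnd f (comul (R := k) (contractSnd g t)) =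
      G (TensorProduct.assoc k A A A ((comul (R := k)).rTensor A t)) := by
    intro t
    induction t with
    | zero => simp
    | add x y hx hy => simp only [map_add, hx, hy]
    | tmul x y =>
      simp only [contractSnd_tmul, map_smul, LinearMap.rTensor_tmul]
      generalize comul (R := k) x = u
      induction u with
      | zero => simp
      | add x y hx hy => simp only [map_add, smul_add, hx, hy, TensorProduct.add_tmul]
      | tmul x z => simp [G, smul_smul, mul_comm]
  have h2 : ∀ t : A ⊗[k] A,
      contractSnd ((TensorProduct.lid k k).toLinearMap ∘ₗ TensorProduct.map f g ∘ₗ comul) t =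
      G ((comul (R := k)).lTensor A t) := by
    intro t
    induction t with
    | zero => simp
    | add x y hx hy => simp only [map_add, hx, hy]
    | tmul x y => simp [G]
  rw [h1, h2, coassoc_apply]

/-- Every element of a coalgebra lies in a finite-dimensional subcoalgebra. -/
lemma exists_finite_subcoalgebra (a : A) : ∃ C : Submodule k A, a ∈ C ∧ C.FG ∧
    ∀ c ∈ C, comul (R := k) c ∈ Submodule.map₂ (TensorProduct.mk k A A) C C := by
  -- The subcoalgebra is spanned by the elements `∑ f(a₍₁₎) g(a₍₃₎) a₍₂₎`. All of them are slices of
  -- one tensor in `A ⊗ A ⊗ A`, hence lie in a finite-dimensional space.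
  let T : (A →ₗ[k] k) → (A →ₗ[k] k) → A := fun f g =>
    contractSnd g (comul (R := k) (contractFst f (comul (R := k) a)))
  have hfin : ∀ t : A ⊗[k] (A ⊗[k] A), ∃ Q : Submodule k A, Q.FG ∧ ∀ f g : A →ₗ[k] k,
      TensorProduct.lid k A (TensorProduct.map f (contractSnd g) t) ∈ Q := by
    intro t
    induction t with
    | zero => exact ⟨⊥, Submodule.fg_bot, fun f g => by simp⟩
    | add x y hx hy =>
      obtain ⟨P, hP, hP'⟩ := hx
      obtain ⟨Q, hQ, hQ'⟩ := hy
      refine ⟨P ⊔ Q, hP.sup hQ, fun f g => ?_⟩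
      rw [map_add, map_add]
      exact Submodule.add_mem_sup (hP' f g) (hQ' f g)
    | tmul x u =>
      induction u with
      | zero => exact ⟨⊥, Submodule.fg_bot, fun f g => by simp⟩
      | add y z hy hz =>
        obtain ⟨P, hP, hP'⟩ := hy
        obtain ⟨Q, hQ, hQ'⟩ := hz
        refine ⟨P ⊔ Q, hP.sup hQ, fun f g => ?_⟩
        rw [TensorProduct.tmul_add, map_add, map_add]
        exact Submodule.add_mem_sup (hP' f g) (hQ' f g)
      | tmul y z =>
        refine ⟨k ∙ y, Submodule.fg_span_singleton y, fun f g => ?_⟩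
        simp only [TensorProduct.map_tmul, contractSnd_tmul, TensorProduct.lid_tmul, smul_smul]
        exact Submodule.smul_mem _ _ (Submodule.mem_span_singleton_self y)
  have hT : ∀ f g, T f g = TensorProduct.lid k A (TensorProduct.map f (contractSnd g)
      ((comul (R := k)).lTensor A (comul (R := k) a))) := by
    intro f g
    simp only [T]
    generalize comul (R := k) a = t
    induction t with
    | zero => simp
    | add x y hx hy => simp only [map_add, hx, hy]
    | tmul x y => simp
  obtain ⟨Q, hQ, hQT⟩ := hfin ((comul (R := k)).lTensor A (comul (R := k) a))
  have : FiniteDimensional k Q := Module.Finite.iff_fg.2 hQ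
  let C : Submodule k A := Submodule.span k {x | ∃ f g, T f g = x}
  have hCQ : C ≤ Q := Submodule.span_le.2 (by rintro _ ⟨f, g, rfl⟩; rw [hT]; exact hQT f g)
  have hCfd : FiniteDimensional k C := Submodule.finiteDimensional_of_le hCQ
  refine ⟨C, Submodule.subset_span ⟨counit, counit, ?_⟩, Module.Finite.iff_fg.1 hCfd,
    fun c hc => mem_map₂_of_contract (fun f => ?_) fun g => ?_⟩
  · simp [T, contractSnd, contractFst]
  · have h : C ≤ C.comap (contractFst f ∘ₗ comul) := Submodule.span_le.2 (by
      rintro _ ⟨f', g, rfl⟩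
      change contractFst f (comul (R := k) (T f' g)) ∈ C
      simp only [T, contractFst_comul_contractSnd, contractFst_comul_contractFst]
      exact Submodule.subset_span ⟨_, _, rfl⟩)
    exact h hc
  · have h : C ≤ C.comap (contractSnd g ∘ₗ comul) := Submodule.span_le.2 (by
      rintro _ ⟨f, g', rfl⟩
      exact Submodule.subset_span ⟨f, _, (contractSnd_comul_contractSnd g g' _).symm⟩)
    exact h hc

end Finiteness

/-! ### Subspaces and subalgebras stable under the Hopf structure -/

section SubHopf

variable {k A : Type*} [Field k] [Ring A] [Algebra k A]
  (𝒜 : ZMod 2 → Submodule k A) [GradedAlgebra 𝒜] [Coalgebra k A] (S : A →ₗ[k] A)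

/-- A subspace stable under the parity automorphism, the comultiplication and the antipode. -/
structure IsHopfStable (C : Submodule k A) : Prop where
  parity : ∀ a ∈ C, parityAut 𝒜 a ∈ C
  comul : ∀ a ∈ C, comul (R := k) a ∈ Submodule.map₂ (TensorProduct.mk k A A) C C
  antipode : ∀ a ∈ C, S a ∈ C

variable {𝒜 S}

lemma isHopfStable_bot : IsHopfStable 𝒜 S (⊥ : Submodule k A) where
  parity a ha := by rw [(Submodule.mem_bot k).1 ha]; simp
  comul a ha := by rw [(Submodule.mem_bot k).1 ha]; simp
  antipode a ha := by rw [(Submodule.mem_bot k).1 ha]; simp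

lemma isHopfStable_top : IsHopfStable 𝒜 S (⊤ : Submodule k A) where
  parity a ha := trivial
  comul a ha := by rw [TensorProduct.map₂_mk_top_top_eq_top]; trivial
  antipode a ha := trivial

lemma comul_sup {C D : Submodule k A}
    (hC : ∀ a ∈ C, Coalgebra.comul (R := k) a ∈ Submodule.map₂ (TensorProduct.mk k A A) C C)
    (hD : ∀ a ∈ D, Coalgebra.comul (R := k) a ∈ Submodule.map₂ (TensorProduct.mk k A A) D D) :
    ∀ a ∈ C ⊔ D,
      Coalgebra.comul (R := k) a ∈ Submodule.map₂ (TensorProduct.mk k A A) (C ⊔ D) (C ⊔ D) := by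
  intro a ha
  obtain ⟨x, hx, y, hy, rfl⟩ := Submodule.mem_sup.1 ha
  rw [map_add]
  exact Submodule.add_mem _ (Submodule.map₂_le_map₂ le_sup_left le_sup_left (hC x hx))
    (Submodule.map₂_le_map₂ le_sup_right le_sup_right (hD y hy))

lemma IsHopfStable.sup {C D : Submodule k A} (hC : IsHopfStable 𝒜 S C) (hD : IsHopfStable 𝒜 S D) :
    IsHopfStable 𝒜 S (C ⊔ D) where
  parity := by
    intro a ha
    obtain ⟨x, hx, y, hy, rfl⟩ := Submodule.mem_sup.1 ha
    rw [map_add]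
    exact Submodule.add_mem_sup (hC.parity x hx) (hD.parity y hy)
  comul := comul_sup hC.comul hD.comul
  antipode := by
    intro a ha
    obtain ⟨x, hx, y, hy, rfl⟩ := Submodule.mem_sup.1 ha
    rw [map_add]
    exact Submodule.add_mem_sup (hC.antipode x hx) (hD.antipode y hy)

variable [IsSuperHopfAlgebra 𝒜] [IsSuperCommutative 𝒜]

/-- Every element lies in a finite-dimensional graded subcoalgebra stable under the antipode. -/
lemma exists_isHopfStable (hk : (2 : k) ≠ 0) (hS : IsAntipode 𝒜 S) (a : A) :
    ∃ C : Submodule k A, a ∈ C ∧ C.FG ∧ IsHopfStable 𝒜 S C := by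
  obtain ⟨C, haC, hC, hΔ⟩ := exists_finite_subcoalgebra (k := k) a
  let γ : A →ₗ[k] A := (parityAut 𝒜).toLinearMap
  have hγγ : ∀ a, γ (γ a) = a := parityAut_parityAut 𝒜
  let P := C ⊔ C.map γ
  have hPγ : ∀ a ∈ P, parityAut 𝒜 a ∈ P := by
    intro a ha
    obtain ⟨x, hx, _, ⟨y, hy, rfl⟩, rfl⟩ := Submodule.mem_sup.1 ha
    rw [map_add, add_comm]
    exact Submodule.add_mem_sup ((hγγ y).symm ▸ hy) (Submodule.mem_map_of_mem (f := γ) hx)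
  have hPΔ : ∀ a ∈ P, comul (R := k) a ∈ Submodule.map₂ (TensorProduct.mk k A A) P P := by
    refine comul_sup hΔ ?_
    rintro _ ⟨x, hx, rfl⟩
    have h : Submodule.map₂ (TensorProduct.mk k A A) C C ≤
        (Submodule.map₂ (TensorProduct.mk k A A) (C.map γ) (C.map γ)).comap
          (TensorProduct.map γ γ) := Submodule.map₂_le.2 fun x hx y hy =>
      Submodule.apply_mem_map₂ _ (Submodule.mem_map_of_mem hx) (Submodule.mem_map_of_mem hy)
    exact (comul_parityAut 𝒜 x).symm ▸ h (hΔ x hx)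
  -- One application of `S` suffices, because `S` is an involution and commutes with `γ`.
  let Q := P ⊔ P.map S
  have hQγ : ∀ a ∈ Q, parityAut 𝒜 a ∈ Q := by
    intro a ha
    obtain ⟨x, hx, _, ⟨y, hy, rfl⟩, rfl⟩ := Submodule.mem_sup.1 ha
    rw [map_add, ← hS.map_parityAut]
    exact Submodule.add_mem_sup (hPγ x hx) (Submodule.mem_map_of_mem (hPγ y hy))
  have hQp := fun i => proj_mem_of_parityAut_mem 𝒜 hk hQγ i
  refine ⟨Q, ?_, ?_, hQγ, ?_, ?_⟩
  · exact Submodule.mem_sup_left (Submodule.mem_sup_left haC)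
  · exact (hC.sup (hC.map γ)).sup ((hC.sup (hC.map γ)).map S)
  · intro a ha
    obtain ⟨x, hx, _, ⟨y, hy, rfl⟩, rfl⟩ := Submodule.mem_sup.1 ha
    rw [map_add]
    exact Submodule.add_mem _ (Submodule.map₂_le_map₂ le_sup_left le_sup_left (hPΔ x hx))
      (comul_antipode_mem hS hPΔ hQp
        (fun a ha => Submodule.mem_sup_right (Submodule.mem_map_of_mem ha)) hy)
  · intro a ha
    obtain ⟨x, hx, _, ⟨y, hy, rfl⟩, rfl⟩ := Submodule.mem_sup.1 ha
    rw [map_add, antipode_antipode hS, add_comm]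
    exact Submodule.add_mem_sup hy (Submodule.mem_map_of_mem hx)

lemma exists_isHopfStable_le (hk : (2 : k) ≠ 0) (hS : IsAntipode 𝒜 S) {P : Submodule k A}
    (hP : P.FG) : ∃ C : Submodule k A, P ≤ C ∧ C.FG ∧ IsHopfStable 𝒜 S C := by
  induction P, hP using Submodule.fg_induction with
  | singleton a =>
    obtain ⟨C, haC, hC⟩ := exists_isHopfStable hk hS a
    exact ⟨C, (Submodule.span_singleton_le_iff_mem _ _).2 haC, hC⟩
  | sup P Q _ _ hP hQ =>
    obtain ⟨C, hPC, hC, hC'⟩ := hP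
    obtain ⟨D, hQD, hD, hD'⟩ := hQ
    exact ⟨C ⊔ D, sup_le_sup hPC hQD, hC.sup hD, hC'.sup hD'⟩

/-- The subalgebra generated by a stable subspace is stable. -/
lemma IsHopfStable.adjoin (hk : (2 : k) ≠ 0) (hS : IsAntipode 𝒜 S) {C : Submodule k A}
    (hC : IsHopfStable 𝒜 S C) :
    IsHopfStable 𝒜 S (Algebra.adjoin k (C : Set A)).toSubmodule := by
  set B := Algebra.adjoin k (C : Set A)
  have hCB : C ≤ B.toSubmodule := fun x hx => Algebra.subset_adjoin hx
  have hBγ : ∀ a ∈ B.toSubmodule, parityAut 𝒜 a ∈ B.toSubmodule := by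
    have : B ≤ B.comap (parityAut 𝒜) := Algebra.adjoin_le fun x hx => hCB (hC.parity x hx)
    exact fun a ha => this ha
  have hBp := fun i => proj_mem_of_parityAut_mem 𝒜 hk hBγ i
  refine ⟨hBγ, fun a ha => ?_, ?_⟩
  · have ha' : a ∈ Algebra.adjoin k (C : Set A) := ha
    induction ha' using Algebra.adjoin_induction with
    | mem x hx => exact Submodule.map₂_le_map₂ hCB hCB (hC.comul x hx)
    | algebraMap r =>
      rw [Algebra.algebraMap_eq_smul_one, map_smul, IsSuperHopfAlgebra.comul_one 𝒜]
      exact Submodule.smul_mem _ _ (Submodule.apply_mem_map₂ _ B.one_mem B.one_mem)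
    | add x y hx' hy' hx hy =>
      rw [map_add]; exact Submodule.add_mem _ (hx hx') (hy hy')
    | mul x y hx' hy' hx hy =>
      rw [comul_mul 𝒜]
      have key : Submodule.map₂ (signedMul 𝒜)
          (Submodule.map₂ (TensorProduct.mk k A A) B.toSubmodule B.toSubmodule)
          (Submodule.map₂ (TensorProduct.mk k A A) B.toSubmodule B.toSubmodule) ≤
          Submodule.map₂ (TensorProduct.mk k A A) B.toSubmodule B.toSubmodule := by
        conv_lhs => rw [Submodule.map₂_eq_span_image2 (TensorProduct.mk k A A)]
        rw [Submodule.map₂_span_span]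
        refine Submodule.span_le.2 ?_
        rintro _ ⟨_, ⟨a, ha, b, hb, rfl⟩, _, ⟨c, hc, d, hd, rfl⟩, rfl⟩
        simp only [TensorProduct.mk_apply, signedMul_tmul, SetLike.mem_coe]
        exact Submodule.add_mem _
          (Submodule.apply_mem_map₂ _ (B.mul_mem ha hc) (B.mul_mem (hBp 0 _ hb) hd))
          (Submodule.apply_mem_map₂ _ (B.mul_mem ha (hBγ _ hc)) (B.mul_mem (hBp 1 _ hb) hd))
      exact key (Submodule.apply_mem_map₂ _ (hx hx') (hy hy'))
  · have : B ≤ B.comap (antipodeHom hS) := Algebra.adjoin_le fun x hx => hCB (hC.antipode x hx)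
    exact fun a ha => this ha

lemma IsHopfStable.map {D : Type*} [Ring D] [Algebra k D] {𝒟 : ZMod 2 → Submodule k D}
    [GradedAlgebra 𝒟] [Coalgebra k D] [IsSuperHopfAlgebra 𝒟] {T : D →ₗ[k] D}
    (hS : IsAntipode 𝒜 S) (hT : IsAntipode 𝒟 T) (f : A →ₐc[k] D)
    (hf : ∀ (i : ZMod 2), ∀ a ∈ 𝒜 i, f a ∈ 𝒟 i) {C : Submodule k A} (hC : IsHopfStable 𝒜 S C) :
    IsHopfStable 𝒟 T (C.map (f : A →ₐ[k] D).toLinearMap) where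
  parity := by
    rintro _ ⟨a, ha, rfl⟩
    refine ⟨_, hC.parity a ha, ?_⟩
    obtain ⟨x, hx, y, hy, rfl⟩ := exists_even_add_odd 𝒜 a
    simp [parityAut_even 𝒜 hx, parityAut_odd 𝒜 hy, parityAut_even 𝒟 (hf 0 x hx),
      parityAut_odd 𝒟 (hf 1 y hy)]
  comul := by
    rintro _ ⟨a, ha, rfl⟩
    have h : Submodule.map₂ (TensorProduct.mk k A A) C C ≤
        (Submodule.map₂ (TensorProduct.mk k D D) (C.map (f : A →ₐ[k] D).toLinearMap)
          (C.map (f : A →ₐ[k] D).toLinearMap)).comap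
          (TensorProduct.map (f : A →ₐ[k] D).toLinearMap (f : A →ₐ[k] D).toLinearMap) :=
      Submodule.map₂_le.2 fun x hx y hy => Submodule.apply_mem_map₂ _
        (Submodule.mem_map_of_mem hx) (Submodule.mem_map_of_mem hy)
    exact (CoalgHomClass.map_comp_comul_apply f a) ▸ h (hC.comul a ha)
  antipode := by
    rintro _ ⟨a, ha, rfl⟩
    exact ⟨_, hC.antipode a ha, map_antipode hS hT f a⟩

end SubHopf

/-! ### Spans of anticommuting elements -/

section ListSpan

variable {k A : Type*} [Field k] [Ring A] [Algebra k A]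

/-- The span of a list of elements. -/
def listSpan (F : List A) : Submodule k A := Submodule.span k {x | x ∈ F}

lemma listSpan_nil : listSpan (k := k) ([] : List A) = ⊥ := by simp [listSpan]

lemma listSpan_cons (z : A) (F : List A) : listSpan (k := k) (z :: F) = (k ∙ z) ⊔ listSpan F := by
  rw [listSpan, listSpan, ← Submodule.span_union]
  congr 1; ext x; simp

lemma listSpan_le {F : List A} {N : Submodule k A} (h : ∀ x ∈ F, x ∈ N) : listSpan F ≤ N :=
  Submodule.span_le.2 h

/-- A power of the span of anticommuting elements is linear in each of them. -/
lemma listSpan_cons_pow_le {z : A} {F : List A}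
    (hz : z * z = 0) (hF : ∀ x ∈ F, z * x = -(x * z)) (n : ℕ) :
    listSpan (k := k) (z :: F) ^ (n + 1) ≤
      listSpan F ^ (n + 1) ⊔ listSpan F ^ n * (k ∙ z) := by
  have hFz : (k ∙ z) * listSpan (k := k) F ≤ listSpan F * (k ∙ z) := by
    rw [listSpan, Submodule.span_mul_span, Submodule.span_le]
    rintro _ ⟨a, rfl, x, hx, rfl⟩
    change a * x ∈ _
    rw [hF x hx]
    exact Submodule.neg_mem _ (Submodule.mul_mem_mul (Submodule.subset_span hx)
      (Submodule.mem_span_singleton_self a))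
  have hzz : (k ∙ z) * (k ∙ z) = (⊥ : Submodule k A) := by
    rw [Submodule.span_mul_span, Set.singleton_mul_singleton, hz]; simp
  induction n with
  | zero => rw [pow_one, pow_one, pow_zero, one_mul, listSpan_cons, sup_comm]
  | succ n ih =>
    rw [pow_succ]
    refine (mul_le_mul' ih le_rfl).trans ?_
    rw [listSpan_cons, Submodule.sup_mul, Submodule.mul_sup, Submodule.mul_sup, ← pow_succ,
      mul_assoc (listSpan F ^ n) (k ∙ z) (k ∙ z), hzz, Submodule.mul_bot,
      mul_assoc (listSpan F ^ n) (k ∙ z)]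
    refine sup_le (sup_le le_sup_right le_sup_left) (sup_le bot_le ?_)
    refine le_trans ?_ le_sup_right
    rw [pow_succ, mul_assoc]
    exact mul_le_mul' le_rfl hFz

/-- A product with more factors than generators repeats one of them, and anticommutation brings the
repeated factors together. -/
lemma listSpan_pow_eq_bot {F : List A}
    (hsq : ∀ x ∈ F, x * x = 0) (hF : ∀ x ∈ F, ∀ y ∈ F, x * y = -(y * x)) :
    listSpan (k := k) F ^ (F.length + 1) = ⊥ := by
  induction F with
  | nil => rw [List.length_nil, zero_add, pow_one, listSpan_nil]
  | cons z F ih =>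
    have h := listSpan_cons_pow_le (k := k) (hsq z List.mem_cons_self)
      (fun x hx => hF z List.mem_cons_self x (List.mem_cons_of_mem _ hx)) (F.length + 1)
    rw [pow_succ (listSpan F), ih (fun x hx => hsq x (List.mem_cons_of_mem _ hx))
      (fun x hx y hy => hF x (List.mem_cons_of_mem _ hx) y (List.mem_cons_of_mem _ hy)),
      Submodule.bot_mul, Submodule.bot_mul, sup_bot_eq] at h
    exact le_bot_iff.1 h

end ListSpan

/-! ### Powers of the odd ideal of a subalgebra -/

section OddIdeal

variable {k A : Type*} [Field k] [Ring A] [Algebra k A]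
  (𝒜 : ZMod 2 → Submodule k A) [GradedAlgebra 𝒜] (B : Subalgebra k A)

/-- The odd part of a graded subalgebra. -/
def oddPart : Submodule k A := B.toSubmodule ⊓ 𝒜 1

/-- The `n`-th power of the ideal of `B` generated by the odd elements. -/
def oddPow (n : ℕ) : Submodule k A := B.toSubmodule * oddPart 𝒜 B ^ n

variable {𝒜 B}

lemma mul_self_le : B.toSubmodule * B.toSubmodule ≤ B.toSubmodule :=
  Submodule.mul_le.2 fun _ ha _ hb => B.mul_mem ha hb

lemma one_le_subalgebra : (1 : Submodule k A) ≤ B.toSubmodule :=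
  Submodule.one_le.2 B.one_mem

lemma le_mul_of_subalgebra (N : Submodule k A) : N ≤ B.toSubmodule * N := by
  calc N = 1 * N := (one_mul N).symm
    _ ≤ _ := mul_le_mul' one_le_subalgebra le_rfl

lemma oddPart_le : oddPart 𝒜 B ≤ B.toSubmodule := inf_le_left

lemma oddPow_zero : oddPow 𝒜 B 0 = B.toSubmodule := by rw [oddPow, pow_zero, mul_one]

lemma oddPow_one : oddPow 𝒜 B 1 = B.toSubmodule * oddPart 𝒜 B := by rw [oddPow, pow_one]

lemma oddPow_mul_oddPart (n : ℕ) : oddPow 𝒜 B n * oddPart 𝒜 B = oddPow 𝒜 B (n + 1) := by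
  rw [oddPow, oddPow, mul_assoc, pow_succ]

lemma oddPart_pow_le (n : ℕ) : oddPart 𝒜 B ^ n ≤ B.toSubmodule := by
  induction n with
  | zero => rw [pow_zero]; exact one_le_subalgebra
  | succ n ih => rw [pow_succ]; exact (mul_le_mul' ih oddPart_le).trans mul_self_le

lemma oddPow_le_subalgebra (n : ℕ) : oddPow 𝒜 B n ≤ B.toSubmodule :=
  (mul_le_mul' le_rfl (oddPart_pow_le n)).trans mul_self_le

lemma oddPart_le_oddPow_one : oddPart 𝒜 B ≤ oddPow 𝒜 B 1 := by
  rw [oddPow_one]; exact le_mul_of_subalgebra _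

variable [IsSuperCommutative 𝒜]

lemma odd_mul_subalgebra_le (hB : ∀ a ∈ B, parityAut 𝒜 a ∈ B) {N : Submodule k A}
    (hN : N ≤ 𝒜 1) : N * B.toSubmodule ≤ B.toSubmodule * N :=
  Submodule.mul_le.2 fun a ha b hb => by
    rw [odd_mul 𝒜 (hN ha)]; exact Submodule.mul_mem_mul (hB b hb) ha

lemma pow_mul_subalgebra_le (hB : ∀ a ∈ B, parityAut 𝒜 a ∈ B) {N : Submodule k A}
    (hN : N ≤ 𝒜 1) (n : ℕ) : N ^ n * B.toSubmodule ≤ B.toSubmodule * N ^ n := by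
  induction n with
  | zero => rw [pow_zero, one_mul, mul_one]
  | succ n ih =>
    rw [pow_succ, mul_assoc]
    refine (mul_le_mul' le_rfl (odd_mul_subalgebra_le hB hN)).trans ?_
    rw [← mul_assoc, ← mul_assoc]
    exact mul_le_mul' ih le_rfl

lemma oddPow_mul_oddPow (hB : ∀ a ∈ B, parityAut 𝒜 a ∈ B) (m n : ℕ) :
    oddPow 𝒜 B m * oddPow 𝒜 B n ≤ oddPow 𝒜 B (m + n) := by
  rw [oddPow, oddPow, oddPow, mul_assoc, pow_add]
  calc B.toSubmodule * (oddPart 𝒜 B ^ m * (B.toSubmodule * oddPart 𝒜 B ^ n))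
      = B.toSubmodule * ((oddPart 𝒜 B ^ m * B.toSubmodule) * oddPart 𝒜 B ^ n) := by
        rw [mul_assoc (oddPart 𝒜 B ^ m)]
    _ ≤ B.toSubmodule * ((B.toSubmodule * oddPart 𝒜 B ^ m) * oddPart 𝒜 B ^ n) :=
        mul_le_mul' le_rfl (mul_le_mul' (pow_mul_subalgebra_le hB inf_le_right m) le_rfl)
    _ = (B.toSubmodule * B.toSubmodule) * (oddPart 𝒜 B ^ m * oddPart 𝒜 B ^ n) := by
        simp only [mul_assoc]
    _ ≤ _ := mul_le_mul' mul_self_le le_rfl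

/-- The odd elements of a graded subalgebra are generated by the odd components of generators. -/
lemma oddPart_adjoin_le (hk : (2 : k) ≠ 0) {C : Submodule k A}
    (hB : ∀ a ∈ Algebra.adjoin k (C : Set A), parityAut 𝒜 a ∈ Algebra.adjoin k (C : Set A)) :
    oddPart 𝒜 (Algebra.adjoin k (C : Set A)) ≤
      (Algebra.adjoin k (C : Set A)).toSubmodule * C.map (proj 𝒜 1) := by
  set B := Algebra.adjoin k (C : Set A)
  have hCB : C ≤ B.toSubmodule := fun x hx => Algebra.subset_adjoin hx
  let N := C.map (proj 𝒜 1)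
  have hN1 : N ≤ 𝒜 1 := by rintro _ ⟨x, -, rfl⟩; exact proj_mem 𝒜 1 x
  -- The elements of `B` that are even modulo `B N` include the generators and are closed under
  -- products. Taking odd components afterwards removes the even term.
  have hEBN : B.toSubmodule ≤ (𝒜 0) ⊔ B.toSubmodule * N := by
    intro b hb
    have hb' : b ∈ Algebra.adjoin k (C : Set A) := hb
    induction hb' using Algebra.adjoin_induction with
    | mem x hx =>
      rw [← proj_zero_add_proj_one 𝒜 x]
      exact Submodule.add_mem_sup (proj_mem 𝒜 0 x)
        (le_mul_of_subalgebra _ (Submodule.mem_map_of_mem hx))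
    | algebraMap r => exact Submodule.mem_sup_left (algebraMap_mem_even 𝒜 r)
    | add x y hx hy hx' hy' => exact Submodule.add_mem _ (hx' hx) (hy' hy)
    | mul x y hx hy hx' hy' =>
      obtain ⟨a, ha, n, hn, hx''⟩ := Submodule.mem_sup.1 (hx' hx)
      obtain ⟨c, hc, m, hm, hy''⟩ := Submodule.mem_sup.1 (hy' hy)
      have hBN : B.toSubmodule * N ≤ B.toSubmodule :=
        (mul_le_mul' le_rfl (fun x hx => by
          obtain ⟨y, hy, rfl⟩ := hx
          exact proj_mem_of_parityAut_mem 𝒜 hk hB 1 y (hCB hy))).trans mul_self_le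
      have haB : a ∈ B := by
        have : a = x - n := eq_sub_of_add_eq hx''
        rw [this]; exact B.sub_mem hx (hBN hn)
      have : x * y = a * c + (a * m + n * y) := by
        rw [← hy'', mul_add, ← hx'', add_mul]; simp only [mul_add, add_mul]; abel
      rw [this]
      refine Submodule.add_mem_sup (mul_mem_even 𝒜 ha hc) (Submodule.add_mem _ ?_ ?_)
      · have := Submodule.mul_mem_mul (M := B.toSubmodule) (N := B.toSubmodule * N) haB hm
        rw [← mul_assoc] at this
        exact mul_le_mul' mul_self_le le_rfl this
      · have := Submodule.mul_mem_mul (M := B.toSubmodule * N) (N := B.toSubmodule) hn hy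
        rw [mul_assoc] at this
        have := mul_le_mul' le_rfl (odd_mul_subalgebra_le hB hN1) this
        rw [← mul_assoc] at this
        exact mul_le_mul' mul_self_le le_rfl this
  rintro b ⟨hb, hb1⟩
  obtain ⟨a, ha, n, hn, rfl⟩ := Submodule.mem_sup.1 (hEBN hb)
  have hp : B.toSubmodule * N ≤ (B.toSubmodule * N).comap (proj 𝒜 1) := by
    refine Submodule.mul_le.2 fun x hx y hy => ?_
    have : proj 𝒜 1 (x * y) = proj 𝒜 0 x * y := by
      nth_rw 1 [← proj_zero_add_proj_one 𝒜 x]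
      rw [add_mul, map_add, proj_of_mem 𝒜 (mul_mem_odd_right 𝒜 (proj_mem 𝒜 0 x) (hN1 hy)),
        proj_one_of_even 𝒜 (mul_mem_even_of_odd 𝒜 (proj_mem 𝒜 1 x) (hN1 hy)), add_zero]
    rw [Submodule.mem_comap, this]
    exact Submodule.mul_mem_mul (proj_mem_of_parityAut_mem 𝒜 hk hB 0 x hx) hy
  have h := hp hn
  rw [← proj_of_mem 𝒜 hb1, map_add, proj_one_of_even 𝒜 ha, zero_add]
  exact h

/-- The ideal generated by the odd elements of a finitely generated super commutative algebra is
nilpotent. -/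
lemma exists_oddPow_eq_bot (hk : (2 : k) ≠ 0) {C : Submodule k A} (hC : C.FG)
    (hB : ∀ a ∈ Algebra.adjoin k (C : Set A), parityAut 𝒜 a ∈ Algebra.adjoin k (C : Set A)) :
    ∃ n, oddPow 𝒜 (Algebra.adjoin k (C : Set A)) n = ⊥ := by
  set B := Algebra.adjoin k (C : Set A)
  have hCB : C ≤ B.toSubmodule := fun x hx => Algebra.subset_adjoin hx
  obtain ⟨s, hs⟩ := hC.map (proj 𝒜 1)
  let N := C.map (proj 𝒜 1)
  have hN1 : N ≤ 𝒜 1 := by rintro _ ⟨x, -, rfl⟩; exact proj_mem 𝒜 1 x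
  have hNs : N = listSpan s.toList := by
    rw [listSpan]; simp only [Finset.mem_toList]; exact hs.symm
  have hO : oddPart 𝒜 B ≤ B.toSubmodule * N := oddPart_adjoin_le hk hB
  -- Coefficients move to the left past odd elements at the cost of `γ`, so powers of the ideal are
  -- controlled by powers of the finite-dimensional space `N`.
  have hpow : ∀ n, oddPow 𝒜 B n ≤ B.toSubmodule * N ^ n := by
    intro n
    induction n with
    | zero => rw [oddPow_zero, pow_zero, mul_one]
    | succ n ih =>
      rw [← oddPow_mul_oddPart]
      refine (mul_le_mul' ih hO).trans ?_
      rw [mul_assoc, ← mul_assoc (N ^ n)]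
      refine (mul_le_mul' le_rfl (mul_le_mul' (pow_mul_subalgebra_le hB hN1 n) le_rfl)).trans ?_
      rw [mul_assoc, ← pow_succ, ← mul_assoc]
      exact mul_le_mul' mul_self_le le_rfl
  refine ⟨s.toList.length + 1, le_bot_iff.1 ((hpow _).trans ?_)⟩
  have hs1 : ∀ x ∈ s.toList, x ∈ 𝒜 1 := fun x hx =>
    hN1 (hs.le (Submodule.subset_span (Finset.mem_toList.1 hx)))
  rw [hNs, listSpan_pow_eq_bot (fun x hx => odd_mul_self 𝒜 hk (hs1 x hx))
    (fun x hx y hy => odd_mul_odd 𝒜 (hs1 x hx) (hs1 y hy)), Submodule.mul_bot]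

end OddIdeal

/-! ### Left-invariant odd derivations and canonical lifts of odd classes -/

section Derivation

variable {k A : Type*} [Field k] [Ring A] [Algebra k A]
  (𝒜 : ZMod 2 → Submodule k A) [GradedAlgebra 𝒜] [Coalgebra k A]

/-- `B₀⁺ B₁`, the kernel of the projection from `B₁` to the odd cotangent space of `B`. -/
def oddRel (B : Subalgebra k A) : Submodule k A :=
  (B.toSubmodule ⊓ (𝒜 0 ⊓ LinearMap.ker (counit (R := k) (A := A)))) * oddPart 𝒜 B

/-- An odd `ε`-derivation of `B`: a linear form vanishing on even elements and on `B₀⁺ B₁`. -/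
structure IsOddDer (B : Subalgebra k A) (v : A →ₗ[k] k) : Prop where
  even : ∀ a ∈ 𝒜 0, v a = 0
  rel : ∀ a ∈ oddRel 𝒜 B, v a = 0

/-- The left-invariant operator `a ↦ ∑ a₍₁₎ v(a₍₂₎)`. -/
def invDer (v : A →ₗ[k] k) : A →ₗ[k] A := contractSnd v ∘ₗ comul

lemma invDer_apply (v : A →ₗ[k] k) (a : A) : invDer v a = contractSnd v (comul (R := k) a) := rfl

/-- As a convolution product `D_v = id * v`, so `S * D_v = v`; this is what ties `D_v` to `oddLift`.
-/
lemma toConv_invDer (v : A →ₗ[k] k) :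
    toConv (invDer v) = toConv LinearMap.id * toConv (Algebra.linearMap k A ∘ₗ v) := by
  ext a
  rw [LinearMap.convMul_apply]
  change contractSnd v (comul (R := k) a) = _
  generalize comul (R := k) a = t
  induction t with
  | zero => simp
  | add x y hx hy => simp only [map_add, hx, hy]
  | tmul x y => simp [Algebra.smul_def, Algebra.commutes]

variable {𝒜} {B : Subalgebra k A} {v : A →ₗ[k] k}

lemma contractSnd_mem {P Q : Submodule k A} {t : A ⊗[k] A}
    (ht : t ∈ Submodule.map₂ (TensorProduct.mk k A A) P Q) : contractSnd v t ∈ P := by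
  have h : Submodule.map₂ (TensorProduct.mk k A A) P Q ≤ P.comap (contractSnd v) :=
    Submodule.map₂_le.2 fun x hx y _ => by
      rw [Submodule.mem_comap, TensorProduct.mk_apply, contractSnd_tmul]
      exact P.smul_mem _ hx
  exact h ht

lemma invDer_mem {C : Submodule k A}
    (hC : ∀ a ∈ C, comul (R := k) a ∈ Submodule.map₂ (TensorProduct.mk k A A) C C) {a : A}
    (ha : a ∈ C) : invDer v a ∈ C :=
  contractSnd_mem (hC a ha)

lemma invDer_congr {C : Submodule k A}
    (hC : ∀ a ∈ C, comul (R := k) a ∈ Submodule.map₂ (TensorProduct.mk k A A) C C)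
    {w : A →ₗ[k] k} (h : ∀ a ∈ C, v a = w a) {a : A} (ha : a ∈ C) : invDer v a = invDer w a := by
  have h : Submodule.map₂ (TensorProduct.mk k A A) C C ≤
      LinearMap.eqLocus (contractSnd v) (contractSnd w) :=
    Submodule.map₂_le.2 fun x _ y hy => by
      rw [LinearMap.mem_eqLocus, TensorProduct.mk_apply, contractSnd_tmul, contractSnd_tmul, h y hy]
  exact h (hC a ha)

variable [IsSuperHopfAlgebra 𝒜]

lemma IsOddDer.eq_proj (hv : IsOddDer 𝒜 B v) (a : A) : v a = v (proj 𝒜 1 a) := by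
  nth_rw 1 [← proj_zero_add_proj_one 𝒜 a]
  rw [map_add, hv.even _ (proj_mem 𝒜 0 a), zero_add]

lemma IsOddDer.map_even_mul_odd (hv : IsOddDer 𝒜 B v) {a b : A} (ha : a ∈ B) (ha0 : a ∈ 𝒜 0)
    (hb : b ∈ oddPart 𝒜 B) : v (a * b) = counit (R := k) a * v b := by
  have h : v ((a - algebraMap k A (counit (R := k) a)) * b) = 0 := by
    refine hv.rel _ (Submodule.mul_mem_mul ⟨B.sub_mem ha (B.algebraMap_mem _),
      (𝒜 0).sub_mem ha0 (algebraMap_mem_even 𝒜 _), ?_⟩ hb)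
    rw [SetLike.mem_coe, LinearMap.mem_ker, map_sub, Algebra.algebraMap_eq_smul_one, map_smul,
      IsSuperHopfAlgebra.counit_one 𝒜, smul_eq_mul, mul_one, sub_self]
  rw [sub_mul, map_sub, ← Algebra.smul_def, map_smul, smul_eq_mul] at h
  exact sub_eq_zero.1 h

variable [IsSuperCommutative 𝒜]

lemma IsOddDer.map_mul (hv : IsOddDer 𝒜 B v) (hB : ∀ i, ∀ a ∈ B, proj 𝒜 i a ∈ B) {a b : A}
    (ha : a ∈ B) (hb : b ∈ B) :
    v (a * b) = counit (R := k) a * v b + v a * counit (R := k) b := by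
  have hO : ∀ {a}, a ∈ B → proj 𝒜 1 a ∈ oddPart 𝒜 B := fun h => ⟨hB 1 _ h, proj_mem 𝒜 1 _⟩
  rw [hv.eq_proj a, hv.eq_proj b, ← counit_proj_zero 𝒜 a, ← counit_proj_zero 𝒜 b,
    ← hv.map_even_mul_odd (hB 0 a ha) (proj_mem 𝒜 0 a) (hO hb),
    mul_comm (v _) (counit (R := k) _),
    ← hv.map_even_mul_odd (hB 0 b hb) (proj_mem 𝒜 0 b) (hO ha),
    even_mul 𝒜 (proj_mem 𝒜 0 b)]
  nth_rw 1 [← proj_zero_add_proj_one 𝒜 a, ← proj_zero_add_proj_one 𝒜 b]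
  rw [mul_add, add_mul, add_mul, map_add, map_add, map_add,
    hv.even _ (mul_mem_even 𝒜 (proj_mem 𝒜 0 a) (proj_mem 𝒜 0 b)),
    hv.even _ (mul_mem_even_of_odd 𝒜 (proj_mem 𝒜 1 a) (proj_mem 𝒜 1 b))]
  ring

variable {S : A →ₗ[k] A}

/-- The invariant operator of an odd `ε`-derivation is an odd derivation. -/
lemma IsOddDer.invDer_mul (hv : IsOddDer 𝒜 B v) (hB : ∀ i, ∀ a ∈ B, proj 𝒜 i a ∈ B)
    (hΔ : ∀ a ∈ B.toSubmodule, comul (R := k) a ∈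
      Submodule.map₂ (TensorProduct.mk k A A) B.toSubmodule B.toSubmodule) {a b : A}
    (ha : a ∈ B) (hb : b ∈ B) :
    invDer v (a * b) = a * invDer v b + invDer v a * parityAut 𝒜 b := by
  have hBt := Submodule.map₂_eq_span_image2 (TensorProduct.mk k A A) B.toSubmodule B.toSubmodule
  -- The form `v` is an `ε`-derivation. In the term where it falls on the second leg of `s`, only
  -- the odd part of that leg counts, and the sign rule applies `γ` to the first leg of `t`.
  have key : ∀ s ∈ Submodule.map₂ (TensorProduct.mk k A A) B.toSubmodule B.toSubmodule,
      ∀ t ∈ Submodule.map₂ (TensorProduct.mk k A A) B.toSubmodule B.toSubmodule,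
      contractSnd v (signedMul 𝒜 s t) = contractSnd counit s * contractSnd v t +
        contractSnd v s * parityAut 𝒜 (contractSnd counit t) := by
    intro s hs t ht
    rw [hBt] at hs ht
    induction hs, ht using Submodule.span_induction₂ with
    | mem_mem s t hs ht =>
      obtain ⟨x, hx, y, hy, rfl⟩ := hs
      obtain ⟨z, hz, w, hw, rfl⟩ := ht
      simp only [TensorProduct.mk_apply, signedMul_tmul, map_add, contractSnd_tmul]
      rw [hv.map_mul hB (hB 0 y hy) hw, hv.map_mul hB (hB 1 y hy) hw, counit_proj_one 𝒜,
        counit_proj_zero 𝒜, hv.even _ (proj_mem 𝒜 0 y), ← hv.eq_proj, map_smul, zero_mul,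
        zero_mul, zero_add, add_zero, smul_mul_smul_comm, smul_mul_smul_comm]
    | zero_left t ht => simp
    | zero_right s hs => simp
    | add_left x y z hx hy hz h1 h2 =>
      simp only [map_add, LinearMap.add_apply, h1, h2, add_mul]; abel
    | add_right x y z hx hy hz h1 h2 =>
      simp only [map_add, h1, h2, mul_add]; abel
    | smul_left r x y hx hy h => simp only [map_smul, LinearMap.smul_apply, h, smul_add,
        smul_mul_assoc]
    | smul_right r x y hx hy h => simp only [map_smul, h, smul_add, mul_smul_comm]
  have hε : ∀ a : A, contractSnd counit (comul (R := k) a) = a := fun a => by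
    simp [contractSnd]
  rw [invDer_apply, comul_mul 𝒜, key _ (hΔ a ha) _ (hΔ b hb), hε, hε]; rfl

lemma IsOddDer.invDer_parityAut (hv : IsOddDer 𝒜 B v) (a : A) :
    invDer v (parityAut 𝒜 a) = -parityAut 𝒜 (invDer v a) := by
  rw [invDer_apply, comul_parityAut, invDer_apply]
  generalize comul (R := k) a = t
  induction t with
  | zero => simp
  | add x y hx hy => simp only [map_add, hx, hy, neg_add]
  | tmul x y =>
    have : v (parityAut 𝒜 y) = -v y := by
      rw [hv.eq_proj, proj_one_parityAut, map_neg, ← hv.eq_proj]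
    simp [this]

lemma IsOddDer.invDer_proj_one (hk : (2 : k) ≠ 0) (hv : IsOddDer 𝒜 B v) (a : A) :
    invDer v (proj 𝒜 1 a) = proj 𝒜 0 (invDer v a) := by
  have h1 : invDer v (proj 𝒜 1 a) ∈ 𝒜 0 := mem_even_of_parityAut hk (by
    have := hv.invDer_parityAut (proj 𝒜 1 a)
    rw [parityAut_odd 𝒜 (proj_mem 𝒜 1 a), map_neg, neg_inj] at this
    exact this.symm)
  have h0 : invDer v (proj 𝒜 0 a) ∈ 𝒜 1 := mem_odd_of_parityAut hk (by
    have := hv.invDer_parityAut (proj 𝒜 0 a)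
    rw [parityAut_even 𝒜 (proj_mem 𝒜 0 a)] at this
    rw [this, neg_neg, ← this])
  nth_rw 2 [← proj_zero_add_proj_one 𝒜 a]
  rw [map_add, map_add, proj_zero_of_odd 𝒜 h0, proj_of_mem 𝒜 h1, zero_add]

variable (𝒜 S) in
/-- The map `a ↦ ∑ S(a₍₁₎) p(a₍₂₎)`, where `p` is the projection onto the odd component. -/
def oddLift : A →ₗ[k] A := (toConv S * toConv (proj 𝒜 1)).ofConv

lemma oddLift_apply (a : A) : oddLift 𝒜 S a =
    LinearMap.mul' k A (TensorProduct.map S (proj 𝒜 1) (comul (R := k) a)) := rfl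

/-- For odd `y` this reads `y = ∑ y₍₁₎ oddLift(y₍₂₎)`, which is how the lifts come to generate the
odd ideal. -/
lemma conv_oddLift (hS : IsAntipode 𝒜 S) :
    toConv LinearMap.id * toConv (oddLift 𝒜 S) = toConv (proj 𝒜 1) := by
  rw [oddLift, toConv_ofConv, ← mul_assoc, hS.right_inv, one_mul]

lemma oddLift_parityAut (hS : IsAntipode 𝒜 S) (a : A) :
    oddLift 𝒜 S (parityAut 𝒜 a) = parityAut 𝒜 (oddLift 𝒜 S a) := by
  rw [oddLift_apply, oddLift_apply, comul_parityAut]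
  generalize comul (R := k) a = t
  induction t with
  | zero => simp
  | add x y hx hy => simp only [map_add, hx, hy]
  | tmul x y =>
    simp only [TensorProduct.map_tmul, LinearMap.mul'_apply, AlgHom.toLinearMap_apply,
      hS.map_parityAut, proj_one_parityAut, map_mul, parityAut_odd 𝒜 (proj_mem 𝒜 1 y)]

/-- Put `m_i = S * p_i`, with `p_i` the projection to parity `i`. Multiplicativity of `S` and super
commutativity give `m₁(ab) = m₀(a) m₁(b) + m₁(a) m₀(b)`, and `m₀ + m₁ = S * id` is the counit. -/
lemma oddLift_mul (hS : IsAntipode 𝒜 S) (a b : A) : oddLift 𝒜 S (a * b) =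
    (algebraMap k A (counit (R := k) a) - oddLift 𝒜 S a) * oddLift 𝒜 S b +
      oddLift 𝒜 S a * (algebraMap k A (counit (R := k) b) - oddLift 𝒜 S b) := by
  let m : ZMod 2 → A ⊗[k] A →ₗ[k] A := fun i => LinearMap.mul' k A ∘ₗ TensorProduct.map S (proj 𝒜 i)
  have key : ∀ s t, m 1 (signedMul 𝒜 s t) = m 0 s * m 1 t + m 1 s * m 0 t := by
    intro s t
    induction s with
    | zero => simp
    | add x y hx hy => simp only [map_add, hx, hy, LinearMap.add_apply, add_mul]; abel
    | tmul x y =>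
    induction t with
    | zero => simp
    | add x y hx hy => simp only [map_add, hx, hy, mul_add]; abel
    | tmul z w =>
      have e0 : proj 𝒜 1 (proj 𝒜 0 y * w) = proj 𝒜 0 y * proj 𝒜 1 w := by
        nth_rw 1 [← proj_zero_add_proj_one 𝒜 w]
        rw [mul_add, map_add, proj_of_mem 𝒜 (mul_mem_odd_right 𝒜 (proj_mem 𝒜 0 y) (proj_mem 𝒜 1 w)),
          proj_one_of_even 𝒜 (mul_mem_even 𝒜 (proj_mem 𝒜 0 y) (proj_mem 𝒜 0 w)), zero_add]
      have e1 : proj 𝒜 1 (proj 𝒜 1 y * w) = proj 𝒜 1 y * proj 𝒜 0 w := by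
        nth_rw 1 [← proj_zero_add_proj_one 𝒜 w]
        rw [mul_add, map_add, proj_of_mem 𝒜 (mul_mem_odd_left 𝒜 (proj_mem 𝒜 1 y) (proj_mem 𝒜 0 w)),
          proj_one_of_even 𝒜 (mul_mem_even_of_odd 𝒜 (proj_mem 𝒜 1 y) (proj_mem 𝒜 1 w)), add_zero]
      simp only [m, signedMul_tmul, map_add, LinearMap.comp_apply, TensorProduct.map_tmul,
        LinearMap.mul'_apply, antipode_mul hS, e0, e1, hS.map_parityAut]
      congr 1
      · rw [mul_assoc, mul_assoc, ← mul_assoc (S z), ← even_mul 𝒜 (proj_mem 𝒜 0 y), mul_assoc]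
      · rw [mul_assoc, mul_assoc, ← mul_assoc _ (proj 𝒜 1 y), ← odd_mul 𝒜 (proj_mem 𝒜 1 y),
          mul_assoc]
  have h0 : ∀ a, m 0 (comul (R := k) a) = algebraMap k A (counit (R := k) a) - oddLift 𝒜 S a := by
    intro a
    have h := congrArg (fun f : WithConv (A →ₗ[k] A) => f.ofConv a) hS.left_inv
    change LinearMap.mul' k A (TensorProduct.map S LinearMap.id (comul (R := k) a)) =
      algebraMap k A (counit (R := k) a) at h
    rw [← h, oddLift_apply]
    generalize comul (R := k) a = t
    induction t with
    | zero => simp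
    | add x y hx hy => simp only [map_add, hx, hy]; abel
    | tmul x y => simp [m, ← mul_sub, proj_zero_eq 𝒜 y]
  rw [oddLift_apply, comul_mul 𝒜, ← h0, ← h0]
  exact key _ _

lemma oddLift_mem (hk : (2 : k) ≠ 0) (hB : IsHopfStable 𝒜 S B.toSubmodule) {b : A} (hb : b ∈ B) :
    oddLift 𝒜 S b ∈ oddPow 𝒜 B 1 := by
  have h := convMul_mem (hB.comul b hb) S (proj 𝒜 1)
  rw [oddPow_one]
  refine (mul_le_mul' ?_ ?_ : _ ≤ B.toSubmodule * oddPart 𝒜 B) h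
  · rintro _ ⟨x, hx, rfl⟩; exact hB.antipode x hx
  · rintro _ ⟨x, hx, rfl⟩
    exact ⟨proj_mem_of_parityAut_mem 𝒜 hk hB.parity 1 x hx, proj_mem 𝒜 1 x⟩

lemma oddLift_odd_mem (hk : (2 : k) ≠ 0) (hS : IsAntipode 𝒜 S)
    (hB : IsHopfStable 𝒜 S B.toSubmodule) {b : A} (hb : b ∈ oddPart 𝒜 B) :
    oddLift 𝒜 S b ∈ oddPart 𝒜 B := by
  refine ⟨oddPow_le_subalgebra 1 (oddLift_mem hk hB hb.1), mem_odd_of_parityAut hk ?_⟩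
  rw [← oddLift_parityAut hS, parityAut_odd 𝒜 hb.2, map_neg]

lemma mem_oddPow_two_of_even (hk : (2 : k) ≠ 0) (hB : ∀ a ∈ B, parityAut 𝒜 a ∈ B) {b : A}
    (hb : b ∈ oddPow 𝒜 B 1) (hb0 : b ∈ 𝒜 0) : b ∈ oddPow 𝒜 B 2 := by
  have h : oddPow 𝒜 B 1 ≤ (oddPow 𝒜 B 2).comap (proj 𝒜 0) := by
    rw [oddPow_one]
    refine Submodule.mul_le.2 fun x hx y hy => ?_
    have : proj 𝒜 0 (x * y) = proj 𝒜 1 x * y := by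
      nth_rw 1 [← proj_zero_add_proj_one 𝒜 x]
      rw [add_mul, map_add, proj_zero_of_odd 𝒜 (mul_mem_odd_right 𝒜 (proj_mem 𝒜 0 x) hy.2),
        proj_of_mem 𝒜 (mul_mem_even_of_odd 𝒜 (proj_mem 𝒜 1 x) hy.2), zero_add]
    rw [Submodule.mem_comap, this, ← oddPow_mul_oddPart]
    refine Submodule.mul_mem_mul (oddPart_le_oddPow_one ⟨?_, proj_mem 𝒜 1 x⟩) hy
    exact proj_mem_of_parityAut_mem 𝒜 hk hB 1 x hx
  rw [← proj_of_mem 𝒜 hb0]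
  exact h hb

lemma oddLift_even_mem (hk : (2 : k) ≠ 0) (hS : IsAntipode 𝒜 S)
    (hB : IsHopfStable 𝒜 S B.toSubmodule) {b : A} (hb : b ∈ B) (hb0 : b ∈ 𝒜 0) :
    oddLift 𝒜 S b ∈ oddPow 𝒜 B 2 := by
  refine mem_oddPow_two_of_even hk hB.parity (oddLift_mem hk hB hb) (mem_even_of_parityAut hk ?_)
  rw [← oddLift_parityAut hS, parityAut_even 𝒜 hb0]

/-- By `oddLift_mul`, on a product of two elements killed by `ε` the value is a sum of products of
two values, each in the odd ideal. With `oddLift_even_mem` this makes `oddLift` modulo the square of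
the ideal a function of the class in the odd cotangent space of `B`. -/
lemma oddLift_rel_mem (hk : (2 : k) ≠ 0) (hS : IsAntipode 𝒜 S)
    (hB : IsHopfStable 𝒜 S B.toSubmodule) {b : A} (hb : b ∈ oddRel 𝒜 B) :
    oddLift 𝒜 S b ∈ oddPow 𝒜 B 2 := by
  have h : oddRel 𝒜 B ≤ (oddPow 𝒜 B 2).comap (oddLift 𝒜 S) := by
    refine Submodule.mul_le.2 fun c hc u hu => ?_
    have hcε : counit (R := k) c = 0 := hc.2.2
    rw [Submodule.mem_comap, oddLift_mul hS, hcε, counit_odd 𝒜 hu.2, map_zero, zero_sub, zero_sub]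
    have hc' := oddLift_mem hk hB hc.1
    have hu' := oddLift_mem hk hB hu.1
    exact Submodule.add_mem _
      (oddPow_mul_oddPow hB.parity 1 1 (Submodule.mul_mem_mul (Submodule.neg_mem _ hc') hu'))
      (oddPow_mul_oddPow hB.parity 1 1 (Submodule.mul_mem_mul hc' (Submodule.neg_mem _ hu')))
  exact h hb

/-- Differentiating `∑ S(b₍₁₎) p₁(b₍₂₎)` by the Leibniz rule leaves `∑ S(b₍₁₎) D_v(b₍₂₎) = v(b)` up
to terms with an odd factor on the right. -/
lemma IsOddDer.invDer_oddLift_sub_mem (hk : (2 : k) ≠ 0) (hS : IsAntipode 𝒜 S)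
    (hB : IsHopfStable 𝒜 S B.toSubmodule) (hv : IsOddDer 𝒜 B v) {b : A} (hb : b ∈ B) :
    invDer v (oddLift 𝒜 S b) - algebraMap k A (v b) ∈ oddPow 𝒜 B 1 := by
  have hBp := fun i => proj_mem_of_parityAut_mem 𝒜 hk hB.parity i
  have h1 : toConv S * toConv (invDer v) = toConv (Algebra.linearMap k A ∘ₗ v) := by
    rw [toConv_invDer, ← mul_assoc, hS.left_inv, one_mul]
  have h1b : LinearMap.mul' k A (TensorProduct.map S (invDer v) (comul (R := k) b)) =
      algebraMap k A (v b) := congrArg (fun f : WithConv (A →ₗ[k] A) => f.ofConv b) h1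
  have hle : Submodule.map₂ (TensorProduct.mk k A A) B.toSubmodule B.toSubmodule ≤
      (oddPow 𝒜 B 1).comap (invDer v ∘ₗ LinearMap.mul' k A ∘ₗ TensorProduct.map S (proj 𝒜 1) -
        LinearMap.mul' k A ∘ₗ TensorProduct.map S (invDer v)) := by
    refine Submodule.map₂_le.2 fun x hx y hy => ?_
    have hDy : invDer v y ∈ B := invDer_mem hB.comul hy
    simp only [Submodule.mem_comap, TensorProduct.mk_apply, LinearMap.sub_apply,
      LinearMap.comp_apply, TensorProduct.map_tmul, LinearMap.mul'_apply]
    rw [hv.invDer_mul hBp hB.comul (hB.antipode x hx) (hBp 1 y hy), hv.invDer_proj_one hk,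
      proj_zero_eq, mul_sub, parityAut_odd 𝒜 (proj_mem 𝒜 1 y)]
    have : S x * invDer v y - S x * proj 𝒜 1 (invDer v y) + invDer v (S x) * -proj 𝒜 1 y -
        S x * invDer v y = -(S x * proj 𝒜 1 (invDer v y) + invDer v (S x) * proj 𝒜 1 y) := by
      rw [mul_neg]; abel
    rw [this, oddPow_one]
    exact Submodule.neg_mem _ (Submodule.add_mem _
      (Submodule.mul_mem_mul (hB.antipode x hx) ⟨hBp 1 _ hDy, proj_mem 𝒜 1 _⟩)
      (Submodule.mul_mem_mul (invDer_mem hB.comul (hB.antipode x hx)) ⟨hBp 1 _ hy, proj_mem 𝒜 1 _⟩))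
  have := hle (hB.comul b hb)
  rw [Submodule.mem_comap, LinearMap.sub_apply, LinearMap.comp_apply, LinearMap.comp_apply,
    LinearMap.comp_apply, h1b] at this
  exact this

/-- Lifts of generators of the odd cotangent space generate the odd ideal modulo its square. -/
lemma oddPart_le_span_oddLift (hk : (2 : k) ≠ 0) (hS : IsAntipode 𝒜 S)
    (hB : IsHopfStable 𝒜 S B.toSubmodule) {N : Submodule k A}
    (hN : oddPart 𝒜 B ≤ N ⊔ oddRel 𝒜 B) :
    oddPart 𝒜 B ≤ B.toSubmodule * N.map (oddLift 𝒜 S) ⊔ oddPow 𝒜 B 2 := by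
  have hBp := fun i => proj_mem_of_parityAut_mem 𝒜 hk hB.parity i
  have hmap : B.toSubmodule.map (oddLift 𝒜 S) ≤ N.map (oddLift 𝒜 S) ⊔ oddPow 𝒜 B 2 := by
    rintro _ ⟨b, hb, rfl⟩
    rw [← proj_zero_add_proj_one 𝒜 b, map_add]
    refine Submodule.add_mem _
      (Submodule.mem_sup_right (oddLift_even_mem hk hS hB (hBp 0 b hb) (proj_mem 𝒜 0 b))) ?_
    obtain ⟨n, hn, r, hr, h⟩ := Submodule.mem_sup.1
      (hN (x := proj 𝒜 1 b) ⟨hBp 1 b hb, proj_mem 𝒜 1 b⟩)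
    rw [← h, map_add]
    exact Submodule.add_mem_sup (Submodule.mem_map_of_mem hn) (oddLift_rel_mem hk hS hB hr)
  intro y hy
  have h := convMul_mem (hB.comul y hy.1) LinearMap.id (oddLift 𝒜 S)
  have e : (toConv (LinearMap.id : A →ₗ[k] A) * toConv (oddLift 𝒜 S)) y = y := by
    rw [conv_oddLift hS]; exact proj_of_mem 𝒜 hy.2
  rw [e, Submodule.map_id] at h
  have := mul_le_mul' (le_refl B.toSubmodule) hmap h
  rw [Submodule.mul_sup] at this
  refine (sup_le_sup le_rfl ?_ : _ ≤ B.toSubmodule * N.map (oddLift 𝒜 S) ⊔ _) this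
  rw [oddPow, ← mul_assoc]
  exact mul_le_mul' mul_self_le le_rfl

end Derivation

/-! ### Separation by iterated derivations; the powers of the odd ideal meet in zero -/

section Separation

variable {k A : Type*} [Field k] [Ring A] [Algebra k A]
  {𝒜 : ZMod 2 → Submodule k A} [GradedAlgebra 𝒜] [Coalgebra k A] [IsSuperHopfAlgebra 𝒜]
  [IsSuperCommutative 𝒜] {S : A →ₗ[k] A} {B : Subalgebra k A} {v : A →ₗ[k] k}

/-- The composite of the operators `invDer v`, the first entry of the list being applied first. -/
def iterDer : List (A →ₗ[k] k) → A →ₗ[k] A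
  | [] => LinearMap.id
  | v :: l => iterDer l ∘ₗ invDer v

lemma IsOddDer.invDer_oddPow_mem (hk : (2 : k) ≠ 0) (hB : IsHopfStable 𝒜 S B.toSubmodule)
    (hv : IsOddDer 𝒜 B v) (n : ℕ) {a : A} (ha : a ∈ oddPow 𝒜 B (n + 1)) :
    invDer v a ∈ oddPow 𝒜 B n := by
  have hBp := fun i => proj_mem_of_parityAut_mem 𝒜 hk hB.parity i
  induction n generalizing a with
  | zero =>
    rw [oddPow_zero]
    exact invDer_mem hB.comul (oddPow_le_subalgebra _ ha)
  | succ n ih =>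
    rw [← oddPow_mul_oddPart] at ha
    induction ha using Submodule.mul_induction_on' with
    | mem_mul_mem x hx y hy =>
      rw [hv.invDer_mul hBp hB.comul (oddPow_le_subalgebra _ hx) hy.1, parityAut_odd 𝒜 hy.2]
      refine Submodule.add_mem _ ?_ ?_
      · refine oddPow_mul_oddPow hB.parity (n + 1) 0 (Submodule.mul_mem_mul hx ?_)
        rw [oddPow_zero]; exact invDer_mem hB.comul hy.1
      · rw [← oddPow_mul_oddPart]
        exact Submodule.mul_mem_mul (ih hx) (Submodule.neg_mem _ hy)
    | add x _ y _ hx hy => rw [map_add]; exact Submodule.add_mem _ hx hy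

/-- Differentiating a factor from `X` leaves an element of the odd ideal in its place, so no power
is lost, in contrast to `IsOddDer.invDer_oddPow_mem`. -/
lemma IsOddDer.invDer_mul_pow_mem (hk : (2 : k) ≠ 0) (hB : IsHopfStable 𝒜 S B.toSubmodule)
    (hv : IsOddDer 𝒜 B v) {X : Submodule k A} (hX : X ≤ oddPart 𝒜 B)
    (hvX : ∀ x ∈ X, invDer v x ∈ oddPow 𝒜 B 1) (n : ℕ) {a : A}
    (ha : a ∈ B.toSubmodule * X ^ n) : invDer v a ∈ oddPow 𝒜 B n := by
  have hBp := fun i => proj_mem_of_parityAut_mem 𝒜 hk hB.parity i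
  have hXn : ∀ n, B.toSubmodule * X ^ n ≤ oddPow 𝒜 B n := fun n =>
    mul_le_mul' le_rfl (pow_le_pow_left' hX n)
  induction n generalizing a with
  | zero =>
    rw [oddPow_zero]
    exact invDer_mem hB.comul (oddPow_le_subalgebra _ (hXn _ ha))
  | succ n ih =>
    rw [pow_succ, ← mul_assoc] at ha
    induction ha using Submodule.mul_induction_on' with
    | mem_mul_mem x hx y hy =>
      rw [hv.invDer_mul hBp hB.comul (oddPow_le_subalgebra _ (hXn _ hx)) (hX hy).1,
        parityAut_odd 𝒜 (hX hy).2]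
      refine Submodule.add_mem _ ?_ ?_
      · exact oddPow_mul_oddPow hB.parity n 1 (Submodule.mul_mem_mul (hXn _ hx) (hvX y hy))
      · rw [← oddPow_mul_oddPart]
        exact Submodule.mul_mem_mul (ih hx) (Submodule.neg_mem _ (hX hy))
    | add x _ y _ hx hy => rw [map_add]; exact Submodule.add_mem _ hx hy

/-- A list of odd `ε`-derivations of `B` together with odd elements of `B` dual to them. -/
structure IsDualList (𝒜 : ZMod 2 → Submodule k A) [GradedAlgebra 𝒜] (B : Subalgebra k A)
    (F : List ((A →ₗ[k] k) × A)) : Prop where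
  isOddDer : ∀ p ∈ F, IsOddDer 𝒜 B p.1
  odd : ∀ p ∈ F, p.2 ∈ oddPart 𝒜 B
  self : ∀ p ∈ F, invDer p.1 p.2 - 1 ∈ oddPow 𝒜 B 1
  pairwise : F.Pairwise fun p q => invDer p.1 q.2 ∈ oddPow 𝒜 B 1

/-- Modulo the next power, an element of a power of the odd ideal is detected by the operators of
dual `ε`-derivations. -/
lemma IsDualList.mem_oddPow (hk : (2 : k) ≠ 0) (hB : IsHopfStable 𝒜 S B.toSubmodule)
    {F : List ((A →ₗ[k] k) × A)} (hF : IsDualList 𝒜 B F) {n : ℕ} {b : A}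
    (hb : b ∈ B.toSubmodule * listSpan (F.map Prod.snd) ^ n ⊔ oddPow 𝒜 B (n + 1))
    (h : ∀ T, T.Sublist (F.map Prod.fst) → T.length = n → iterDer T b ∈ oddPow 𝒜 B 1) :
    b ∈ oddPow 𝒜 B (n + 1) := by
  induction F generalizing n b with
  | nil =>
    rcases n with _ | n
    · exact h [] (List.nil_sublist _) rfl
    · rwa [List.map_nil, listSpan_nil, pow_succ, Submodule.mul_bot, Submodule.mul_bot,
        bot_sup_eq] at hb
  | cons p F ih =>
    obtain ⟨v, z⟩ := p
    rcases n with _ | n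
    · exact h [] (List.nil_sublist _) rfl
    have hF' : IsDualList 𝒜 B F := ⟨fun q hq => hF.isOddDer q (List.mem_cons_of_mem _ hq),
      fun q hq => hF.odd q (List.mem_cons_of_mem _ hq),
      fun q hq => hF.self q (List.mem_cons_of_mem _ hq), (List.pairwise_cons.1 hF.pairwise).2⟩
    have hv : IsOddDer 𝒜 B v := hF.isOddDer (v, z) List.mem_cons_self
    have hz : z ∈ oddPart 𝒜 B := hF.odd (v, z) List.mem_cons_self
    have hzv : invDer v z - 1 ∈ oddPow 𝒜 B 1 := hF.self (v, z) List.mem_cons_self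
    have hBp := fun i => proj_mem_of_parityAut_mem 𝒜 hk hB.parity i
    let X : Submodule k A := listSpan (F.map Prod.snd)
    have hX : X ≤ oddPart 𝒜 B := listSpan_le fun x hx => by
      obtain ⟨q, hq, rfl⟩ := List.mem_map.1 hx
      exact hF'.odd q hq
    have hvX : ∀ x ∈ X, invDer v x ∈ oddPow 𝒜 B 1 := by
      have : X ≤ (oddPow 𝒜 B 1).comap (invDer v) := listSpan_le fun x hx => by
        obtain ⟨q, hq, rfl⟩ := List.mem_map.1 hx
        exact (List.pairwise_cons.1 hF.pairwise).1 q hq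
      exact fun x hx => this hx
    have hXn : ∀ n, B.toSubmodule * X ^ n ≤ oddPow 𝒜 B n := fun n =>
      mul_le_mul' le_rfl (pow_le_pow_left' hX n)
    obtain ⟨b', hb', s, hs, rfl⟩ := Submodule.mem_sup.1 hb
    -- Since `z² = 0`, the element becomes `r + q z + s` with `r` and `q` expressed through the
    -- remaining generators and `s` of higher order.
    have hle : B.toSubmodule * listSpan (List.map Prod.snd ((v, z) :: F)) ^ (n + 1) ≤
        B.toSubmodule * X ^ (n + 1) ⊔ (B.toSubmodule * X ^ n) * (k ∙ z) := by
      refine (mul_le_mul' le_rfl (listSpan_cons_pow_le (odd_mul_self 𝒜 hk hz.2)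
        (fun x hx => ?_) n)).trans ?_
      · obtain ⟨q, hq, rfl⟩ := List.mem_map.1 hx
        exact odd_mul_odd 𝒜 hz.2 (hF'.odd q hq).2
      · rw [Submodule.mul_sup, mul_assoc]
    obtain ⟨r, hr, y, hy, rfl⟩ := Submodule.mem_sup.1 (hle hb')
    obtain ⟨q, hq, rfl⟩ := Submodule.mem_mul_span_singleton.1 hy
    -- `D_v` kills the later generators and sends `z` to `1`, both modulo the odd ideal, so it
    -- extracts the coefficient `q`. Duality in this one direction is all that is needed.
    have hDb : invDer v (r + q * z + s) - q ∈ oddPow 𝒜 B (n + 1) := by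
      rw [map_add, map_add, hv.invDer_mul hBp hB.comul (oddPow_le_subalgebra _ (hXn _ hq)) hz.1,
        parityAut_odd 𝒜 hz.2]
      have : invDer v r + (q * invDer v z + invDer v q * -z) + invDer v s - q =
          invDer v r + (q * (invDer v z - 1) + invDer v q * -z) + invDer v s := by
        rw [mul_sub, mul_one]; abel
      rw [this]
      refine Submodule.add_mem _ (Submodule.add_mem _
        (hv.invDer_mul_pow_mem hk hB hX hvX _ hr) (Submodule.add_mem _ ?_ ?_))
        (hv.invDer_oddPow_mem hk hB _ hs)
      · exact oddPow_mul_oddPow hB.parity n 1 (Submodule.mul_mem_mul (hXn _ hq) hzv)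
      · rw [← oddPow_mul_oddPart]
        exact Submodule.mul_mem_mul (hv.invDer_mul_pow_mem hk hB hX hvX _ hq)
          (Submodule.neg_mem _ hz)
    -- Sublists starting with `v` control `D_v b`, hence `q`. Then `q z` is of higher order, and the
    -- sublists omitting `v` control the rest.
    have hq' : q ∈ oddPow 𝒜 B (n + 1) := by
      have h1 : invDer v (r + q * z + s) ∈ oddPow 𝒜 B (n + 1) := by
        refine ih hF' ?_ fun T hT hn => ?_
        · have := Submodule.add_mem_sup hq hDb
          rwa [add_sub_cancel] at this
        · exact h (v :: T) (hT.cons_cons v) (by simp [hn])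
      have := Submodule.sub_mem _ h1 hDb
      rwa [sub_sub_cancel] at this
    refine ih hF' ?_ fun T hT hn => h T (hT.cons v) hn
    rw [add_assoc r]
    refine Submodule.add_mem_sup hr (Submodule.add_mem _ ?_ hs)
    rw [← oddPow_mul_oddPart]
    exact Submodule.mul_mem_mul hq' hz

lemma oddPow_le_of_oddPart_le (hB : ∀ a ∈ B, parityAut 𝒜 a ∈ B) {N : Submodule k A}
    (hN : N ≤ oddPart 𝒜 B) (h : oddPart 𝒜 B ≤ B.toSubmodule * N ⊔ oddPow 𝒜 B 2) (n : ℕ) :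
    oddPow 𝒜 B n ≤ B.toSubmodule * N ^ n ⊔ oddPow 𝒜 B (n + 1) := by
  have hNn : B.toSubmodule * N ^ n ≤ oddPow 𝒜 B n := mul_le_mul' le_rfl (pow_le_pow_left' hN n)
  induction n with
  | zero => rw [oddPow_zero, pow_zero, mul_one]; exact le_sup_left
  | succ n ih =>
    have hNn' : B.toSubmodule * N ^ n ≤ oddPow 𝒜 B n :=
      mul_le_mul' le_rfl (pow_le_pow_left' hN n)
    nth_rw 1 [← oddPow_mul_oddPart]
    refine (mul_le_mul' (ih hNn') le_rfl).trans ?_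
    rw [Submodule.sup_mul]
    refine sup_le ((mul_le_mul' le_rfl h).trans ?_) ?_
    · rw [Submodule.mul_sup]
      refine sup_le_sup ?_ ?_
      · rw [mul_assoc, ← mul_assoc (N ^ n)]
        refine (mul_le_mul' le_rfl (mul_le_mul' (pow_mul_subalgebra_le hB
          (hN.trans inf_le_right) n) le_rfl)).trans ?_
        rw [mul_assoc, ← pow_succ, ← mul_assoc]
        exact mul_le_mul' mul_self_le le_rfl
      · exact (mul_le_mul' hNn' le_rfl).trans (oddPow_mul_oddPow hB n 2)
    · rw [oddPow_mul_oddPart]; exact le_sup_right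

/-- Modulo `B₀⁺ B₁` an even coefficient acts through its counit, so the generators of
`oddPart_adjoin_le` over `B` become generators over `k`. -/
lemma oddPart_adjoin_le_sup (hk : (2 : k) ≠ 0) {C : Submodule k A}
    (hC : ∀ a ∈ C, parityAut 𝒜 a ∈ C)
    (hB : ∀ a ∈ Algebra.adjoin k (C : Set A), parityAut 𝒜 a ∈ Algebra.adjoin k (C : Set A)) :
    oddPart 𝒜 (Algebra.adjoin k (C : Set A)) ≤
      C.map (proj 𝒜 1) ⊔ oddRel 𝒜 (Algebra.adjoin k (C : Set A)) := by
  set B := Algebra.adjoin k (C : Set A)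
  have hCB : C ≤ B.toSubmodule := fun x hx => Algebra.subset_adjoin hx
  have hCO : C.map (proj 𝒜 1) ≤ oddPart 𝒜 B := by
    rintro _ ⟨x, hx, rfl⟩
    exact ⟨hCB (proj_mem_of_parityAut_mem 𝒜 hk hC 1 x hx), proj_mem 𝒜 1 x⟩
  have h : B.toSubmodule * C.map (proj 𝒜 1) ≤
      (C.map (proj 𝒜 1) ⊔ oddRel 𝒜 B).comap (proj 𝒜 1) := by
    refine Submodule.mul_le.2 fun b hb c hc => ?_
    have hc1 := (hCO hc).2
    have e : proj 𝒜 1 (b * c) = counit (R := k) b • c +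
        (proj 𝒜 0 b - algebraMap k A (counit (R := k) b)) * c := by
      nth_rw 1 [← proj_zero_add_proj_one 𝒜 b]
      rw [add_mul, map_add, proj_of_mem 𝒜 (mul_mem_odd_right 𝒜 (proj_mem 𝒜 0 b) hc1),
        proj_one_of_even 𝒜 (mul_mem_even_of_odd 𝒜 (proj_mem 𝒜 1 b) hc1), sub_mul,
        Algebra.smul_def]
      abel
    rw [Submodule.mem_comap, e]
    refine Submodule.add_mem_sup (Submodule.smul_mem _ _ hc) (Submodule.mul_mem_mul
      ⟨B.sub_mem (proj_mem_of_parityAut_mem 𝒜 hk hB 0 b hb) (B.algebraMap_mem _),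
        (𝒜 0).sub_mem (proj_mem 𝒜 0 b) (algebraMap_mem_even 𝒜 _), ?_⟩ (hCO hc))
    rw [SetLike.mem_coe, LinearMap.mem_ker, map_sub, counit_proj_zero,
      Algebra.algebraMap_eq_smul_one, map_smul, IsSuperHopfAlgebra.counit_one 𝒜, smul_eq_mul,
      mul_one, sub_self]
  intro y hy
  rw [← proj_of_mem 𝒜 hy.2]
  exact h (oddPart_adjoin_le hk hB hy)

lemma oddRel_le_odd : oddRel 𝒜 B ≤ 𝒜 1 :=
  Submodule.mul_le.2 fun _ ha _ hb => mul_mem_odd_right 𝒜 ha.2.1 hb.2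

/-- A finitely generated Hopf subalgebra has a finite dual list generating its odd ideal. -/
lemma exists_isDualList (hk : (2 : k) ≠ 0) (hS : IsAntipode 𝒜 S) {C : Submodule k A}
    (hCfg : C.FG) (hC : IsHopfStable 𝒜 S C) : ∃ F, IsDualList 𝒜 (Algebra.adjoin k (C : Set A)) F ∧
      oddPart 𝒜 (Algebra.adjoin k (C : Set A)) ≤
        (Algebra.adjoin k (C : Set A)).toSubmodule * listSpan (F.map Prod.snd) ⊔
          oddPow 𝒜 (Algebra.adjoin k (C : Set A)) 2 := by
  have hB := hC.adjoin hk hS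
  set B := Algebra.adjoin k (C : Set A)
  have hCB : C ≤ B.toSubmodule := fun x hx => Algebra.subset_adjoin hx
  have hsup := oddPart_adjoin_le_sup hk hC.parity hB.parity
  have hCO : C.map (proj 𝒜 1) ≤ oddPart 𝒜 B := by
    rintro _ ⟨x, hx, rfl⟩
    exact ⟨hCB (proj_mem_of_parityAut_mem 𝒜 hk hC.parity 1 x hx), proj_mem 𝒜 1 x⟩
  let q := (oddRel 𝒜 B).mkQ
  let Y := (C.map (proj 𝒜 1)).map q
  have : FiniteDimensional k Y := Module.Finite.iff_fg.2 ((hCfg.map _).map _)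
  let e := Module.finBasis k Y
  have hy : ∀ i, ∃ y ∈ C.map (proj 𝒜 1), q y = e i := fun i => (e i).2
  choose y hyC hye using hy
  have hw : ∀ i, ∃ w : (A ⧸ oddRel 𝒜 B) →ₗ[k] k, w ∘ₗ Y.subtype = e.coord i :=
    fun i => LinearMap.exists_extend _
  choose w hwe using hw
  let v : Fin (Module.finrank k Y) → A →ₗ[k] k := fun i => w i ∘ₗ q ∘ₗ proj 𝒜 1
  have hv : ∀ i, IsOddDer 𝒜 B (v i) := fun i => by
    refine ⟨fun a ha => ?_, fun a ha => ?_⟩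
    · simp [v, proj_one_of_even 𝒜 ha]
    · have : q a = 0 := (Submodule.Quotient.mk_eq_zero _).2 ha
      simp [v, proj_of_mem 𝒜 (oddRel_le_odd ha), this]
  have hvy : ∀ i j, v i (y j) = if j = i then 1 else 0 := fun i j => by
    have h1 : v i (y j) = w i (q (y j)) := by simp [v, proj_of_mem 𝒜 (hCO (hyC j)).2]
    have h2 : w i (e j) = e.coord i (e j) := congrArg (fun f => f (e j)) (hwe i)
    rw [h1, hye, h2, Module.Basis.coord_apply, Module.Basis.repr_self, Finsupp.single_apply]
  -- The `y i` themselves are dual to the `v i` only after applying the counit to `D_{v i} (y j)`;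
  -- their lifts are dual modulo the odd ideal.
  let F : List ((A →ₗ[k] k) × A) := (List.finRange _).map fun i => (v i, oddLift 𝒜 S (y i))
  have hF : ∀ p ∈ F, ∃ i, p = (v i, oddLift 𝒜 S (y i)) := fun p hp => by
    obtain ⟨i, -, rfl⟩ := List.mem_map.1 hp; exact ⟨i, rfl⟩
  refine ⟨F, ⟨fun p hp => ?_, fun p hp => ?_, fun p hp => ?_, ?_⟩, ?_⟩
  · obtain ⟨i, rfl⟩ := hF p hp; exact hv i
  · obtain ⟨i, rfl⟩ := hF p hp; exact oddLift_odd_mem hk hS hB (hCO (hyC i))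
  · obtain ⟨i, rfl⟩ := hF p hp
    have := (hv i).invDer_oddLift_sub_mem hk hS hB (hCO (hyC i)).1
    rwa [hvy, if_pos rfl, map_one] at this
  · refine List.Pairwise.map _ (fun i j hij => ?_) (List.nodup_finRange _)
    have := (hv i).invDer_oddLift_sub_mem hk hS hB (hCO (hyC j)).1
    rwa [hvy, if_neg (Ne.symm hij), map_zero, sub_zero] at this
  · have hspan : listSpan (F.map Prod.snd) =
        (Submodule.span k (Set.range y)).map (oddLift 𝒜 S) := by
      rw [Submodule.map_span, listSpan]
      congr 1; ext x; simp [F]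
    rw [hspan]
    refine oddPart_le_span_oddLift hk hS hB (hsup.trans (sup_le ?_ le_sup_right))
    intro c hc
    have h1 := e.sum_repr ⟨q c, Submodule.mem_map_of_mem hc⟩
    have h2 : c - ∑ i, e.repr ⟨q c, Submodule.mem_map_of_mem hc⟩ i • y i ∈ oddRel 𝒜 B := by
      rw [← Submodule.Quotient.mk_eq_zero]
      change q _ = 0
      rw [map_sub, map_sum, sub_eq_zero]
      have h3 := congrArg Subtype.val h1
      rw [AddSubmonoidClass.coe_finsetSum] at h3
      refine h3.symm.trans (Finset.sum_congr rfl fun i _ => ?_)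
      rw [map_smul, hye]; rfl
    rw [← add_sub_cancel (∑ i, e.repr ⟨q c, Submodule.mem_map_of_mem hc⟩ i • y i) c]
    exact Submodule.add_mem_sup (Submodule.sum_mem _ fun i _ => Submodule.smul_mem _ _
      (Submodule.subset_span ⟨i, rfl⟩)) h2

/-- Elements of a finitely generated Hopf subalgebra are detected by the operators of its odd
`ε`-derivations modulo its odd ideal. -/
lemma eq_zero_of_iterDer (hk : (2 : k) ≠ 0) (hS : IsAntipode 𝒜 S) {C : Submodule k A}
    (hCfg : C.FG) (hC : IsHopfStable 𝒜 S C) {b : A} (hb : b ∈ Algebra.adjoin k (C : Set A))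
    (h : ∀ T : List (A →ₗ[k] k), (∀ v ∈ T, IsOddDer 𝒜 (Algebra.adjoin k (C : Set A)) v) →
      iterDer T b ∈ oddPow 𝒜 (Algebra.adjoin k (C : Set A)) 1) : b = 0 := by
  have hB := hC.adjoin hk hS
  set B := Algebra.adjoin k (C : Set A)
  obtain ⟨F, hF, hFO⟩ := exists_isDualList hk hS hCfg hC
  have hall : ∀ n, b ∈ oddPow 𝒜 B n := by
    intro n
    induction n with
    | zero => rw [oddPow_zero]; exact hb
    | succ n ih =>
      refine hF.mem_oddPow hk hB (oddPow_le_of_oddPart_le hB.parity ?_ hFO n ih) fun T hT _ =>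
        h T fun v hv => ?_
      · refine listSpan_le fun x hx => ?_
        obtain ⟨p, hp, rfl⟩ := List.mem_map.1 hx
        exact hF.odd p hp
      · obtain ⟨p, hp, rfl⟩ := List.mem_map.1 (hT.subset hv)
        exact hF.isOddDer p hp
  obtain ⟨n, hn⟩ := exists_oddPow_eq_bot (𝒜 := 𝒜) hk hCfg hB.parity
  exact (Submodule.mem_bot k).1 (hn ▸ hall n)

/-- Collects the finitely many factors witnessing membership in a product, so that the membership
persists in a finitely generated subalgebra containing them. -/
lemma exists_fg_le_mul {K P Q : Submodule k A} (hK : K.FG) (h : K ≤ P * Q) :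
    ∃ P' ≤ P, ∃ Q' ≤ Q, P'.FG ∧ Q'.FG ∧ K ≤ P' * Q' := by
  induction K, hK using Submodule.fg_induction with
  | singleton a =>
    obtain ⟨T, T', hT, hT', ha⟩ := Submodule.mem_span_mul_finite_of_mem_mul
      (h (Submodule.mem_span_singleton_self a))
    refine ⟨Submodule.span k T, Submodule.span_le.2 hT, Submodule.span k T',
      Submodule.span_le.2 hT', ⟨T, rfl⟩, ⟨T', rfl⟩, ?_⟩
    rwa [Submodule.span_mul_span, Submodule.span_singleton_le_iff_mem]
  | sup K₁ K₂ _ _ h₁ h₂ =>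
    obtain ⟨P₁, hP₁, Q₁, hQ₁, hP₁', hQ₁', hK₁⟩ := h₁ (le_sup_left.trans h)
    obtain ⟨P₂, hP₂, Q₂, hQ₂, hP₂', hQ₂', hK₂⟩ := h₂ (le_sup_right.trans h)
    exact ⟨P₁ ⊔ P₂, sup_le hP₁ hP₂, Q₁ ⊔ Q₂, sup_le hQ₁ hQ₂, hP₁'.sup hP₂', hQ₁'.sup hQ₂',
      sup_le (hK₁.trans (mul_le_mul' le_sup_left le_sup_left))
        (hK₂.trans (mul_le_mul' le_sup_right le_sup_right))⟩

/-- The powers of the odd ideal of a super commutative Hopf algebra intersect in zero. -/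
theorem eq_zero_of_forall_mem_oddPow (hk : (2 : k) ≠ 0) (hS : IsAntipode 𝒜 S) {a : A}
    (h : ∀ n, a ∈ oddPow 𝒜 (⊤ : Subalgebra k A) n) : a = 0 := by
  obtain ⟨C₀, haC₀, hC₀fg, hC₀⟩ := exists_isHopfStable hk hS a
  have : FiniteDimensional k C₀ := Module.Finite.iff_fg.2 hC₀fg
  have hTop : IsHopfStable 𝒜 S (⊤ : Subalgebra k A).toSubmodule := by
    rw [Algebra.top_toSubmodule]; exact isHopfStable_top
  have hfg : ∀ P : Submodule k A, P ≤ C₀ → P.FG := fun P hP => by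
    have : FiniteDimensional k P := Submodule.finiteDimensional_of_le hP
    exact Module.Finite.iff_fg.1 this
  -- Powers of the odd ideal of a subalgebra may be smaller than the traces of those of `A`. The
  -- subalgebra is chosen large enough that on `C₀` membership in the first power and in `A₀⁺ A₁` is
  -- already witnessed inside it; higher powers are not compared.
  obtain ⟨P₁, -, Q₁, hQ₁, hP₁fg, hQ₁fg, h₁⟩ := exists_fg_le_mul
    (hfg (C₀ ⊓ oddPow 𝒜 ⊤ 1) inf_le_left) (inf_le_right.trans oddPow_one.le)
  obtain ⟨P₂, hP₂, Q₂, hQ₂, hP₂fg, hQ₂fg, h₂⟩ := exists_fg_le_mul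
    (hfg (C₀ ⊓ oddRel 𝒜 ⊤) inf_le_left) inf_le_right
  obtain ⟨C, hle, hCfg, hC⟩ := exists_isHopfStable_le hk hS
    (P := C₀ ⊔ (P₁ ⊔ Q₁) ⊔ (P₂ ⊔ Q₂))
    ((hC₀fg.sup (hP₁fg.sup hQ₁fg)).sup (hP₂fg.sup hQ₂fg))
  have hCB : C ≤ (Algebra.adjoin k (C : Set A)).toSubmodule := fun x hx => Algebra.subset_adjoin hx
  have hle' := hle.trans hCB
  rw [sup_le_iff, sup_le_iff, sup_le_iff, sup_le_iff] at hle'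
  obtain ⟨⟨hC₀B, hP₁B, hQ₁B⟩, hP₂B, hQ₂B⟩ := hle'
  set B := Algebra.adjoin k (C : Set A)
  have hI : ∀ c ∈ C₀, c ∈ oddPow 𝒜 ⊤ 1 → c ∈ oddPow 𝒜 B 1 := fun c hc hc' => by
    rw [oddPow_one]
    exact mul_le_mul' hP₁B (le_inf hQ₁B (hQ₁.trans inf_le_right)) (h₁ ⟨hc, hc'⟩)
  have hR : ∀ c ∈ C₀, c ∈ oddRel 𝒜 ⊤ → c ∈ oddRel 𝒜 B := fun c hc hc' =>
    mul_le_mul' (le_inf hP₂B (hP₂.trans inf_le_right))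
      (le_inf hQ₂B (hQ₂.trans inf_le_right)) (h₂ ⟨hc, hc'⟩)
  -- The restriction of `v` to `C₀` kills `C₀ ∩ (A₀ + A₀⁺ A₁)`, hence comes from a form on the
  -- quotient of `A`.
  have hext : ∀ v, IsOddDer 𝒜 B v → ∃ u, IsOddDer 𝒜 ⊤ u ∧ ∀ c ∈ C₀, v c = u c := by
    intro v hv
    let q := (𝒜 0 ⊔ oddRel 𝒜 (⊤ : Subalgebra k A)).mkQ
    have hker : v ∘ₗ C₀.subtype ∈ (LinearMap.ker (q ∘ₗ C₀.subtype)).dualAnnihilator := by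
      rw [Submodule.mem_dualAnnihilator]
      rintro ⟨c, hc⟩ hc'
      have hc'' : c ∈ 𝒜 0 ⊔ oddRel 𝒜 (⊤ : Subalgebra k A) :=
        (Submodule.Quotient.mk_eq_zero _).1 hc'
      obtain ⟨x, hx, y, hy, hxy⟩ := Submodule.mem_sup.1 hc''
      have hp : proj 𝒜 1 c = y := by
        rw [← hxy, map_add, proj_one_of_even 𝒜 hx, proj_of_mem 𝒜 (oddRel_le_odd hy), zero_add]
      change v c = 0
      rw [hv.eq_proj, hp]
      refine hv.rel _ (hR _ ?_ hy)
      rw [← hp]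
      exact proj_mem_of_parityAut_mem 𝒜 hk hC₀.parity 1 c hc
    rw [← LinearMap.range_dualMap_eq_dualAnnihilator_ker] at hker
    obtain ⟨u, hu⟩ := hker
    refine ⟨u ∘ₗ q, ⟨fun a ha => ?_, fun a ha => ?_⟩, fun c hc => ?_⟩
    · have : q a = 0 := (Submodule.Quotient.mk_eq_zero _).2 (Submodule.mem_sup_left ha)
      rw [LinearMap.comp_apply, this, map_zero]
    · have : q a = 0 := (Submodule.Quotient.mk_eq_zero _).2 (Submodule.mem_sup_right ha)
      rw [LinearMap.comp_apply, this, map_zero]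
    · exact (congrArg (fun f => f ⟨c, hc⟩) hu).symm
  refine eq_zero_of_iterDer hk hS hCfg hC (hC₀B haC₀) fun T hT => ?_
  -- The operators preserve the subcoalgebra `C₀`, and there `v` may be replaced by its global
  -- substitute, which lowers powers of the odd ideal of `A` by one. The extra `+ 1` leaves one
  -- power at the end, to be moved to `B`.
  have key : ∀ T : List (A →ₗ[k] k), (∀ v ∈ T, IsOddDer 𝒜 B v) → ∀ c ∈ C₀,
      c ∈ oddPow 𝒜 ⊤ (T.length + 1) → iterDer T c ∈ oddPow 𝒜 B 1 := by
    intro T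
    induction T with
    | nil => exact fun _ c hc hc' => hI c hc hc'
    | cons v T ih =>
      intro hT c hc hc'
      obtain ⟨u, hu, huv⟩ := hext v (hT v List.mem_cons_self)
      refine ih (fun w hw => hT w (List.mem_cons_of_mem _ hw)) _ (invDer_mem hC₀.comul hc) ?_
      rw [invDer_congr hC₀.comul huv hc]
      exact hu.invDer_oddPow_mem hk hTop _ hc'
  exact key T hT a haC₀ (h _)

end Separation

/-! ### Auxiliary facts on the exterior algebra and free comodules -/

section Exterior

variable {k V : Type*} [Field k] [AddCommGroup V] [Module k V]

lemma ι_mul_exterior (x : V) (y : ExteriorAlgebra k V) : ExteriorAlgebra.ι k x * y =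
    CliffordAlgebra.involute y * ExteriorAlgebra.ι k x := by
  induction y using ExteriorAlgebra.induction with
  | algebraMap r => rw [AlgHom.commutes, Algebra.commutes]
  | ι m =>
    have h : CliffordAlgebra.involute (ExteriorAlgebra.ι k m) = -ExteriorAlgebra.ι k m :=
      CliffordAlgebra.involute_ι m
    rw [h, neg_mul, eq_neg_iff_add_eq_zero, ExteriorAlgebra.ι_add_mul_swap]
  | mul a b ha hb => rw [← mul_assoc, ha, mul_assoc, hb, map_mul, mul_assoc]
  | add a b ha hb => rw [mul_add, ha, hb, map_add, add_mul]

end Exterior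

section FreeComodule

variable {k H L : Type*} [Field k] [Ring H] [Algebra k H] [Coalgebra k H] [Ring L] [Algebra k L]

variable (k H L) in
/-- The left coaction of `H` on `H ⊗ L`. -/
def freeCoaction : H ⊗[k] L →ₗ[k] H ⊗[k] (H ⊗[k] L) :=
  (TensorProduct.assoc k H H L).toLinearMap ∘ₗ (comul (R := k) (A := H)).rTensor L

lemma freeCoaction_mul (u : H ⊗[k] L) (y : L) : freeCoaction k H L (u * 1 ⊗ₜ y) =
    (LinearMap.mulRight k (1 ⊗ₜ[k] y : H ⊗[k] L)).lTensor H (freeCoaction k H L u) := by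
  induction u with
  | zero => simp
  | add x y hx hy => rw [add_mul, map_add, hx, hy, map_add, map_add]
  | tmul b z =>
    rw [Algebra.TensorProduct.tmul_mul_tmul, mul_one]
    simp only [freeCoaction, LinearMap.comp_apply, LinearMap.rTensor_tmul]
    generalize comul (R := k) b = t
    induction t with
    | zero => simp
    | add x y hx hy => simp only [TensorProduct.add_tmul, map_add, hx, hy]
    | tmul b c => simp [Algebra.TensorProduct.tmul_mul_tmul]

lemma freeCoaction_tmul_one (b : H) : freeCoaction k H L (b ⊗ₜ 1) =
    ((TensorProduct.mk k H L).flip 1).lTensor H (comul (R := k) b) := by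
  simp only [freeCoaction, LinearMap.comp_apply, LinearMap.rTensor_tmul]
  generalize comul (R := k) b = t
  induction t with
  | zero => simp
  | add x y hx hy => simp only [TensorProduct.add_tmul, map_add, hx, hy]
  | tmul b c => simp

end FreeComodule

/-! ### Ordered products of the operators `1 + R(gᵢ) Dᵢ` -/

section Decomposition

variable {k A : Type*} [Field k] [Ring A] [Algebra k A]
  (𝒜 : ZMod 2 → Submodule k A) [GradedAlgebra 𝒜] [Coalgebra k A]

/-- The class of the odd component of an element in the odd cotangent space. -/
def oddClass : A →ₗ[k] oddCotangent 𝒜 :=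
  Submodule.mkQ _ ∘ₗ (proj 𝒜 1).codRestrict (𝒜 1) (proj_mem 𝒜 1)

lemma oddClass_even {a : A} (ha : a ∈ 𝒜 0) : oddClass 𝒜 a = 0 := by
  have : (proj 𝒜 1).codRestrict (𝒜 1) (proj_mem 𝒜 1) a = 0 :=
    Subtype.ext (proj_one_of_even 𝒜 ha)
  rw [oddClass, LinearMap.comp_apply, this, map_zero]

lemma oddClass_proj_one (a : A) : oddClass 𝒜 (proj 𝒜 1 a) = oddClass 𝒜 a := by
  nth_rw 2 [← proj_zero_add_proj_one 𝒜 a]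
  rw [map_add, oddClass_even 𝒜 (proj_mem 𝒜 0 a), zero_add]

lemma oddClass_surjective : Function.Surjective (oddClass 𝒜) := by
  intro w
  obtain ⟨y, rfl⟩ := Submodule.mkQ_surjective _ w
  refine ⟨y, congrArg _ (Subtype.ext (proj_of_mem 𝒜 y.2))⟩

lemma oddClass_eq_zero_iff {a : A} (ha : a ∈ 𝒜 1) :
    oddClass 𝒜 a = 0 ↔ a ∈ oddRel 𝒜 (⊤ : Subalgebra k A) := by
  rw [oddRel, oddPart, Algebra.top_toSubmodule, top_inf_eq, top_inf_eq]
  refine (Submodule.Quotient.mk_eq_zero _).trans ?_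
  rw [Submodule.submoduleOf, Submodule.mem_comap]
  change proj 𝒜 1 a ∈ _ ↔ _
  rw [proj_of_mem 𝒜 ha]

lemma oddRel_mono {B B' : Subalgebra k A} (h : B ≤ B') : oddRel 𝒜 B ≤ oddRel 𝒜 B' :=
  mul_le_mul' (inf_le_inf_right _ h) (inf_le_inf_right _ h)

/-- The invariant operator on `A` given by a linear form on the odd cotangent space. -/
abbrev cotDer (v : oddCotangent 𝒜 →ₗ[k] k) : A →ₗ[k] A := invDer (v ∘ₗ oddClass 𝒜)

section Operators

variable [IsSuperHopfAlgebra 𝒜] [IsSuperCommutative 𝒜]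

omit [IsSuperHopfAlgebra 𝒜] [IsSuperCommutative 𝒜] in
lemma isOddDer_comp_oddClass (v : oddCotangent 𝒜 →ₗ[k] k) :
    IsOddDer 𝒜 (⊤ : Subalgebra k A) (v ∘ₗ oddClass 𝒜) where
  even a ha := by rw [LinearMap.comp_apply, oddClass_even 𝒜 ha, map_zero]
  rel a ha := by
    have ha1 : a ∈ 𝒜 1 :=
      (Submodule.mul_le.2 fun _ ha _ hb => mul_mem_odd_right 𝒜 ha.2.1 hb.2 :
        oddRel 𝒜 (⊤ : Subalgebra k A) ≤ 𝒜 1) ha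
    rw [LinearMap.comp_apply, (oddClass_eq_zero_iff 𝒜 ha1).2 ha, map_zero]

lemma cotDer_mul (v : oddCotangent 𝒜 →ₗ[k] k) (a b : A) :
    cotDer 𝒜 v (a * b) = a * cotDer 𝒜 v b + cotDer 𝒜 v a * parityAut 𝒜 b := by
  refine (isOddDer_comp_oddClass 𝒜 v).invDer_mul (fun _ _ _ => trivial) (fun a _ => ?_)
    trivial trivial
  rw [Algebra.top_toSubmodule, TensorProduct.map₂_mk_top_top_eq_top]
  trivial

lemma cotDer_parityAut (v : oddCotangent 𝒜 →ₗ[k] k) (a : A) :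
    cotDer 𝒜 v (parityAut 𝒜 a) = -parityAut 𝒜 (cotDer 𝒜 v a) :=
  (isOddDer_comp_oddClass 𝒜 v).invDer_parityAut a

omit [IsSuperCommutative 𝒜] in
lemma cotDer_one (v : oddCotangent 𝒜 →ₗ[k] k) : cotDer 𝒜 v 1 = 0 := by
  rw [invDer_apply, IsSuperHopfAlgebra.comul_one 𝒜, contractSnd_tmul, LinearMap.comp_apply,
    oddClass_even 𝒜 (one_mem_even 𝒜), map_zero, zero_smul]

-- Coassociativity: the operator uses the last leg of the iterated comultiplication and the coaction
-- the first.
omit [IsSuperHopfAlgebra 𝒜] [IsSuperCommutative 𝒜] in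
lemma leftCoaction_invDer (v : A →ₗ[k] k) (a : A) :
    leftCoaction 𝒜 (invDer v a) = (invDer v).lTensor (Bar 𝒜) (leftCoaction 𝒜 a) := by
  have h := Coalgebra.coassoc_apply (R := k) a
  have h' := congrArg ((contractSnd v).lTensor (Bar 𝒜) ∘ₗ
    (toBar 𝒜).toLinearMap.rTensor (A ⊗[k] A)) h
  have e1 : ((contractSnd v).lTensor (Bar 𝒜) ∘ₗ (toBar 𝒜).toLinearMap.rTensor (A ⊗[k] A))
      (comul.lTensor A (comul (R := k) a)) = (invDer v).lTensor (Bar 𝒜) (leftCoaction 𝒜 a) := by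
    rw [leftCoaction, LinearMap.comp_apply (LinearMap.rTensor A _) comul]
    generalize comul (R := k) a = t
    induction t with
    | zero => simp
    | add x y hx hy => simp only [map_add, hx, hy]
    | tmul x y => simp [invDer_apply]
  rw [← e1, ← h, leftCoaction, invDer_apply]
  generalize comul (R := k) a = t
  induction t with
  | zero => simp
  | add x y hx hy => simp only [map_add, hx, hy]
  | tmul x y =>
    rw [contractSnd_tmul, map_smul, LinearMap.comp_apply, LinearMap.rTensor_tmul]
    generalize comul (R := k) x = t
    induction t with
    | zero => simp
    | add x y hx hy => simp only [map_add, hx, hy, smul_add, TensorProduct.add_tmul]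
    | tmul p q => simp [contractSnd_tmul]

end Operators

variable {M E : Type*} [Ring E] [Algebra k E] (v : M → oddCotangent 𝒜 →ₗ[k] k) (p : A →ₐ[k] E)
  (g : M → E)

/-- The composite of `p` with the product over a list of the operators `1 + R(gᵢ) Dᵢ`, where `Dᵢ`
is the invariant operator of `vᵢ`. -/
def partialDecomp : List M → A →ₗ[k] E
  | [] => p.toLinearMap
  | i :: l => partialDecomp l + LinearMap.mulRight k (g i) ∘ₗ partialDecomp l ∘ₗ cotDer 𝒜 (v i)

variable {𝒜 v p g}

lemma partialDecomp_nil (a : A) : partialDecomp 𝒜 v p g [] a = p a := rfl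

lemma partialDecomp_cons (i : M) (l : List M) (a : A) : partialDecomp 𝒜 v p g (i :: l) a =
    partialDecomp 𝒜 v p g l a + partialDecomp 𝒜 v p g l (cotDer 𝒜 (v i) a) * g i := rfl

/-- Elements that square to zero and supercommute with everything with respect to the parity
automorphism `σ`. -/
structure IsOddFamily (σ : E →ₐ[k] E) (g : M → E) : Prop where
  map : ∀ i, σ (g i) = -g i
  mul : ∀ i u, g i * u = σ u * g i
  sq : ∀ i, g i * g i = 0

variable {σ : E →ₐ[k] E}

lemma partialDecomp_one [IsSuperHopfAlgebra 𝒜] (l : List M) : partialDecomp 𝒜 v p g l 1 = 1 := by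
  induction l with
  | nil => exact map_one p
  | cons i l ih => rw [partialDecomp_cons, ih, cotDer_one, map_zero, zero_mul, add_zero]

lemma partialDecomp_counit [IsSuperHopfAlgebra 𝒜] {η : E →ₐ[k] k}
    (hp : ∀ a, η (p a) = counit (R := k) a) (hg : ∀ i, η (g i) = 0) (l : List M) (a : A) :
    η (partialDecomp 𝒜 v p g l a) = counit (R := k) a := by
  induction l generalizing a with
  | nil => exact hp a
  | cons i l ih => rw [partialDecomp_cons, map_add, map_mul, hg, mul_zero, add_zero, ih]

lemma partialDecomp_colinear {ρ : E →ₗ[k] Bar 𝒜 ⊗[k] E}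
    (hp : ∀ a, ρ (p a) = p.toLinearMap.lTensor (Bar 𝒜) (leftCoaction 𝒜 a))
    (hg : ∀ i u, ρ (u * g i) = (LinearMap.mulRight k (g i)).lTensor (Bar 𝒜) (ρ u))
    (l : List M) (a : A) : ρ (partialDecomp 𝒜 v p g l a) =
      (partialDecomp 𝒜 v p g l).lTensor (Bar 𝒜) (leftCoaction 𝒜 a) := by
  induction l generalizing a with
  | nil => exact hp a
  | cons i l ih =>
    rw [partialDecomp_cons, map_add, hg, ih, ih, leftCoaction_invDer,
      partialDecomp, LinearMap.lTensor_add, LinearMap.add_apply, LinearMap.lTensor_comp,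
      LinearMap.lTensor_comp]
    rfl

variable [IsSuperHopfAlgebra 𝒜] [IsSuperCommutative 𝒜]

lemma partialDecomp_parityAut (hσ : IsOddFamily σ g) (hp : ∀ a, p (parityAut 𝒜 a) = σ (p a))
    (l : List M) (a : A) :
    partialDecomp 𝒜 v p g l (parityAut 𝒜 a) = σ (partialDecomp 𝒜 v p g l a) := by
  induction l generalizing a with
  | nil => exact hp a
  | cons i l ih =>
    rw [partialDecomp_cons, cotDer_parityAut, map_neg, ih, ih, partialDecomp_cons, map_add, map_mul,
      hσ.map, neg_mul_comm]

/-- For a single factor, moving `g i` to the right of `b` applies `σ` and produces exactly the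
Leibniz rule for `Dᵢ`; the term quadratic in `g i` vanishes. -/
lemma partialDecomp_mul (hσ : IsOddFamily σ g) (hp : ∀ a, p (parityAut 𝒜 a) = σ (p a))
    (l : List M) (a b : A) : partialDecomp 𝒜 v p g l (a * b) =
      partialDecomp 𝒜 v p g l a * partialDecomp 𝒜 v p g l b := by
  induction l generalizing a b with
  | nil => exact map_mul p a b
  | cons i l ih =>
    simp only [partialDecomp_cons, cotDer_mul, map_add, ih, partialDecomp_parityAut hσ hp]
    generalize partialDecomp 𝒜 v p g l (cotDer 𝒜 (v i) a) = a'
    generalize partialDecomp 𝒜 v p g l (cotDer 𝒜 (v i) b) = b'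
    generalize partialDecomp 𝒜 v p g l a = a
    generalize partialDecomp 𝒜 v p g l b = b
    have h1 : ∀ s t, s * g i * t = s * σ t * g i := fun s t => by
      rw [mul_assoc, hσ.mul, mul_assoc]
    have h2 : a' * g i * (b' * g i) = 0 := by
      rw [← mul_assoc, h1, mul_assoc, hσ.sq, mul_zero]
    rw [add_mul a, mul_add a, mul_add (a' * _), h2, h1, add_zero, add_mul, ← mul_assoc]
    abel

/-- Operators that vanish on a subspace stable under the comultiplication may be dropped. -/
lemma partialDecomp_filter {C : Submodule k A}
    (hC : ∀ a ∈ C, comul (R := k) a ∈ Submodule.map₂ (TensorProduct.mk k A A) C C)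
    (q : M → Prop) [DecidablePred q] (hq : ∀ i, ¬ q i → ∀ a ∈ C, v i (oddClass 𝒜 a) = 0)
    (l : List M) {a : A} (ha : a ∈ C) :
    partialDecomp 𝒜 v p g l a = partialDecomp 𝒜 v p g (l.filter q) a := by
  induction l generalizing a with
  | nil => rfl
  | cons i l ih =>
    by_cases h : q i
    · rw [List.filter_cons_of_pos (by simpa using h), partialDecomp_cons, partialDecomp_cons, ih ha,
        ih (invDer_mem hC ha)]
    · have h0 : cotDer 𝒜 (v i) a = 0 := by
        rw [cotDer, invDer_congr (w := 0) hC (hq i h) ha, invDer_apply]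
        simp [contractSnd]
      rw [List.filter_cons_of_neg (by simpa using h), partialDecomp_cons, ih ha, h0, map_zero,
        zero_mul, add_zero]

end Decomposition

/-! ### Bases padded by zeros -/

section DualSystem

variable {k W M : Type*} [Field k] [AddCommGroup W] [Module k W]

/-- A basis of `W` and the coordinate forms with respect to it, both extended by zero to a larger
index set. -/
structure IsDualSystem (v : M → W →ₗ[k] k) (x : M → W) : Prop where
  span : Submodule.span k (Set.range x) = ⊤
  self : ∀ i, v i (x i) = 1 ∨ v i = 0 ∧ x i = 0
  ne : ∀ i j, i ≠ j → v i (x j) = 0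

variable {v : M → W →ₗ[k] k} {x : M → W}

lemma IsDualSystem.self_of_ne (h : IsDualSystem v x) {i : M} (hi : v i ≠ 0) : v i (x i) = 1 :=
  (h.self i).resolve_right fun h => hi h.1

lemma IsDualSystem.sum_eq (h : IsDualSystem v x) {w : W} {F : Finset M}
    (hF : ∀ i, i ∉ F → v i w = 0) : ∑ i ∈ F, v i w • x i = w := by
  classical
  obtain ⟨c, hc⟩ := Finsupp.mem_span_range_iff_exists_finsupp.1
    (h.span ▸ Submodule.mem_top : w ∈ Submodule.span k (Set.range x))
  rw [Finsupp.sum] at hc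
  have hv : ∀ i, v i w = c i * v i (x i) := fun i => by
    rw [← hc, map_sum, Finset.sum_eq_single i]
    · rw [map_smul, smul_eq_mul]
    · intro j _ hj
      rw [map_smul, h.ne i j hj.symm, smul_zero]
    · intro hi
      rw [Finsupp.notMem_support_iff.1 hi, zero_smul, map_zero]
  have hvx : ∀ i, v i w • x i = c i • x i := fun i => by
    rw [hv]
    obtain h1 | ⟨-, h0⟩ := h.self i
    · rw [h1, mul_one]
    · rw [h0, smul_zero, smul_zero]
  have h1 : ∑ i ∈ F, v i w • x i = ∑ i ∈ F ∪ c.support, v i w • x i :=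
    Finset.sum_subset Finset.subset_union_left fun i _ hi => by rw [hF i hi, zero_smul]
  have h2 : ∑ i ∈ c.support, v i w • x i = ∑ i ∈ F ∪ c.support, v i w • x i :=
    Finset.sum_subset Finset.subset_union_right fun i _ hi => by
      rw [hvx, Finsupp.notMem_support_iff.1 hi, zero_smul]
  rw [h1, ← h2, ← hc]
  refine (Finset.sum_congr rfl fun i _ => ?_)
  rw [hc, hvx]

lemma IsDualSystem.finite (h : IsDualSystem v x) (w : W) : {i | v i w ≠ 0}.Finite := by
  have hw : w ∈ Submodule.span k (Set.range x) := h.span ▸ Submodule.mem_top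
  induction hw using Submodule.span_induction with
  | mem w hw =>
    obtain ⟨j, rfl⟩ := hw
    exact (Set.finite_singleton j).subset fun i hi => by
      by_contra hij
      exact hi (h.ne i j hij)
  | zero => simp
  | add w w' _ _ h h' =>
    refine (h.union h').subset fun i hi => ?_
    by_contra hi'
    rw [Set.mem_union, not_or, Set.mem_ofPred_eq, Set.mem_ofPred_eq, not_not, not_not] at hi'
    exact hi (by rw [map_add, hi'.1, hi'.2, add_zero])
  | smul c w _ h => exact h.subset fun i hi hi' => hi (by rw [map_smul, hi', smul_zero])

/-- Makes the product over an infinite basis finite on each finite-dimensional subcoalgebra. -/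
lemma IsDualSystem.finite_of_fg (h : IsDualSystem v x) {P : Submodule k W} (hP : P.FG) :
    {i | ∃ w ∈ P, v i w ≠ 0}.Finite := by
  obtain ⟨s, rfl⟩ := hP
  refine (Set.Finite.biUnion s.finite_toSet fun w _ => h.finite w).subset ?_
  rintro i ⟨w, hw, hi⟩
  by_contra hi'
  have h0 : ∀ w ∈ s, v i w = 0 := fun w hw => by
    by_contra hw'
    exact hi' (Set.mem_iUnion₂.2 ⟨w, hw, hw'⟩)
  have : Submodule.span k (s : Set W) ≤ LinearMap.ker (v i) := Submodule.span_le.2 h0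
  exact hi (this hw)

end DualSystem

/-! ### The limit over finite sets of indices -/

section Limit

variable {k A : Type*} [Field k] [Ring A] [Algebra k A]
  {𝒜 : ZMod 2 → Submodule k A} [GradedAlgebra 𝒜] [Coalgebra k A]
  [IsSuperHopfAlgebra 𝒜] [IsSuperCommutative 𝒜] {S : A →ₗ[k] A}
  {M E : Type*} [LinearOrder M] [Ring E] [Algebra k E] {v : M → oddCotangent 𝒜 →ₗ[k] k}
  {x : M → oddCotangent 𝒜} {p : A →ₐ[k] E} {g : M → E} {σ : E →ₐ[k] E}

lemma partialDecomp_sort_eq {C : Submodule k A}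
    (hC : ∀ a ∈ C, comul (R := k) a ∈ Submodule.map₂ (TensorProduct.mk k A A) C C)
    {G F : Finset M} (hG : ∀ i, i ∉ G → ∀ a ∈ C, v i (oddClass 𝒜 a) = 0) (hGF : G ⊆ F) {a : A}
    (ha : a ∈ C) : partialDecomp 𝒜 v p g F.sort a = partialDecomp 𝒜 v p g G.sort a := by
  classical
  rw [partialDecomp_filter hC (fun i => i ∈ G) hG (F.sort (· ≤ ·)) ha]
  congr 2
  refine (List.perm_of_nodup_nodup_toFinset_eq ((F.sort_nodup _).filter _) (G.sort_nodup _)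
    ?_).eq_of_pairwise (fun a b _ _ h h' => le_antisymm h h')
      ((F.pairwise_sort _).filter _) (G.pairwise_sort _)
  ext i
  simpa using fun h => hGF h

lemma exists_partialDecomp_eventually (hk : (2 : k) ≠ 0) (hS : IsAntipode 𝒜 S)
    (h : IsDualSystem v x) (a : A) : ∃ G : Finset M, ∀ F, G ⊆ F →
      partialDecomp 𝒜 v p g F.sort a = partialDecomp 𝒜 v p g G.sort a := by
  obtain ⟨C, haC, hCfg, hC⟩ := exists_isHopfStable hk hS a
  refine ⟨(h.finite_of_fg (hCfg.map (oddClass 𝒜))).toFinset, fun F hF =>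
    partialDecomp_sort_eq hC.comul (fun i hi b hb => ?_) hF haC⟩
  by_contra hb'
  exact hi ((Set.Finite.mem_toFinset _).2 ⟨_, Submodule.mem_map_of_mem hb, hb'⟩)

/-- The algebra map which is the eventual value of `partialDecomp` along the finite sets of
indices. -/
lemma exists_decompHom (hk : (2 : k) ≠ 0) (hS : IsAntipode 𝒜 S)
    (h : IsDualSystem v x) (hσ : IsOddFamily σ g) (hp : ∀ a, p (parityAut 𝒜 a) = σ (p a)) :
    ∃ Φ : A →ₐ[k] E, ∀ a, ∀ᶠ F : Finset M in Filter.atTop,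
      partialDecomp 𝒜 v p g F.sort a = Φ a := by
  choose G hG using exists_partialDecomp_eventually (p := p) (g := g) hk hS h
  have hev : ∀ a, ∀ᶠ F : Finset M in Filter.atTop, partialDecomp 𝒜 v p g F.sort a =
      partialDecomp 𝒜 v p g (G a).sort a := fun a =>
    Filter.eventually_atTop.2 ⟨G a, fun F hF => hG a F hF⟩
  -- Each identity involves finitely many elements, so it can be checked at a common finite stage.
  refine ⟨AlgHom.ofLinearMap
    { toFun := fun a => partialDecomp 𝒜 v p g ((G a).sort (· ≤ ·)) a
      map_add' := fun a b => ?_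
      map_smul' := fun c a => ?_ } ?_ fun a b => ?_, hev⟩
  · obtain ⟨F, h1, h2, h3⟩ := ((hev a).and ((hev b).and (hev (a + b)))).exists
    rw [← h1, ← h2, ← h3, map_add]
  · obtain ⟨F, h1, h2⟩ := ((hev a).and (hev (c • a))).exists
    rw [← h1, ← h2, map_smul]; rfl
  · exact partialDecomp_one _
  · obtain ⟨F, h1, h2, h3⟩ := ((hev a).and ((hev b).and (hev (a * b)))).exists
    change partialDecomp 𝒜 v p g _ _ = partialDecomp 𝒜 v p g _ _ * partialDecomp 𝒜 v p g _ _
    rw [← h1, ← h2, ← h3, partialDecomp_mul hσ hp]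

end Limit

/-! ### Injectivity of the decomposition -/

section Injective

variable {k A : Type*} [Field k] [Ring A] [Algebra k A]
  {𝒜 : ZMod 2 → Submodule k A} [GradedAlgebra 𝒜] [Coalgebra k A]
  {S : A →ₗ[k] A}
  {M E : Type*} [Ring E] [Algebra k E] {v : M → oddCotangent 𝒜 →ₗ[k] k}
  {x : M → oddCotangent 𝒜} {p : A →ₐ[k] E} {g : M → E}

/-- Operators on `E` that behave like the contractions with the forms `vᵢ`. -/
structure IsContraction (v : M → oddCotangent 𝒜 →ₗ[k] k) (x : M → oddCotangent 𝒜) (p : A →ₐ[k] E)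
    (g : M → E) (c : M → E →ₗ[k] E) : Prop where
  base : ∀ i a, c i (p a) = 0
  mul : ∀ i j u, c i (u * g j) = v i (x j) • u - c i u * g j

variable {c : M → E →ₗ[k] E}

lemma IsContraction.partialDecomp (hc : IsContraction v x p g c) {i : M} {l : List M}
    (hi : ∀ j ∈ l, v i (x j) = 0) (a : A) : c i (partialDecomp 𝒜 v p g l a) = 0 := by
  induction l generalizing a with
  | nil => exact hc.base i a
  | cons j l ih =>
    have ih := ih fun j hj => hi j (List.mem_cons_of_mem _ hj)
    rw [partialDecomp_cons, map_add, ih, hc.mul, ih, hi j List.mem_cons_self, zero_smul, zero_mul,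
      sub_zero, add_zero]

/-- Contracting with `c i` isolates the coefficient of the first generator, because `c i` kills the
stages built from later ones. Both that coefficient and the remaining term then vanish, and the list
shrinks. -/
lemma IsContraction.iterDer_eq_zero (hc : IsContraction v x p g c) {l : List M} (hl : l.Nodup)
    (h1 : ∀ i ∈ l, v i (x i) = 1) (h0 : ∀ i j, i ≠ j → v i (x j) = 0) {a : A}
    (ha : SuperHopf.partialDecomp 𝒜 v p g l a = 0) {T : List M} (hT : T.Sublist l) :
    p (iterDer (T.map fun i => v i ∘ₗ oddClass 𝒜) a) = 0 := by
  induction l generalizing a T with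
  | nil =>
    rw [List.sublist_nil.1 hT]
    exact ha
  | cons i l ih =>
    have hil : ∀ j ∈ l, v i (x j) = 0 := fun j hj => h0 i j fun h =>
      (List.nodup_cons.1 hl).1 (h ▸ hj)
    have hD : SuperHopf.partialDecomp 𝒜 v p g l (cotDer 𝒜 (v i) a) = 0 := by
      have h := congrArg (c i) ha
      rwa [partialDecomp_cons, map_add, hc.mul, hc.partialDecomp hil, hc.partialDecomp hil,
        h1 i List.mem_cons_self, one_smul, zero_mul, sub_zero, zero_add, map_zero] at h
    rw [partialDecomp_cons, hD, zero_mul, add_zero] at ha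
    have ih := fun {a} => @ih (List.nodup_cons.1 hl).2
      (fun j hj => h1 j (List.mem_cons_of_mem _ hj)) a
    rcases hT with _ | h | h
    · exact ih ha ‹_›
    · exact ih hD ‹_›

lemma exists_finset_mem_mul_span_pow {R : Type*} [Ring R] [Algebra k R] [DecidableEq M]
    {B : Submodule k R} (z : M → R) (n : ℕ) {b : R}
    (hb : b ∈ B * Submodule.span k (Set.range z) ^ n) :
    ∃ F : Finset M, b ∈ B * Submodule.span k (z '' F) ^ n := by
  have hmono : ∀ {F F' : Finset M}, F ⊆ F' → ∀ n, B * Submodule.span k (z '' F) ^ n ≤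
      B * Submodule.span k (z '' F') ^ n := fun h n =>
    mul_le_mul' le_rfl (pow_le_pow_left' (Submodule.span_mono (Set.image_mono h)) n)
  induction n generalizing b with
  | zero => exact ⟨∅, by simpa using hb⟩
  | succ n ih =>
    rw [pow_succ, ← mul_assoc] at hb
    induction hb using Submodule.mul_induction_on' with
    | mem_mul_mem b hb y hy =>
      obtain ⟨F, hF⟩ := ih hb
      obtain ⟨c, rfl⟩ := Finsupp.mem_span_range_iff_exists_finsupp.1 hy
      refine ⟨F ∪ c.support, ?_⟩
      rw [pow_succ, ← mul_assoc]
      exact Submodule.mul_mem_mul (hmono Finset.subset_union_left n hF) (Submodule.sum_mem _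
        fun i hi => Submodule.smul_mem _ _ (Submodule.subset_span
          (Set.mem_image_of_mem _ (Finset.mem_coe.2 (Finset.mem_union_right _ hi)))))
    | add b _ b' _ h h' =>
      obtain ⟨F, hF⟩ := h
      obtain ⟨F', hF'⟩ := h'
      exact ⟨F ∪ F', Submodule.add_mem _ (hmono Finset.subset_union_left _ hF)
        (hmono Finset.subset_union_right _ hF')⟩

variable [IsSuperHopfAlgebra 𝒜] [IsSuperCommutative 𝒜] [LinearOrder M]

/-- Elements on which all finite stages of the decomposition vanish are zero. -/
theorem eq_zero_of_partialDecomp (hk : (2 : k) ≠ 0) (hS : IsAntipode 𝒜 S) (h : IsDualSystem v x)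
    (hpk : ∀ a, p a = 0 → a ∈ oddPow 𝒜 (⊤ : Subalgebra k A) 1)
    (hc : IsContraction v x p g c) {a : A}
    (ha : ∀ᶠ F : Finset M in Filter.atTop, partialDecomp 𝒜 v p g F.sort a = 0) : a = 0 := by
  classical
  have hTop : IsHopfStable 𝒜 S (⊤ : Subalgebra k A).toSubmodule := by
    rw [Algebra.top_toSubmodule]; exact isHopfStable_top
  -- For padding indices the representative is chosen to be zero, so that its lift is zero and
  -- contributes nothing to the span.
  have hy : ∀ i, ∃ y ∈ 𝒜 1, oddClass 𝒜 y = x i ∧ (v i = 0 → y = 0) := fun i => by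
    by_cases hi : v i = 0
    · have hx : x i = 0 := ((h.self i).resolve_left (by simp [hi])).2
      exact ⟨0, (𝒜 1).zero_mem, by rw [hx, map_zero], fun _ => rfl⟩
    obtain ⟨y, hy⟩ := oddClass_surjective 𝒜 (x i)
    exact ⟨proj 𝒜 1 y, proj_mem 𝒜 1 y, by rw [oddClass_proj_one, hy], fun h => absurd h hi⟩
  choose y hy1 hyx hy0 using hy
  have hyO : ∀ i, y i ∈ oddPart 𝒜 (⊤ : Subalgebra k A) := fun i => ⟨trivial, hy1 i⟩
  have hspan : oddPart 𝒜 (⊤ : Subalgebra k A) ≤ Submodule.span k (Set.range y) ⊔ oddRel 𝒜 ⊤ := by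
    intro b hb
    have hw : oddClass 𝒜 b ∈ (Submodule.span k (Set.range y)).map (oddClass 𝒜) := by
      rw [Submodule.map_span, ← Set.range_comp]
      have : oddClass 𝒜 ∘ y = x := funext hyx
      rw [this, h.span]; trivial
    obtain ⟨b', hb', hbb⟩ := hw
    have hb1 : b' ∈ 𝒜 1 := Submodule.span_le.2 (by rintro _ ⟨i, rfl⟩; exact hy1 i) hb'
    rw [← add_sub_cancel b' b]
    refine Submodule.add_mem_sup hb' ((oddClass_eq_zero_iff 𝒜 ((𝒜 1).sub_mem hb.2 hb1)).1 ?_)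
    rw [map_sub, hbb, sub_self]
  let z := fun i => oddLift 𝒜 S (y i)
  have hzO : ∀ i, z i ∈ oddPart 𝒜 (⊤ : Subalgebra k A) := fun i =>
    oddLift_odd_mem hk hS hTop (hyO i)
  have hgen := oddPart_le_span_oddLift hk hS hTop hspan
  rw [Submodule.map_span, ← Set.range_comp] at hgen
  have hN : Submodule.span k (Set.range z) ≤ oddPart 𝒜 (⊤ : Subalgebra k A) :=
    Submodule.span_le.2 (by rintro _ ⟨i, rfl⟩; exact hzO i)
  refine eq_zero_of_forall_mem_oddPow hk hS fun n => ?_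
  induction n with
  | zero => rw [oddPow_zero]; trivial
  | succ n ih =>
    obtain ⟨b, hb, b', hb', rfl⟩ := Submodule.mem_sup.1
      (oddPow_le_of_oddPart_le hTop.parity hN hgen n ih)
    obtain ⟨G, hG⟩ := exists_finset_mem_mul_span_pow z n hb
    obtain ⟨F, hF, hGF⟩ := (ha.and (Filter.eventually_ge_atTop G)).exists
    -- Padding indices give no dual pair; dropping them changes neither the finite stage nor the
    -- span of the lifts.
    let l := F.sort.filter fun i => v i ≠ 0
    have hl : l.Nodup := (F.sort_nodup _).filter _
    have hlv : ∀ i ∈ l, v i (x i) = 1 := fun i hi =>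
      h.self_of_ne (by simpa using (List.mem_filter.1 hi).2)
    rw [partialDecomp_filter (C := ⊤) (q := fun i => v i ≠ 0)
      (isHopfStable_top (𝒜 := 𝒜) (S := S)).comul
      (fun i hi a _ => by rw [not_not.1 hi, LinearMap.zero_apply]) _ trivial] at hF
    have hdual : IsDualList 𝒜 (⊤ : Subalgebra k A) (l.map fun i => (v i ∘ₗ oddClass 𝒜, z i)) := by
      refine ⟨fun q hq => ?_, fun q hq => ?_, fun q hq => ?_, ?_⟩
      · obtain ⟨i, -, rfl⟩ := List.mem_map.1 hq
        exact isOddDer_comp_oddClass 𝒜 (v i)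
      · obtain ⟨i, -, rfl⟩ := List.mem_map.1 hq
        exact hzO i
      · obtain ⟨i, hi, rfl⟩ := List.mem_map.1 hq
        have := (isOddDer_comp_oddClass 𝒜 (v i)).invDer_oddLift_sub_mem hk hS hTop (hyO i).1
        rwa [LinearMap.comp_apply, hyx, hlv i hi, map_one] at this
      · refine List.Pairwise.map _ (fun i j hij => ?_) hl
        have := (isOddDer_comp_oddClass 𝒜 (v i)).invDer_oddLift_sub_mem hk hS hTop (hyO j).1
        rwa [LinearMap.comp_apply, hyx, h.ne i j hij, map_zero, sub_zero] at this
    have e1 : (l.map fun i => (v i ∘ₗ oddClass 𝒜, z i)).map Prod.snd = l.map z := by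
      rw [List.map_map]; rfl
    have e2 : (l.map fun i => (v i ∘ₗ oddClass 𝒜, z i)).map Prod.fst =
        l.map fun i => v i ∘ₗ oddClass 𝒜 := by
      rw [List.map_map]; rfl
    refine hdual.mem_oddPow hk hTop (Submodule.add_mem_sup ?_ hb') fun T hT _ => ?_
    · rw [e1]
      refine (mul_le_mul' le_rfl (pow_le_pow_left' ?_ n) :
        _ ≤ (⊤ : Subalgebra k A).toSubmodule * listSpan (l.map z) ^ n) hG
      rw [Submodule.span_le]
      rintro _ ⟨i, hi, rfl⟩
      by_cases hvi : v i = 0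
      · have : z i = 0 := by change oddLift 𝒜 S (y i) = 0; rw [hy0 i hvi, map_zero]
        rw [this]; exact Submodule.zero_mem _
      · exact Submodule.subset_span (List.mem_map_of_mem (List.mem_filter.2
          ⟨(Finset.mem_sort _).2 (hGF hi), by simpa using hvi⟩))
    · rw [e2] at hT
      obtain ⟨T', hT', rfl⟩ := List.sublist_map_iff.1 hT
      exact hpk _ (hc.iterDer_eq_zero hl hlv h.ne hF hT')

end Injective

/-! ### Successive approximation along a nilpotent filtration -/

section Nilpotent

variable {k R : Type*} [Field k] [Ring R] [Algebra k R] {U T : Subalgebra k R}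
  {X : Submodule k R}

/-- A subalgebra that covers a nilpotently filtered algebra modulo the first step, and the
generators of the first step modulo the second one, is everything. -/
lemma subalgebra_le_of_nilpotent (hX : X ≤ U.toSubmodule)
    (hXU : X * U.toSubmodule ≤ U.toSubmodule * X) {N : ℕ} (hN : X ^ N = ⊥)
    (h1 : U.toSubmodule ≤ T.toSubmodule ⊔ U.toSubmodule * X)
    (h2 : X ≤ T.toSubmodule ⊔ U.toSubmodule * X ^ 2) : U ≤ T := by
  let J : ℕ → Submodule k R := fun n => U.toSubmodule * X ^ n
  have hXnU : ∀ n, X ^ n * U.toSubmodule ≤ J n := by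
    intro n
    induction n with
    | zero => rw [pow_zero, one_mul]; simp [J]
    | succ n ih =>
      rw [pow_succ, mul_assoc]
      refine (mul_le_mul' le_rfl hXU).trans ?_
      rw [← mul_assoc]
      refine (mul_le_mul' ih le_rfl).trans ?_
      rw [mul_assoc, ← pow_succ]
  have hJJ : ∀ m n, J m * J n ≤ J (m + n) := fun m n => by
    change _ * _ * (_ * _) ≤ _ * _
    rw [mul_assoc, ← mul_assoc (X ^ m)]
    refine (mul_le_mul' le_rfl (mul_le_mul' (hXnU m) le_rfl)).trans ?_
    rw [mul_assoc, ← pow_add, ← mul_assoc]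
    exact mul_le_mul' mul_self_le le_rfl
  have hXJ : ∀ n, X ^ n ≤ J n := fun n => le_mul_of_subalgebra _
  have hJU : ∀ n, J n ≤ U.toSubmodule := by
    intro n
    induction n with
    | zero => simp [J]
    | succ n ih =>
      change _ * X ^ (n + 1) ≤ _
      rw [pow_succ, ← mul_assoc]
      exact (mul_le_mul' ih hX).trans mul_self_le
  have hJ : ∀ n, J (n + 1) ≤ J n := fun n => by
    change _ * X ^ (n + 1) ≤ _ * X ^ n
    rw [add_comm, pow_add, pow_one, ← mul_assoc]
    exact mul_le_mul' ((mul_le_mul' le_rfl hX).trans mul_self_le) le_rfl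
  have hX1 : X ≤ T.toSubmodule ⊓ J 1 ⊔ J 2 := fun x hx => by
    obtain ⟨t, ht, u, hu, rfl⟩ := Submodule.mem_sup.1 (h2 hx)
    refine Submodule.add_mem_sup ⟨ht, ?_⟩ hu
    have := Submodule.sub_mem _ (hXJ 1 (by rwa [pow_one])) (hJ 1 hu)
    rwa [add_sub_cancel_right] at this
  -- Keeping the approximants inside `J n` ensures that the error terms of a product drop to the
  -- next step of the filtration.
  have hXn : ∀ n, X ^ n ≤ T.toSubmodule ⊓ J n ⊔ J (n + 1) := by
    intro n
    induction n with
    | zero =>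
      rw [pow_zero]
      exact le_sup_of_le_left (le_inf one_le_subalgebra ((pow_zero X).symm.le.trans (hXJ 0)))
    | succ n ih =>
      rw [pow_succ]
      refine (mul_le_mul' ih hX1).trans ?_
      rw [Submodule.sup_mul, Submodule.mul_sup]
      refine sup_le (sup_le (le_sup_of_le_left (le_inf ?_ ?_)) (le_sup_of_le_right ?_))
        (le_sup_of_le_right ?_)
      · exact (mul_le_mul' inf_le_left inf_le_left).trans mul_self_le
      · exact (mul_le_mul' inf_le_right inf_le_right).trans (hJJ n 1)
      · exact (mul_le_mul' inf_le_right le_rfl).trans (hJJ n 2)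
      · refine (mul_le_mul' le_rfl (sup_le inf_le_right (hJ 1))).trans (hJJ (n + 1) 1)
  have hU1 : U.toSubmodule ≤ T.toSubmodule ⊓ U.toSubmodule ⊔ J 1 := fun u hu => by
    obtain ⟨t, ht, j, hj, rfl⟩ := Submodule.mem_sup.1 (h1 hu)
    rw [← pow_one X] at hj
    refine Submodule.add_mem_sup ⟨ht, ?_⟩ hj
    have := Submodule.sub_mem _ hu (hJU 1 hj)
    rwa [add_sub_cancel_right] at this
  have hUn : ∀ n, U.toSubmodule ≤ T.toSubmodule ⊔ J n := by
    intro n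
    induction n with
    | zero => exact le_sup_of_le_right (by simp [J])
    | succ n ih =>
      refine ih.trans (sup_le le_sup_left ?_)
      refine (mul_le_mul' hU1 (hXn n)).trans ?_
      rw [Submodule.sup_mul, Submodule.mul_sup]
      refine sup_le (sup_le (le_sup_of_le_left ?_) (le_sup_of_le_right ?_))
        (le_sup_of_le_right ?_)
      · exact (mul_le_mul' inf_le_left inf_le_left).trans mul_self_le
      · refine (mul_le_mul' inf_le_right le_rfl).trans ?_
        rw [← mul_assoc]
        exact mul_le_mul' mul_self_le le_rfl
      · refine (mul_le_mul' le_rfl (sup_le inf_le_right (hJ n))).trans ?_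
        rw [add_comm]
        exact hJJ 1 n
  have := hUn N
  simp only [J, hN, Submodule.mul_bot, sup_bot_eq] at this
  exact this

end Nilpotent

/-! ### Surjectivity on a Hopf subalgebra -/

section Surjective

variable {k A : Type*} [Field k] [Ring A] [Algebra k A]
  {𝒜 : ZMod 2 → Submodule k A} [GradedAlgebra 𝒜] [Coalgebra k A]
  [IsSuperHopfAlgebra 𝒜] [IsSuperCommutative 𝒜] {S : A →ₗ[k] A}
  {M E : Type*} [LinearOrder M] [Ring E] [Algebra k E] {v : M → oddCotangent 𝒜 →ₗ[k] k}
  {x : M → oddCotangent 𝒜} {p : A →ₐ[k] E} {g : oddCotangent 𝒜 →ₗ[k] E} {σ : E →ₐ[k] E}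

/-- If a subalgebra contains the values of the decomposition on a Hopf subalgebra `B`, and the
generators relevant for `B` up to the odd cotangent space of `B`, then it contains the image of `B`
in `Ā` and these generators. -/
lemma mem_of_partialDecomp_mem (hk : (2 : k) ≠ 0) (hS : IsAntipode 𝒜 S) (h : IsDualSystem v x)
    (hσ : IsOddFamily σ g) (hp : ∀ a, σ (p a) = p a) (hp1 : ∀ a ∈ 𝒜 1, p a = 0)
    {B : Subalgebra k A} (hB : IsHopfStable 𝒜 S B.toSubmodule) {G : Finset M}
    (hG : ∀ i, i ∉ G → ∀ b ∈ B, v i (oddClass 𝒜 b) = 0) {R : Subalgebra k E}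
    (hR : ∀ b ∈ B, partialDecomp 𝒜 v p (fun i => g (x i)) G.sort b ∈ R)
    (hx : ∀ i ∈ G, x i ∈ B.toSubmodule.map (oddClass 𝒜) ⊔ R.toSubmodule.comap g) :
    (∀ b ∈ B, p b ∈ R) ∧ ∀ i ∈ G, g (x i) ∈ R := by
  classical
  let X : Submodule k E := listSpan ((G.sort (· ≤ ·)).map fun i => g (x i))
  have hXg : ∀ i ∈ G, g (x i) ∈ X := fun i hi =>
    Submodule.subset_span (List.mem_map.2 ⟨i, (Finset.mem_sort _).2 hi, rfl⟩)
  have hXw : ∀ y ∈ X, ∃ w, g w = y := by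
    have : X ≤ LinearMap.range g := listSpan_le fun y hy => by
      obtain ⟨i, -, rfl⟩ := List.mem_map.1 hy
      exact ⟨_, rfl⟩
    exact fun y hy => this hy
  have hXnil : X ^ (((G.sort (· ≤ ·)).map fun i => g (x i)).length + 1) = ⊥ := by
    refine listSpan_pow_eq_bot (fun y hy => ?_) fun y hy z hz => ?_
    · obtain ⟨i, -, rfl⟩ := List.mem_map.1 hy
      exact hσ.sq _
    · obtain ⟨i, -, rfl⟩ := List.mem_map.1 hy
      obtain ⟨j, -, rfl⟩ := List.mem_map.1 hz
      rw [hσ.mul, hσ.map, neg_mul]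
  -- The comparison takes place in `U`, filtered by the subspaces `U X ^ n`, which vanish for large
  -- `n`. The goal becomes `U ≤ R`.
  let U : Subalgebra k E := Algebra.adjoin k (B.toSubmodule.map p.toLinearMap ∪ X : Set E)
  have hXU : X ≤ U.toSubmodule := fun y hy => Algebra.subset_adjoin (Or.inr hy)
  have hpU : ∀ b ∈ B, p b ∈ U := fun b hb => Algebra.subset_adjoin (Or.inl ⟨b, hb, rfl⟩)
  have hσU : ∀ u ∈ U, σ u ∈ U := by
    have : U ≤ U.comap σ := Algebra.adjoin_le <| by
      rintro _ (⟨b, hb, rfl⟩ | hy)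
      · change σ (p b) ∈ U
        rw [hp]; exact hpU b hb
      · obtain ⟨w, rfl⟩ := hXw _ hy
        change σ (g w) ∈ U
        rw [hσ.map]; exact U.neg_mem (hXU hy)
    exact this
  have hcomm : X * U.toSubmodule ≤ U.toSubmodule * X := Submodule.mul_le.2 fun y hy u hu => by
    obtain ⟨w, rfl⟩ := hXw _ hy
    rw [hσ.mul]
    exact Submodule.mul_mem_mul (hσU u hu) hy
  have hUX : U.toSubmodule * X ≤ U.toSubmodule := (mul_le_mul' le_rfl hXU).trans mul_self_le
  have hfirst : ∀ l : List M, (∀ i ∈ l, i ∈ G) → ∀ b ∈ B,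
      partialDecomp 𝒜 v p (fun i => g (x i)) l b - p b ∈ U.toSubmodule * X := by
    intro l hl
    induction l with
    | nil => intro b _; rw [partialDecomp_nil, sub_self]; exact Submodule.zero_mem _
    | cons i l ih =>
      intro b hb
      have ih := ih fun i hi => hl i (List.mem_cons_of_mem _ hi)
      have hD : cotDer 𝒜 (v i) b ∈ B := invDer_mem hB.comul hb
      have hmem := U.add_mem (hUX (ih _ hD)) (hpU _ hD)
      rw [sub_add_cancel] at hmem
      rw [partialDecomp_cons, add_sub_right_comm]
      exact Submodule.add_mem _ (ih b hb)
        (Submodule.mul_mem_mul hmem (hXg i (hl i List.mem_cons_self)))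
  -- The expansion of the product up to first order in the generators; `hfirst` is the order zero
  -- version.
  have hsecond : ∀ l : List M, (∀ i ∈ l, i ∈ G) → ∀ b ∈ B,
      partialDecomp 𝒜 v p (fun i => g (x i)) l b - p b -
        (l.map fun i => p (cotDer 𝒜 (v i) b) * g (x i)).sum ∈ U.toSubmodule * X ^ 2 := by
    intro l hl
    induction l with
    | nil =>
      intro b _
      rw [partialDecomp_nil, sub_self, List.map_nil, List.sum_nil, sub_self]
      exact Submodule.zero_mem _
    | cons i l ih =>
      intro b hb
      have hl' : ∀ j ∈ l, j ∈ G := fun j hj => hl j (List.mem_cons_of_mem _ hj)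
      have hD : cotDer 𝒜 (v i) b ∈ B := invDer_mem hB.comul hb
      have e : partialDecomp 𝒜 v p (fun i => g (x i)) (i :: l) b - p b -
          ((i :: l).map fun i => p (cotDer 𝒜 (v i) b) * g (x i)).sum =
          (partialDecomp 𝒜 v p (fun i => g (x i)) l b - p b -
            (l.map fun i => p (cotDer 𝒜 (v i) b) * g (x i)).sum) +
          (partialDecomp 𝒜 v p (fun i => g (x i)) l (cotDer 𝒜 (v i) b) -
            p (cotDer 𝒜 (v i) b)) * g (x i) := by
        rw [partialDecomp_cons, List.map_cons, List.sum_cons, sub_mul]; abel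
      rw [e]
      refine Submodule.add_mem _ (ih hl' b hb) ?_
      rw [pow_two, ← mul_assoc]
      exact Submodule.mul_mem_mul (hfirst l hl' _ hD) (hXg i (hl i List.mem_cons_self))
  have hGs : ∀ i ∈ G.sort (· ≤ ·), i ∈ G := fun i hi => (Finset.mem_sort _).1 hi
  have hp' : ∀ a ∈ oddPow 𝒜 B 1, p a = 0 := by
    have : oddPow 𝒜 B 1 ≤ LinearMap.ker p.toLinearMap := by
      rw [oddPow_one]
      refine Submodule.mul_le.2 fun a _ b hb => ?_
      rw [LinearMap.mem_ker, AlgHom.toLinearMap_apply, map_mul, hp1 b hb.2, mul_zero]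
    exact this
  -- For the odd element `oddLift c` the constant term vanishes, and `p` turns its first order
  -- coefficients into the scalars `v i (oddClass c)`. Their combination with the `x i` is the class
  -- of `c`.
  have hlift : ∀ c ∈ oddPart 𝒜 B, g (oddClass 𝒜 c) ∈ R.toSubmodule ⊔ U.toSubmodule * X ^ 2 := by
    intro c hc
    have hz := oddLift_odd_mem hk hS hB hc
    have hsum : ((G.sort (· ≤ ·)).map fun i =>
        p (cotDer 𝒜 (v i) (oddLift 𝒜 S c)) * g (x i)).sum = g (oddClass 𝒜 c) := by
      have e : ∀ i, p (cotDer 𝒜 (v i) (oddLift 𝒜 S c)) * g (x i) =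
          g (v i (oddClass 𝒜 c) • x i) := fun i => by
        have hv : IsOddDer 𝒜 B (v i ∘ₗ oddClass 𝒜) :=
          ⟨(isOddDer_comp_oddClass 𝒜 (v i)).even,
            fun a ha => (isOddDer_comp_oddClass 𝒜 (v i)).rel a (oddRel_mono 𝒜 le_top ha)⟩
        have := hp' _ (hv.invDer_oddLift_sub_mem hk hS hB hc.1)
        rw [map_sub, sub_eq_zero, AlgHom.commutes] at this
        rw [this, map_smul, Algebra.smul_def]; rfl
      simp only [e]
      have hw := congrArg g (h.sum_eq (F := G) (w := oddClass 𝒜 c) fun i hi => hG i hi c hc.1)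
      rw [map_sum, Finset.sum, ← Finset.sort_eq G (· ≤ ·), Multiset.map_coe,
        Multiset.sum_coe] at hw
      exact hw
    have hs := hsecond _ hGs _ hz.1
    rw [hsum, hp1 _ hz.2, sub_zero] at hs
    have := Submodule.add_mem_sup (S := R.toSubmodule) (hR _ hz.1) (Submodule.neg_mem _ hs)
    rwa [neg_sub, add_sub_cancel] at this
  have hBp := fun i => proj_mem_of_parityAut_mem 𝒜 hk hB.parity i
  have h2 : X ≤ R.toSubmodule ⊔ U.toSubmodule * X ^ 2 := listSpan_le fun y hy => by
    obtain ⟨i, hi, rfl⟩ := List.mem_map.1 hy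
    obtain ⟨_, ⟨b, hb, rfl⟩, w, hw, hbw⟩ := Submodule.mem_sup.1 (hx i (hGs i hi))
    rw [← hbw, map_add]
    refine Submodule.add_mem _ ?_ (Submodule.mem_sup_left hw)
    rw [← oddClass_proj_one]
    exact hlift _ ⟨hBp 1 b hb, proj_mem 𝒜 1 b⟩
  have hJU : U.toSubmodule * X * U.toSubmodule ≤ U.toSubmodule * X := by
    rw [mul_assoc]
    refine (mul_le_mul' le_rfl hcomm).trans ?_
    rw [← mul_assoc]
    exact mul_le_mul' mul_self_le le_rfl
  have hUJ : U.toSubmodule * (U.toSubmodule * X) ≤ U.toSubmodule * X := by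
    rw [← mul_assoc]
    exact mul_le_mul' mul_self_le le_rfl
  have h1 : U.toSubmodule ≤ (R ⊓ U).toSubmodule ⊔ U.toSubmodule * X := by
    have hcl : ((R ⊓ U).toSubmodule ⊔ U.toSubmodule * X) *
        ((R ⊓ U).toSubmodule ⊔ U.toSubmodule * X) ≤
          (R ⊓ U).toSubmodule ⊔ U.toSubmodule * X := by
      have hRU : (R ⊓ U).toSubmodule ≤ U.toSubmodule := inf_le_right (a := R)
      rw [Submodule.sup_mul, Submodule.mul_sup]
      refine sup_le (sup_le (le_sup_of_le_left mul_self_le) (le_sup_of_le_right ?_))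
        (le_sup_of_le_right ?_)
      · exact (mul_le_mul' hRU le_rfl).trans hUJ
      · exact (mul_le_mul' le_rfl (sup_le hRU hUX)).trans hJU
    intro u hu
    have hu' : u ∈ U := hu
    induction hu' using Algebra.adjoin_induction with
    | mem u hu' =>
      rcases hu' with ⟨b, hb, rfl⟩ | hy
      · have hf := hfirst _ hGs b hb
        have hmem := U.add_mem (hUX hf) (hpU b hb)
        rw [sub_add_cancel] at hmem
        have := Submodule.add_mem_sup (S := (R ⊓ U).toSubmodule) ⟨hR b hb, hmem⟩
          (Submodule.neg_mem _ hf)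
        rwa [neg_sub, add_sub_cancel] at this
      · exact Submodule.mem_sup_right (le_mul_of_subalgebra _ hy)
    | algebraMap r => exact Submodule.mem_sup_left ((R ⊓ U).algebraMap_mem r)
    | add a b ha hb iha ihb => exact Submodule.add_mem _ (iha ha) (ihb hb)
    | mul a b ha hb iha ihb => exact hcl (Submodule.mul_mem_mul (iha ha) (ihb hb))
  have hUR : U ≤ R := subalgebra_le_of_nilpotent hXU hcomm hXnil
    (h1.trans (sup_le_sup_right (fun _ h => h.1) _)) h2
  exact ⟨fun b hb => hUR (hpU b hb), fun i hi => hUR (hXU (hXg i hi))⟩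

end Surjective

/-! ### Bases adapted to a well-ordered exhaustion -/

section Adapted

variable {k A : Type*} [Field k] [Ring A] [Algebra k A]
  {𝒜 : ZMod 2 → Submodule k A} [GradedAlgebra 𝒜] [Coalgebra k A]
  {S : A →ₗ[k] A} {Λ M : Type*} [LinearOrder Λ] {C : Λ → Submodule k A} {r : M → Λ}
  {v : M → oddCotangent 𝒜 →ₗ[k] k} {x : M → oddCotangent 𝒜}

/-- A basis of the odd cotangent space that is compatible with an exhaustion by finite dimensional
Hopf stable subspaces. -/
structure IsAdaptedSystem (𝒜 : ZMod 2 → Submodule k A) [GradedAlgebra 𝒜] (S : A →ₗ[k] A)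
    (C : Λ → Submodule k A) (r : M → Λ) (v : M → oddCotangent 𝒜 →ₗ[k] k)
    (x : M → oddCotangent 𝒜) : Prop extends IsDualSystem v x where
  fg : ∀ l, (C l).FG
  stable : ∀ l, IsHopfStable 𝒜 S (C l)
  cover : ∀ a, ∃ l, a ∈ C l
  vanish : ∀ i l, l < r i → ∀ a ∈ C l, v i (oddClass 𝒜 a) = 0
  mem : ∀ i, x i ∈ (C (r i)).map (oddClass 𝒜) ⊔ ⨆ l < r i, (C l).map (oddClass 𝒜)

variable [IsSuperHopfAlgebra 𝒜] [IsSuperCommutative 𝒜] [LinearOrder M] [WellFoundedLT Λ]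
  {E : Type*} [Ring E] [Algebra k E] {p : A →ₐ[k] E} {g : oddCotangent 𝒜 →ₗ[k] E}
  {σ : E →ₐ[k] E}

lemma oddClass_adjoin_le (hk : (2 : k) ≠ 0) (hS : IsAntipode 𝒜 S) {C : Submodule k A}
    (hC : IsHopfStable 𝒜 S C) :
    (Algebra.adjoin k (C : Set A)).toSubmodule.map (oddClass 𝒜) ≤ C.map (oddClass 𝒜) := by
  have hB := hC.adjoin hk hS
  rintro _ ⟨b, hb, rfl⟩
  rw [← oddClass_proj_one]
  obtain ⟨_, ⟨c, hc, rfl⟩, s, hs, hcs⟩ := Submodule.mem_sup.1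
    (oddPart_adjoin_le_sup hk hC.parity hB.parity
      ⟨proj_mem_of_parityAut_mem 𝒜 hk hB.parity 1 b hb, proj_mem 𝒜 1 b⟩)
  rw [← hcs, map_add, (oddClass_eq_zero_iff 𝒜 (oddRel_le_odd hs)).2 (oddRel_mono 𝒜 le_top hs),
    add_zero, oddClass_proj_one]
  exact Submodule.mem_map_of_mem hc

/-- Well-founded induction on the level. By `vanish`, an index relevant for `C l` has level at most
`l`. At a lower level its generator is in the range by induction; at level `l`, `mem` writes `x i`
as a class from `C l` plus classes already treated, as `mem_of_partialDecomp_mem` demands. -/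
lemma IsAdaptedSystem.mem_range (hk : (2 : k) ≠ 0) (hS : IsAntipode 𝒜 S)
    (h : IsAdaptedSystem 𝒜 S C r v x) (hσ : IsOddFamily σ g) (hp : ∀ a, σ (p a) = p a)
    (hp1 : ∀ a ∈ 𝒜 1, p a = 0) {Φ : A →ₐ[k] E} (hΦ : ∀ a, ∀ᶠ F : Finset M in Filter.atTop,
      partialDecomp 𝒜 v p (fun i => g (x i)) F.sort a = Φ a) :
    (∀ a, p a ∈ Φ.range) ∧ ∀ w, g w ∈ Φ.range := by
  have key : ∀ l, (∀ b ∈ C l, p b ∈ Φ.range) ∧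
      (C l).map (oddClass 𝒜) ≤ Φ.range.toSubmodule.comap g := by
    intro l
    induction l using WellFoundedLT.induction with
    | ind l ih =>
      have hB := (h.stable l).adjoin hk hS
      have hCB : C l ≤ (Algebra.adjoin k (C l : Set A)).toSubmodule :=
        fun x hx => Algebra.subset_adjoin hx
      have hBC := oddClass_adjoin_le hk hS (h.stable l)
      set B := Algebra.adjoin k (C l : Set A)
      let G := (h.finite_of_fg ((h.fg l).map (oddClass 𝒜))).toFinset
      have hG : ∀ i, i ∉ G → ∀ b ∈ B, v i (oddClass 𝒜 b) = 0 := fun i hi b hb => by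
        by_contra hb'
        exact hi ((Set.Finite.mem_toFinset _).2 ⟨_, hBC (Submodule.mem_map_of_mem hb), hb'⟩)
      have hx : ∀ i ∈ G, x i ∈ B.toSubmodule.map (oddClass 𝒜) ⊔ Φ.range.toSubmodule.comap g := by
        intro i hi
        obtain ⟨_, ⟨c, hc, rfl⟩, hi⟩ := (Set.Finite.mem_toFinset _).1 hi
        have hri : r i ≤ l := not_lt.1 fun hlt => hi (h.vanish i l hlt c hc)
        refine (sup_le ?_ (le_sup_of_le_right (iSup₂_le fun m hm => (ih m
          (hm.trans_le hri)).2)) : _ ≤ _) (h.mem i)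
        obtain hri | hri := hri.lt_or_eq
        · exact le_sup_of_le_right (ih _ hri).2
        · rw [hri]; exact le_sup_of_le_left (Submodule.map_mono hCB)
      obtain ⟨h1, h2⟩ := mem_of_partialDecomp_mem hk hS h.toIsDualSystem hσ hp hp1 hB hG
        (R := Φ.range) (fun b hb => by
          obtain ⟨F, hF, hGF⟩ := ((hΦ b).and (Filter.eventually_ge_atTop G)).exists
          rw [← partialDecomp_sort_eq hB.comul hG hGF hb, hF]
          exact ⟨b, rfl⟩) hx
      refine ⟨fun b hb => h1 b (hCB hb), ?_⟩
      rintro _ ⟨c, hc, rfl⟩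
      rw [Submodule.mem_comap, ← h.sum_eq (F := G) (w := oddClass 𝒜 c)
        fun i hi => hG i hi c (hCB hc), map_sum]
      refine Submodule.sum_mem _ fun i hi => ?_
      rw [map_smul]
      exact Submodule.smul_mem _ _ (h2 i hi)
  refine ⟨fun a => ?_, fun w => ?_⟩
  · obtain ⟨l, hl⟩ := h.cover a
    exact (key l).1 a hl
  · obtain ⟨a, rfl⟩ := oddClass_surjective 𝒜 w
    obtain ⟨l, hl⟩ := h.cover a
    exact (key l).2 (Submodule.mem_map_of_mem hl)

end Adapted

/-! ### The super algebra `H ⊗ ⋀ V` -/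

section Tensor

variable {k H V : Type*} [Field k] [Ring H] [Algebra k H] [AddCommGroup V] [Module k V]

/-- The parity automorphism of `H ⊗ ⋀ V`. -/
def tensorInvolute : H ⊗[k] ExteriorAlgebra k V →ₐ[k] H ⊗[k] ExteriorAlgebra k V :=
  Algebra.TensorProduct.map (AlgHom.id k H) CliffordAlgebra.involute

lemma tensorInvolute_tmul (b : H) (y : ExteriorAlgebra k V) :
    tensorInvolute (b ⊗ₜ[k] y) = b ⊗ₜ[k] CliffordAlgebra.involute y :=
  Algebra.TensorProduct.map_tmul ..

variable (k H) in
/-- The generator `1 ⊗ w` of `H ⊗ ⋀ V`. -/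
def tensorGen : V →ₗ[k] H ⊗[k] ExteriorAlgebra k V :=
  TensorProduct.mk k H (ExteriorAlgebra k V) 1 ∘ₗ ExteriorAlgebra.ι k

lemma tensorGen_apply (w : V) : tensorGen k H w = 1 ⊗ₜ[k] ExteriorAlgebra.ι k w := rfl

lemma isOddFamily_tensorGen : IsOddFamily tensorInvolute (tensorGen k H (V := V)) where
  map w := by
    have h : CliffordAlgebra.involute (ExteriorAlgebra.ι k w) = -ExteriorAlgebra.ι k w :=
      CliffordAlgebra.involute_ι w
    rw [tensorGen_apply, tensorInvolute_tmul, h, TensorProduct.tmul_neg]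
  mul w u := by
    induction u with
    | zero => simp
    | add x y hx hy => rw [mul_add, hx, hy, map_add, add_mul]
    | tmul b y =>
      rw [tensorGen_apply, tensorInvolute_tmul, Algebra.TensorProduct.tmul_mul_tmul,
        Algebra.TensorProduct.tmul_mul_tmul, one_mul, mul_one, ι_mul_exterior]
  sq w := by
    rw [tensorGen_apply, Algebra.TensorProduct.tmul_mul_tmul, ExteriorAlgebra.ι_sq_zero,
      TensorProduct.tmul_zero]

variable (H) in
/-- The right contraction on `H ⊗ ⋀ V` with a linear form. -/
def tensorContract (d : V →ₗ[k] k) : H ⊗[k] ExteriorAlgebra k V →ₗ[k] H ⊗[k] ExteriorAlgebra k V :=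
  ((CliffordAlgebra.contractRight (Q := (0 : QuadraticForm k V))).flip d).lTensor H

lemma tensorContract_tmul_one (d : V →ₗ[k] k) (b : H) :
    tensorContract H d (b ⊗ₜ[k] (1 : ExteriorAlgebra k V)) = 0 := by
  have h : CliffordAlgebra.contractRight (1 : ExteriorAlgebra k V) d = 0 :=
    CliffordAlgebra.contractRight_one _ d
  rw [tensorContract, LinearMap.lTensor_tmul, LinearMap.flip_apply, h, TensorProduct.tmul_zero]

lemma tensorContract_mul (d : V →ₗ[k] k) (u : H ⊗[k] ExteriorAlgebra k V) (w : V) :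
    tensorContract H d (u * tensorGen k H w) =
      d w • u - tensorContract H d u * tensorGen k H w := by
  induction u with
  | zero => simp
  | add x y hx hy => rw [add_mul, map_add, hx, hy, map_add, smul_add, add_mul]; abel
  | tmul b y =>
    have h : CliffordAlgebra.contractRight (y * ExteriorAlgebra.ι k w) d =
        d w • y - CliffordAlgebra.contractRight y d * ExteriorAlgebra.ι k w :=
      CliffordAlgebra.contractRight_mul_ι d w y
    rw [tensorGen_apply, Algebra.TensorProduct.tmul_mul_tmul, mul_one, tensorContract,
      LinearMap.lTensor_tmul, LinearMap.flip_apply, h, LinearMap.lTensor_tmul, LinearMap.flip_apply,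
      TensorProduct.tmul_sub, TensorProduct.tmul_smul, Algebra.TensorProduct.tmul_mul_tmul, mul_one]

lemma eq_zero_of_tmul_one {b : H} (h : b ⊗ₜ[k] (1 : ExteriorAlgebra k V) = 0) : b = 0 := by
  have h' := congrArg (TensorProduct.rid k H ∘
    (ExteriorAlgebra.algebraMapInv (R := k) (M := V)).toLinearMap.lTensor H) h
  simpa using h'

lemma eq_top_of_tensorGen_mem {R : Subalgebra k (H ⊗[k] ExteriorAlgebra k V)}
    (h0 : ∀ b : H, b ⊗ₜ[k] (1 : ExteriorAlgebra k V) ∈ R) (h1 : ∀ w, tensorGen k H w ∈ R) :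
    R = ⊤ := by
  rw [eq_top_iff]
  rintro u -
  have hy : ∀ y : ExteriorAlgebra k V, (1 : H) ⊗ₜ[k] y ∈ R := fun y => by
    induction y using ExteriorAlgebra.induction with
    | algebraMap c =>
      rw [Algebra.algebraMap_eq_smul_one, TensorProduct.tmul_smul]
      exact R.smul_mem (h0 1) c
    | ι w => exact h1 w
    | mul a b ha hb =>
      rw [← one_mul (1 : H), ← Algebra.TensorProduct.tmul_mul_tmul]
      exact R.mul_mem ha hb
    | add a b ha hb => rw [TensorProduct.tmul_add]; exact R.add_mem ha hb
  induction u with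
  | zero => exact R.zero_mem
  | add x y hx hy => exact R.add_mem hx hy
  | tmul b y =>
    rw [← mul_one b, ← one_mul y, ← Algebra.TensorProduct.tmul_mul_tmul]
    exact R.mul_mem (h0 b) (hy y)

/-- The homogeneous components of `H ⊗ ⋀ V` are the eigenspaces of the parity automorphism. -/
lemma mem_range_lTensor_evenOdd (hk : (2 : k) ≠ 0) {u : H ⊗[k] ExteriorAlgebra k V} {i : ZMod 2}
    {c : k} (hi : i = 0 ∧ c = 1 ∨ i = 1 ∧ c = -1) (hu : c • tensorInvolute u = u) :
    u ∈ LinearMap.range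
      ((CliffordAlgebra.evenOdd (0 : QuadraticForm k V) i).subtype.lTensor H) := by
  -- With `c = ±1`, the operator `1 + c γ` is twice the projection onto the component of parity `i`.
  have hy : ∀ y : ExteriorAlgebra k V, y + c • CliffordAlgebra.involute y ∈
      CliffordAlgebra.evenOdd (0 : QuadraticForm k V) i := by
    intro y
    obtain ⟨y₀, h₀, y₁, h₁, rfl⟩ := exists_even_add_odd
      (CliffordAlgebra.evenOdd (0 : QuadraticForm k V)) y
    rw [map_add, CliffordAlgebra.involute_eq_of_mem_even h₀,
      CliffordAlgebra.involute_eq_of_mem_odd h₁]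
    obtain ⟨rfl, rfl⟩ | ⟨rfl, rfl⟩ := hi
    · have : y₀ + y₁ + (1 : k) • (y₀ + -y₁) = y₀ + y₀ := by rw [one_smul]; abel
      rw [this]; exact Submodule.add_mem _ h₀ h₀
    · have : y₀ + y₁ + (-1 : k) • (y₀ + -y₁) = y₁ + y₁ := by rw [neg_smul, one_smul]; abel
      rw [this]; exact Submodule.add_mem _ h₁ h₁
  have key : ∀ u : H ⊗[k] ExteriorAlgebra k V, u + c • tensorInvolute u ∈
      LinearMap.range ((CliffordAlgebra.evenOdd (0 : QuadraticForm k V) i).subtype.lTensor H) := by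
    intro u
    induction u with
    | zero => rw [map_zero, smul_zero, add_zero]; exact Submodule.zero_mem _
    | add x y hx hy =>
      rw [map_add, smul_add, add_add_add_comm]
      exact Submodule.add_mem _ hx hy
    | tmul b y =>
      refine ⟨b ⊗ₜ ⟨_, hy y⟩, ?_⟩
      rw [LinearMap.lTensor_tmul, tensorInvolute_tmul, Submodule.subtype_apply,
        TensorProduct.tmul_add, TensorProduct.tmul_smul]
  have h := Submodule.smul_mem _ (2 : k)⁻¹ (key u)
  rwa [hu, ← two_smul k u, smul_smul, inv_mul_cancel₀ hk, one_smul] at h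

end Tensor

/-! ### Eventual equality on tensors -/

section Eventually

variable {k H V V' ι : Type*} [Field k] [AddCommGroup H] [Module k H] [AddCommGroup V] [Module k V]
  [AddCommGroup V'] [Module k V']

lemma eventually_lTensor {l : Filter ι} {f : ι → V →ₗ[k] V'} {φ : V →ₗ[k] V'}
    (h : ∀ a, ∀ᶠ i in l, f i a = φ a) (t : H ⊗[k] V) :
    ∀ᶠ i in l, (f i).lTensor H t = φ.lTensor H t := by
  induction t with
  | zero => exact Filter.Eventually.of_forall fun i => by rw [map_zero, map_zero]
  | add s t hs ht => exact (hs.and ht).mono fun i h => by rw [map_add, map_add, h.1, h.2]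
  | tmul b a =>
    exact (h a).mono fun i h => by rw [LinearMap.lTensor_tmul, LinearMap.lTensor_tmul, h]

end Eventually

/-! ### The decomposition attached to an adapted basis -/

section Existence

variable {k A : Type*} [Field k] [Ring A] [Algebra k A]
  (𝒜 : ZMod 2 → Submodule k A) [GradedAlgebra 𝒜] [Coalgebra k A]

/-- The projection `A → Ā` followed by the inclusion `Ā → Ā ⊗ ⋀ W`. -/
def barIncl : A →ₐ[k] Bar 𝒜 ⊗[k] ExteriorAlgebra k (oddCotangent 𝒜) :=
  (Algebra.TensorProduct.includeLeft (S := k)).comp (toBar 𝒜)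

lemma barIncl_apply (a : A) : barIncl 𝒜 a = toBar 𝒜 a ⊗ₜ[k] 1 := rfl

lemma barIncl_odd {a : A} (ha : a ∈ 𝒜 1) : barIncl 𝒜 a = 0 := by
  rw [barIncl_apply, toBar_odd 𝒜 ha, TensorProduct.zero_tmul]

lemma barIncl_parityAut (a : A) : barIncl 𝒜 (parityAut 𝒜 a) = barIncl 𝒜 a := by
  nth_rw 2 [← proj_zero_add_proj_one 𝒜 a]
  rw [parityAut_apply, map_sub, map_add, barIncl_odd 𝒜 (proj_mem 𝒜 1 a), sub_zero, add_zero]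

lemma tensorInvolute_barIncl (a : A) : tensorInvolute (barIncl 𝒜 a) = barIncl 𝒜 a := by
  rw [barIncl_apply, tensorInvolute_tmul, map_one]

lemma toBar_eq_zero {a : A} (ha : toBar 𝒜 a = 0) : a ∈ oddPow 𝒜 (⊤ : Subalgebra k A) 1 := by
  rw [← proj_zero_add_proj_one 𝒜 a, map_add, toBar_odd 𝒜 (proj_mem 𝒜 1 a), add_zero,
    toBar_even 𝒜 (proj_mem 𝒜 0 a), Ideal.Quotient.eq_zero_iff_mem] at ha
  rw [← proj_zero_add_proj_one 𝒜 a]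
  refine Submodule.add_mem _ ?_ (oddPart_le_oddPow_one ⟨trivial, proj_mem 𝒜 1 a⟩)
  rw [oddPow_one]
  have hle : 𝒜 1 ≤ oddPart 𝒜 (⊤ : Subalgebra k A) := le_inf (fun _ _ => trivial) le_rfl
  have hle' : 𝒜 1 ≤ (⊤ : Subalgebra k A).toSubmodule := fun _ _ => trivial
  exact mul_le_mul' hle' hle ha

variable {𝒜}

lemma barIncl_eq_zero {a : A} (ha : barIncl 𝒜 a = 0) :
    a ∈ oddPow 𝒜 (⊤ : Subalgebra k A) 1 :=
  toBar_eq_zero 𝒜 (eq_zero_of_tmul_one ha)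

variable {S : A →ₗ[k] A} {Λ M : Type*} [LinearOrder Λ] {C : Λ → Submodule k A} {r : M → Λ}
  {v : M → oddCotangent 𝒜 →ₗ[k] k} {x : M → oddCotangent 𝒜}
  [IsSuperHopfAlgebra 𝒜] [IsSuperCommutative 𝒜] [LinearOrder M] [WellFoundedLT Λ]

variable (𝒜) in
/-- The counit `ε ⊗ ε` of `Ā ⊗ ⋀ W`. -/
def tensorCounit : Bar 𝒜 ⊗[k] ExteriorAlgebra k (oddCotangent 𝒜) →ₐ[k] k :=
  (Algebra.TensorProduct.lmul' k (S := k)).comp (Algebra.TensorProduct.map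
    (Bialgebra.counitAlgHom k (Bar 𝒜)) ExteriorAlgebra.algebraMapInv)

omit [IsSuperCommutative 𝒜] in
variable (𝒜) in
lemma tensorCounit_tmul (b : Bar 𝒜) (y : ExteriorAlgebra k (oddCotangent 𝒜)) :
    tensorCounit 𝒜 (b ⊗ₜ y) = counit (R := k) b * ExteriorAlgebra.algebraMapInv y := by
  rw [tensorCounit, AlgHom.comp_apply, Algebra.TensorProduct.map_tmul,
    Algebra.TensorProduct.lmul'_apply_tmul]
  rfl

omit [IsSuperCommutative 𝒜] in
variable (𝒜) in
lemma tensorCounit_barIncl (a : A) : tensorCounit 𝒜 (barIncl 𝒜 a) = counit (R := k) a := by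
  rw [barIncl_apply, tensorCounit_tmul, map_one, mul_one]
  exact barCounit_toBar 𝒜 a

omit [IsSuperCommutative 𝒜] in
variable (𝒜) in
lemma tensorCounit_gen (w : oddCotangent 𝒜) : tensorCounit 𝒜 (tensorGen k (Bar 𝒜) w) = 0 := by
  rw [tensorGen_apply, tensorCounit_tmul, ExteriorAlgebra.algebraMapInv,
    ExteriorAlgebra.lift_ι_apply, LinearMap.zero_apply, mul_zero]

omit [IsSuperCommutative 𝒜] in
lemma comul_toBar (a : A) : comul (R := k) (toBar 𝒜 a) =
    (toBar 𝒜).toLinearMap.lTensor (Bar 𝒜) (leftCoaction 𝒜 a) := by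
  refine (barComul_toBar 𝒜 a).trans ?_
  rw [leftCoaction, LinearMap.comp_apply, ← LinearMap.comp_apply (LinearMap.lTensor _ _),
    LinearMap.lTensor_comp_rTensor]

omit [IsSuperCommutative 𝒜] in
lemma freeCoaction_barIncl (a : A) :
    freeCoaction k (Bar 𝒜) (ExteriorAlgebra k (oddCotangent 𝒜)) (barIncl 𝒜 a) =
      (barIncl 𝒜).toLinearMap.lTensor (Bar 𝒜) (leftCoaction 𝒜 a) := by
  have h : (barIncl 𝒜).toLinearMap =
      (TensorProduct.mk k (Bar 𝒜) (ExteriorAlgebra k (oddCotangent 𝒜))).flip 1 ∘ₗ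
        (toBar 𝒜).toLinearMap := LinearMap.ext fun _ => rfl
  rw [barIncl_apply, freeCoaction_tmul_one, comul_toBar, h, LinearMap.lTensor_comp_apply]

/-- The decomposition given by an adapted system. -/
theorem IsAdaptedSystem.exists_isDecomposition (hk : (2 : k) ≠ 0) (hS : IsAntipode 𝒜 S)
    (h : IsAdaptedSystem 𝒜 S C r v x) :
    ∃ φ : A ≃ₐ[k] Bar 𝒜 ⊗[k] ExteriorAlgebra k (oddCotangent 𝒜), IsDecomposition 𝒜 φ ∧
      ∀ a, ∀ᶠ F : Finset M in Filter.atTop, partialDecomp 𝒜 v (barIncl 𝒜)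
        (fun i => tensorGen k (Bar 𝒜) (x i)) F.sort a = φ a := by
  have hσ : IsOddFamily tensorInvolute (tensorGen k (Bar 𝒜) (V := oddCotangent 𝒜)) :=
    isOddFamily_tensorGen
  have hσx : IsOddFamily tensorInvolute fun i => tensorGen k (Bar 𝒜) (x i) :=
    ⟨fun _ => hσ.map _, fun _ => hσ.mul _, fun _ => hσ.sq _⟩
  have hp : ∀ a, barIncl 𝒜 (parityAut 𝒜 a) = tensorInvolute (barIncl 𝒜 a) := fun a => by
    rw [barIncl_parityAut, tensorInvolute_barIncl]
  obtain ⟨Φ, hΦ⟩ := exists_decompHom hk hS h.toIsDualSystem hσx hp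
  have hinj : Function.Injective Φ := (injective_iff_map_eq_zero Φ).2 fun a ha => by
    refine eq_zero_of_partialDecomp hk hS h.toIsDualSystem (fun a => barIncl_eq_zero)
      (c := fun i => tensorContract (Bar 𝒜) (v i)) ⟨fun i a => ?_, fun i j u => ?_⟩
      (ha ▸ hΦ a)
    · exact tensorContract_tmul_one _ _
    · exact tensorContract_mul _ _ _
  have hsurj : Function.Surjective Φ := by
    obtain ⟨h1, h2⟩ := h.mem_range hk hS hσ (tensorInvolute_barIncl 𝒜) (fun a => barIncl_odd 𝒜) hΦ
    rw [← AlgHom.range_eq_top]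
    refine eq_top_of_tensorGen_mem (fun b => ?_) h2
    obtain ⟨a, rfl⟩ := toBar_surjective 𝒜 b
    exact h1 a
  refine ⟨AlgEquiv.ofBijective Φ ⟨hinj, hsurj⟩, ⟨fun i a ha => ?_, fun a => ?_, fun a => ?_⟩, hΦ⟩
  · have hγ : Φ (parityAut 𝒜 a) = tensorInvolute (Φ a) := by
      obtain ⟨F, h1, h2⟩ := ((hΦ a).and (hΦ (parityAut 𝒜 a))).exists
      rw [← h1, ← h2, partialDecomp_parityAut hσx hp]
    change Φ a ∈ _
    obtain rfl | rfl : i = 0 ∨ i = 1 := by clear ha; revert i; decide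
    · refine mem_range_lTensor_evenOdd hk (c := 1) (Or.inl ⟨rfl, rfl⟩) ?_
      rw [← hγ, parityAut_even 𝒜 ha, one_smul]
    · refine mem_range_lTensor_evenOdd hk (c := -1) (Or.inr ⟨rfl, rfl⟩) ?_
      rw [← hγ, parityAut_odd 𝒜 ha, map_neg, neg_smul, one_smul, neg_neg]
  -- A tensor involves finitely many elements, so both sides of colinearity are attained at one
  -- finite stage.
  · have hev := eventually_lTensor (H := Bar 𝒜) (φ := Φ.toLinearMap) hΦ (leftCoaction 𝒜 a)
    obtain ⟨F, h1, h2⟩ := ((hΦ a).and hev).exists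
    change freeCoaction k (Bar 𝒜) (ExteriorAlgebra k (oddCotangent 𝒜)) (Φ a) =
      Φ.toLinearMap.lTensor (Bar 𝒜) (leftCoaction 𝒜 a)
    rw [← h1, ← h2]
    refine partialDecomp_colinear (fun a => ?_) (fun i u => ?_) _ a
    · exact freeCoaction_barIncl a
    · exact freeCoaction_mul u _
  · obtain ⟨F, hF⟩ := (hΦ a).exists
    change tensorCounit 𝒜 (Φ a) = _
    rw [← hF, partialDecomp_counit (tensorCounit_barIncl 𝒜) fun i => tensorCounit_gen 𝒜 (x i)]

end Existence

/-! ### Compatible echelon forms along a linear map -/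

section Echelon

variable {k W M : Type*} [Field k] [AddCommGroup W] [Module k W] [LinearOrder M]

/-- `y` is obtained from `u` by replacing the members in the span of the preceding ones by zero,
and changing the others by elements of that span. -/
def IsEchelon (k : Type*) {W M : Type*} [Field k] [AddCommGroup W] [Module k W] [LinearOrder M]
    (u y : M → W) : Prop :=
  ∀ s, y s = 0 ∧ u s ∈ Submodule.span k (u '' Set.Iio s) ∨
    y s - u s ∈ Submodule.span k (u '' Set.Iio s) ∧ u s ∉ Submodule.span k (u '' Set.Iio s)

variable {u y : M → W}

lemma IsEchelon.mem_span (h : IsEchelon k u y) (s : M) :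
    y s ∈ Submodule.span k (u '' Set.Iic s) := by
  have hle : Submodule.span k (u '' Set.Iio s) ≤ Submodule.span k (u '' Set.Iic s) :=
    Submodule.span_mono (Set.image_mono Set.Iio_subset_Iic_self)
  obtain ⟨h0, -⟩ | ⟨h1, -⟩ := h s
  · rw [h0]; exact Submodule.zero_mem _
  · rw [← sub_add_cancel (y s) (u s)]
    exact Submodule.add_mem _ (hle h1) (Submodule.subset_span ⟨s, Set.self_mem_Iic, rfl⟩)

lemma IsEchelon.span_le_span [WellFoundedLT M] (h : IsEchelon k u y) (s : M) :
    Submodule.span k (u '' Set.Iio s) ≤ Submodule.span k (y '' Set.Iio s) := by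
  induction s using WellFoundedLT.induction with
  | ind s ih =>
    refine Submodule.span_le.2 ?_
    rintro _ ⟨t, ht, rfl⟩
    have hle : Submodule.span k (u '' Set.Iio t) ≤ Submodule.span k (y '' Set.Iio s) :=
      (ih t ht).trans (Submodule.span_mono (Set.image_mono (Set.Iio_subset_Iio (le_of_lt ht))))
    obtain ⟨-, h0⟩ | ⟨h1, -⟩ := h t
    · exact hle h0
    · have := Submodule.sub_mem _ (Submodule.subset_span ⟨t, ht, rfl⟩ :
        y t ∈ Submodule.span k (y '' Set.Iio s)) (hle h1)
      rwa [sub_sub_cancel] at this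

lemma IsEchelon.span_le_span' (h : IsEchelon k u y) (s : M) :
    Submodule.span k (y '' Set.Iio s) ≤ Submodule.span k (u '' Set.Iio s) := by
  refine Submodule.span_le.2 ?_
  rintro _ ⟨t, ht, rfl⟩
  exact Submodule.span_mono (Set.image_mono (Set.Iic_subset_Iio.2 ht)) (h.mem_span t)

lemma IsEchelon.notMem (h : IsEchelon k u y) {s : M} (hs : y s ≠ 0) :
    y s ∉ Submodule.span k (y '' Set.Iio s) := fun hy => by
  obtain ⟨h0, -⟩ | ⟨h1, h2⟩ := h s
  · exact hs h0
  · have := Submodule.sub_mem _ (h.span_le_span' s hy) h1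
    rw [sub_sub_cancel] at this
    exact h2 this

/-- An echelon system is, up to zeros, a basis. -/
lemma IsEchelon.exists_isDualSystem [WellFoundedLT M] (h : IsEchelon k u y)
    (hu : Submodule.span k (Set.range u) = ⊤) : ∃ v : M → W →ₗ[k] k, IsDualSystem v y ∧
      ∀ s, ∀ w ∈ Submodule.span k (u '' Set.Iio s), v s w = 0 := by
  classical
  have hspan : Submodule.span k (Set.range y) = ⊤ := by
    rw [eq_top_iff, ← hu, Submodule.span_le]
    rintro _ ⟨s, rfl⟩
    have hle : Submodule.span k (u '' Set.Iio s) ≤ Submodule.span k (Set.range y) :=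
      (h.span_le_span s).trans (Submodule.span_mono (Set.image_subset_range _ _))
    obtain ⟨-, h0⟩ | ⟨h1, -⟩ := h s
    · exact hle h0
    · have := Submodule.sub_mem _ (Submodule.subset_span ⟨s, rfl⟩ :
        y s ∈ Submodule.span k (Set.range y)) (hle h1)
      rwa [sub_sub_cancel] at this
  let J := {s : M // y s ≠ 0}
  have hli : LinearIndependent k fun s : J => y s := by
    rw [linearIndependent_iff']
    intro F c hc
    by_contra! hne
    obtain ⟨i, hi, hi0⟩ := hne
    have hF : (F.filter fun i => c i ≠ 0).Nonempty := ⟨i, Finset.mem_filter.2 ⟨hi, hi0⟩⟩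
    let m := (F.filter fun i => c i ≠ 0).max' hF
    have hm : m ∈ F.filter fun i => c i ≠ 0 := Finset.max'_mem _ _
    rw [← Finset.sum_filter_of_ne (p := fun i => c i ≠ 0)
      (fun i _ hi hci => hi (by rw [hci, zero_smul])), ← Finset.add_sum_erase _ _ hm] at hc
    have hmem : c m • y m ∈ Submodule.span k (y '' Set.Iio m.1) := by
      rw [eq_neg_of_add_eq_zero_left hc]
      refine Submodule.neg_mem _ (Submodule.sum_mem _ fun i hi => Submodule.smul_mem _ _
        (Submodule.subset_span ⟨i, ?_, rfl⟩))
      have hle : i ≤ m := Finset.le_max' _ _ (Finset.mem_of_mem_erase hi)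
      exact lt_of_le_of_ne hle fun h => Finset.ne_of_mem_erase hi (Subtype.ext h)
    refine h.notMem m.2 ?_
    rw [← inv_smul_smul₀ (Finset.mem_filter.1 hm).2 (y m)]
    exact Submodule.smul_mem _ _ hmem
  have hJ : ⊤ ≤ Submodule.span k (Set.range fun s : J => y s) := by
    rw [← hspan, Submodule.span_le]
    rintro _ ⟨s, rfl⟩
    by_cases hs : y s = 0
    · rw [hs]; exact Submodule.zero_mem _
    · exact Submodule.subset_span ⟨⟨s, hs⟩, rfl⟩
  let b := Module.Basis.mk hli hJ
  have hb : ∀ s : J, b s = y s := fun s => Module.Basis.mk_apply hli hJ s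
  let v : M → W →ₗ[k] k := fun s => if hs : y s ≠ 0 then b.coord ⟨s, hs⟩ else 0
  have hv : ∀ s (hs : y s ≠ 0) t (ht : y t ≠ 0), v s (y t) = if t = s then 1 else 0 := by
    intro s hs t ht
    have : v s = b.coord ⟨s, hs⟩ := dif_pos hs
    rw [this, ← hb ⟨t, ht⟩, Module.Basis.coord_apply, Module.Basis.repr_self,
      Finsupp.single_apply]
    exact if_congr Subtype.ext_iff rfl rfl
  have hdual : IsDualSystem v y := by
    refine ⟨hspan, fun s => ?_, fun s t hst => ?_⟩
    · by_cases hs : y s = 0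
      · exact Or.inr ⟨dif_neg (not_not.2 hs), hs⟩
      · left; rw [hv s hs s hs, if_pos rfl]
    · by_cases ht : y t = 0
      · rw [ht, map_zero]
      by_cases hs : y s = 0
      · have : v s = 0 := dif_neg (not_not.2 hs)
        rw [this, LinearMap.zero_apply]
      · rw [hv s hs t ht, if_neg hst.symm]
  refine ⟨v, hdual, fun s w hw => ?_⟩
  have : Submodule.span k (y '' Set.Iio s) ≤ LinearMap.ker (v s) := Submodule.span_le.2 <| by
    rintro _ ⟨t, ht, rfl⟩
    exact hdual.ne s t (ne_of_gt ht)
  exact this (h.span_le_span s hw)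

variable {W' : Type*} [AddCommGroup W'] [Module k W'] {u' : M → W'} {f : W →ₗ[k] W'}

/-- Two systems related by a linear map have compatible echelon forms. -/
lemma exists_isEchelon {P : M → Prop} (hP : ∀ s t, t ≤ s → P s → P t)
    (h1 : ∀ s, P s → u' s = f (u s)) (h0 : ∀ s, ¬ P s → u s = 0) :
    ∃ (y : M → W) (y' : M → W'), IsEchelon k u y ∧ IsEchelon k u' y' ∧
      ∀ s, f (y s) = y' s ∨ y s = 0 := by
  classical
  -- `P` is an initial segment, so all predecessors of `s` lie where `u' = f ∘ u`.
  have hspan : ∀ s, P s → (Submodule.span k (u '' Set.Iio s)).map f =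
      Submodule.span k (u' '' Set.Iio s) := fun s hs => by
    rw [Submodule.map_span, ← Set.image_comp]
    congr 1
    exact Set.image_congr fun t ht => (h1 t (hP s t (le_of_lt ht) hs)).symm
  have key : ∀ s, ∃ (y : W) (y' : W'),
      (y = 0 ∧ u s ∈ Submodule.span k (u '' Set.Iio s) ∨
        y - u s ∈ Submodule.span k (u '' Set.Iio s) ∧ u s ∉ Submodule.span k (u '' Set.Iio s)) ∧
      (y' = 0 ∧ u' s ∈ Submodule.span k (u' '' Set.Iio s) ∨
        y' - u' s ∈ Submodule.span k (u' '' Set.Iio s) ∧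
          u' s ∉ Submodule.span k (u' '' Set.Iio s)) ∧ (f y = y' ∨ y = 0) := by
    intro s
    by_cases hs : u s ∈ Submodule.span k (u '' Set.Iio s)
    · by_cases hs' : u' s ∈ Submodule.span k (u' '' Set.Iio s)
      · exact ⟨0, 0, Or.inl ⟨rfl, hs⟩, Or.inl ⟨rfl, hs'⟩, Or.inr rfl⟩
      · refine ⟨0, u' s, Or.inl ⟨rfl, hs⟩, Or.inr ⟨?_, hs'⟩, Or.inr rfl⟩
        rw [sub_self]; exact Submodule.zero_mem _
    have hPs : P s := by
      by_contra hPs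
      exact hs (h0 s hPs ▸ Submodule.zero_mem _)
    by_cases hs' : u' s ∈ Submodule.span k (u' '' Set.Iio s)
    -- Here `u s` is new but its image is not: correcting by `z` moves the new basis vector into the
    -- kernel of `f`, matching the zero chosen on the other side.
    · obtain ⟨z, hz, hfz⟩ := (hspan s hPs).symm ▸ hs'
      refine ⟨u s - z, 0, Or.inr ⟨?_, hs⟩, Or.inl ⟨rfl, hs'⟩, Or.inl ?_⟩
      · rw [sub_sub_cancel_left]; exact Submodule.neg_mem _ hz
      · rw [map_sub, hfz, h1 s hPs, sub_self]
    · refine ⟨u s, u' s, Or.inr ⟨?_, hs⟩, Or.inr ⟨?_, hs'⟩, Or.inl (h1 s hPs).symm⟩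
      · rw [sub_self]; exact Submodule.zero_mem _
      · rw [sub_self]; exact Submodule.zero_mem _
  choose y y' h using key
  exact ⟨y, y', fun s => (h s).1, fun s => (h s).2.1, fun s => (h s).2.2⟩

/-- The dichotomy needed by `map_partialDecomp`. If `x' s ≠ 0`, the forms `v' s ∘ f` and `v s` agree
on the spanning family `x`; otherwise both generators become zero in the target. -/
lemma IsDualSystem.comp_eq {M : Type*} {v : M → W →ₗ[k] k} {x : M → W} {v' : M → W' →ₗ[k] k}
    {x' : M → W'} (h : IsDualSystem v x) (h' : IsDualSystem v' x')
    (hf : ∀ s, f (x s) = x' s ∨ x s = 0) (s : M) :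
    v' s ∘ₗ f = v s ∧ (f (x s) = x' s ∨ v s = 0) ∨ f (x s) = 0 ∧ x' s = 0 := by
  by_cases hs : x' s = 0
  · right
    obtain hfs | hfs := hf s
    · exact ⟨hfs.trans hs, hs⟩
    · exact ⟨by rw [hfs, map_zero], hs⟩
  left
  have hv' : v' s (x' s) = 1 := (h'.self s).resolve_right fun h => hs h.2
  refine ⟨LinearMap.ext_on h.span ?_, ?_⟩
  · rintro _ ⟨t, rfl⟩
    rw [LinearMap.comp_apply]
    obtain ht | ht := hf t
    · rw [ht]
      by_cases hst : s = t
      · subst hst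
        have : x s ≠ 0 := fun hx => hs (by rw [← ht, hx, map_zero])
        rw [hv', (h.self s).resolve_right fun h => this h.2]
      · rw [h.ne s t hst, h'.ne s t hst]
    · rw [ht, map_zero, map_zero, map_zero]
  · refine (hf s).imp_right fun hx => ?_
    obtain h1 | h1 := h.self s
    · rw [hx, map_zero] at h1
      exact absurd h1 zero_ne_one
    · exact h1.1

end Echelon

/-! ### Compatibility with Hopf algebra maps -/

section Naturality

variable {k A D : Type*} [Field k] [Ring A] [Algebra k A] [Ring D] [Algebra k D]
  {𝒜 : ZMod 2 → Submodule k A} [GradedAlgebra 𝒜] [Coalgebra k A]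
  {𝒟 : ZMod 2 → Submodule k D} [GradedAlgebra 𝒟] [Coalgebra k D]
  {f : A →ₐc[k] D} (hf : ∀ (i : ZMod 2), ∀ a ∈ 𝒜 i, f a ∈ 𝒟 i)

lemma proj_one_map (hf : ∀ (i : ZMod 2), ∀ a ∈ 𝒜 i, f a ∈ 𝒟 i) (a : A) :
    proj 𝒟 1 (f a) = f (proj 𝒜 1 a) := by
  nth_rw 1 [← proj_zero_add_proj_one 𝒜 a]
  rw [map_add, map_add, proj_one_of_even 𝒟 (hf 0 _ (proj_mem 𝒜 0 a)),
    proj_of_mem 𝒟 (hf 1 _ (proj_mem 𝒜 1 a)), zero_add]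

lemma oddClass_map (a : A) :
    oddClass 𝒟 (f a) = oddCotangentMap 𝒜 𝒟 f hf (oddClass 𝒜 a) :=
  congrArg (Submodule.mkQ _) (Subtype.ext (proj_one_map hf a))

lemma cotDer_map (v : oddCotangent 𝒟 →ₗ[k] k) (a : A) :
    cotDer 𝒟 v (f a) = f (cotDer 𝒜 (v ∘ₗ oddCotangentMap 𝒜 𝒟 f hf) a) := by
  rw [invDer_apply, invDer_apply, ← CoalgHomClass.map_comp_comul_apply f a]
  generalize comul (R := k) a = t
  induction t with
  | zero => simp only [map_zero]
  | add x y hx hy => simp only [map_add, hx, hy]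
  | tmul x y =>
    rw [TensorProduct.map_tmul, contractSnd_tmul, contractSnd_tmul, map_smul]
    refine congrArg (· • f x) ?_
    exact congrArg v (oddClass_map hf y)

variable {M E E' : Type*} [Ring E] [Algebra k E] [Ring E'] [Algebra k E']
  {v : M → oddCotangent 𝒜 →ₗ[k] k} {p : A →ₐ[k] E} {g : M → E}
  {v' : M → oddCotangent 𝒟 →ₗ[k] k} {p' : D →ₐ[k] E'} {g' : M → E'} {Ψ : E →ₐ[k] E'}

/-- The map `f` intertwines the invariant operators and `Ψ` the generators, factor by factor; where
they fail to correspond, the correction terms on both sides vanish. -/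
lemma map_partialDecomp (hp : ∀ a, Ψ (p a) = p' (f a))
    (hg : ∀ i, v' i ∘ₗ oddCotangentMap 𝒜 𝒟 f hf = v i ∧ (Ψ (g i) = g' i ∨ v i = 0) ∨
      Ψ (g i) = 0 ∧ g' i = 0) (l : List M) (a : A) :
    Ψ (partialDecomp 𝒜 v p g l a) = partialDecomp 𝒟 v' p' g' l (f a) := by
  induction l generalizing a with
  | nil => exact hp a
  | cons i l ih =>
    rw [partialDecomp_cons, partialDecomp_cons, map_add, map_mul, ih, ih, cotDer_map hf]
    congr 1
    obtain ⟨h1, h2 | h2⟩ | ⟨h1, h2⟩ := hg i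
    · rw [h1, h2]
    · have h0 : cotDer 𝒜 (v i) a = 0 := by
        rw [cotDer, h2, LinearMap.zero_comp, invDer_apply]
        simp [contractSnd]
      rw [h1, h0, map_zero, map_zero, zero_mul, zero_mul]
    · rw [h1, h2, mul_zero, mul_zero]

end Naturality

/-- Padding by zeros lets every level of the exhaustion use the same well-ordered index set `ℕ`. -/
lemma exists_nat_generating_family {k W : Type*} [Field k] [AddCommGroup W] [Module k W]
    {P : Submodule k W} (hP : P.FG) : ∃ u : ℕ → W, Submodule.span k (Set.range u) = P := by
  obtain ⟨n, s, hs⟩ := Submodule.fg_iff_exists_fin_generating_family.1 hP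
  refine ⟨fun i => if h : i < n then s ⟨i, h⟩ else 0, le_antisymm ?_ ?_⟩
  · refine Submodule.span_le.2 ?_
    rintro _ ⟨i, rfl⟩
    dsimp only
    split_ifs with h
    · exact hs.le (Submodule.subset_span ⟨_, rfl⟩)
    · exact P.zero_mem
  · rw [← hs, Submodule.span_le]
    rintro _ ⟨i, rfl⟩
    exact Submodule.subset_span ⟨i, dif_pos i.2⟩

/-! ### Adapted systems from echelon forms -/

section Construction

variable {k A : Type*} [Field k] [Ring A] [Algebra k A]
  {𝒜 : ZMod 2 → Submodule k A} [GradedAlgebra 𝒜] [Coalgebra k A] {S : A →ₗ[k] A}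

lemma span_range_eq_top_of_cover {Λ : Type*} {C : Λ → Submodule k A} (hC : ∀ a, ∃ l, a ∈ C l)
    {u : Λ → ℕ → oddCotangent 𝒜}
    (hu : ∀ l, Submodule.span k (Set.range (u l)) = (C l).map (oddClass 𝒜)) :
    Submodule.span k (Set.range fun s : Λ ×ₗ ℕ => u (ofLex s).1 (ofLex s).2) = ⊤ := by
  rw [eq_top_iff]
  rintro w -
  obtain ⟨a, rfl⟩ := oddClass_surjective 𝒜 w
  obtain ⟨l, hl⟩ := hC a
  have hle : (C l).map (oddClass 𝒜) ≤
      Submodule.span k (Set.range fun s : Λ ×ₗ ℕ => u (ofLex s).1 (ofLex s).2) := by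
    rw [← hu, Submodule.span_le]
    rintro _ ⟨n, rfl⟩
    exact Submodule.subset_span ⟨toLex (l, n), rfl⟩
  exact hle (Submodule.mem_map_of_mem hl)

/-- An echelon form of generators of an exhaustion by Hopf stable subspaces is an adapted system. -/
lemma IsEchelon.isAdaptedSystem {Λ : Type*} [LinearOrder Λ] {C : Λ → Submodule k A}
    (hfg : ∀ l, (C l).FG) (hst : ∀ l, IsHopfStable 𝒜 S (C l)) (hcov : ∀ a, ∃ l, a ∈ C l)
    {u : Λ → ℕ → oddCotangent 𝒜}
    (hu : ∀ l, Submodule.span k (Set.range (u l)) = (C l).map (oddClass 𝒜))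
    {x : Λ ×ₗ ℕ → oddCotangent 𝒜}
    (hx : IsEchelon k (fun s : Λ ×ₗ ℕ => u (ofLex s).1 (ofLex s).2) x)
    {v : Λ ×ₗ ℕ → oddCotangent 𝒜 →ₗ[k] k} (hv : IsDualSystem v x)
    (hv0 : ∀ s, ∀ w ∈ Submodule.span k
      ((fun s : Λ ×ₗ ℕ => u (ofLex s).1 (ofLex s).2) '' Set.Iio s), v s w = 0) :
    IsAdaptedSystem 𝒜 S C (fun s : Λ ×ₗ ℕ => (ofLex s).1) v x where
  toIsDualSystem := hv
  fg := hfg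
  stable := hst
  cover := hcov
  vanish s l hl a ha := by
    refine hv0 s _ ?_
    have hle : (C l).map (oddClass 𝒜) ≤ Submodule.span k
        ((fun s : Λ ×ₗ ℕ => u (ofLex s).1 (ofLex s).2) '' Set.Iio s) := by
      rw [← hu, Submodule.span_le]
      rintro _ ⟨n, rfl⟩
      exact Submodule.subset_span ⟨toLex (l, n), Prod.Lex.lt_iff.2 (Or.inl hl), rfl⟩
    exact hle (Submodule.mem_map_of_mem ha)
  mem s := by
    refine (Submodule.span_le.2 ?_ : _ ≤ _) (hx.mem_span s)
    rintro _ ⟨t, ht, rfl⟩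
    have hut : u (ofLex t).1 (ofLex t).2 ∈ (C (ofLex t).1).map (oddClass 𝒜) :=
      (hu _).le (Submodule.subset_span ⟨_, rfl⟩)
    obtain h | ⟨h, -⟩ := Prod.Lex.le_iff.1 ht
    · exact Submodule.mem_sup_right
        (Submodule.mem_iSup_of_mem _ (Submodule.mem_iSup_of_mem h hut))
    · have hC : C (ofLex t).1 = C (ofLex s).1 := congrArg C h
      exact Submodule.mem_sup_left (hC ▸ hut)

end Construction

/-! ### Compatible decompositions for a map -/

section Main

variable {k A D : Type*} [Field k] [Ring A] [Algebra k A] [Ring D] [Algebra k D]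
  (𝒜 : ZMod 2 → Submodule k A) [GradedAlgebra 𝒜] [Coalgebra k A] [IsSuperHopfAlgebra 𝒜]
  [IsSuperCommutative 𝒜]
  (𝒟 : ZMod 2 → Submodule k D) [GradedAlgebra 𝒟] [Coalgebra k D] [IsSuperHopfAlgebra 𝒟]
  [IsSuperCommutative 𝒟]

omit [IsSuperHopfAlgebra 𝒜] [IsSuperCommutative 𝒜] [IsSuperHopfAlgebra 𝒟] [IsSuperCommutative 𝒟] in
lemma tensorMap_barIncl (f : A →ₐc[k] D) (hf : ∀ (i : ZMod 2), ∀ a ∈ 𝒜 i, f a ∈ 𝒟 i) (a : A) :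
    Algebra.TensorProduct.map (barMap 𝒜 𝒟 f hf)
      (ExteriorAlgebra.map (oddCotangentMap 𝒜 𝒟 f hf)) (barIncl 𝒜 a) = barIncl 𝒟 (f a) := by
  rw [barIncl_apply, barIncl_apply, Algebra.TensorProduct.map_tmul, map_one]
  exact congrArg (· ⊗ₜ[k] 1) (liftBar_toBar 𝒜 _ (fun b hb => toBar_odd 𝒟 (hf 1 b hb)) a)

omit [IsSuperHopfAlgebra 𝒜] [IsSuperCommutative 𝒜] [IsSuperHopfAlgebra 𝒟] [IsSuperCommutative 𝒟] in
lemma tensorMap_gen (f : A →ₐc[k] D) (hf : ∀ (i : ZMod 2), ∀ a ∈ 𝒜 i, f a ∈ 𝒟 i)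
    (w : oddCotangent 𝒜) :
    Algebra.TensorProduct.map (barMap 𝒜 𝒟 f hf)
      (ExteriorAlgebra.map (oddCotangentMap 𝒜 𝒟 f hf)) (tensorGen k (Bar 𝒜) w) =
        tensorGen k (Bar 𝒟) (oddCotangentMap 𝒜 𝒟 f hf w) := by
  rw [tensorGen_apply, tensorGen_apply, Algebra.TensorProduct.map_tmul, map_one,
    ExteriorAlgebra.map_apply_ι]

/-- A map of super commutative Hopf algebras admits compatible decompositions. -/
theorem exists_compatible_isDecomposition (hk : (2 : k) ≠ 0) (f : A →ₐc[k] D)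
    (hf : ∀ (i : ZMod 2), ∀ a ∈ 𝒜 i, f a ∈ 𝒟 i) :
    ∃ (φ : A ≃ₐ[k] Bar 𝒜 ⊗[k] ExteriorAlgebra k (oddCotangent 𝒜))
      (ψ : D ≃ₐ[k] Bar 𝒟 ⊗[k] ExteriorAlgebra k (oddCotangent 𝒟)),
      IsDecomposition 𝒜 φ ∧ IsDecomposition 𝒟 ψ ∧
      ∀ a : A, ψ (f a) = Algebra.TensorProduct.map (barMap 𝒜 𝒟 f hf)
        (ExteriorAlgebra.map (oddCotangentMap 𝒜 𝒟 f hf)) (φ a) := by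
  obtain ⟨S, hS⟩ := exists_isAntipode 𝒜
  obtain ⟨T, hT⟩ := exists_isAntipode 𝒟
  obtain ⟨_, _⟩ := exists_wellFoundedLT A
  obtain ⟨_, _⟩ := exists_wellFoundedLT D
  choose CA hCA hCAfg hCAst using exists_isHopfStable (𝒜 := 𝒜) hk hS
  choose CD hCD hCDfg hCDst using exists_isHopfStable (𝒜 := 𝒟) hk hT
  choose UA hUA using fun a => exists_nat_generating_family ((hCAfg a).map (oddClass 𝒜))
  choose UD hUD using fun d => exists_nat_generating_family ((hCDfg d).map (oddClass 𝒟))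
  let W := oddCotangentMap 𝒜 𝒟 f hf
  -- Both algebras are exhausted over one well-ordered set, the labels from `A` first. There `D`
  -- receives the images of the stages of `A`, so that generators correspond under `W`; on the
  -- labels from `D` the stages of `A` are zero.
  let C : A ⊕ₗ D → Submodule k A := fun l => Sum.elim CA (fun _ => ⊥) (ofLex l)
  let C' : A ⊕ₗ D → Submodule k D := fun l =>
    Sum.elim (fun a => (CA a).map (f : A →ₐ[k] D).toLinearMap) CD (ofLex l)
  let u : A ⊕ₗ D → ℕ → oddCotangent 𝒜 := fun l => Sum.elim UA (fun _ _ => 0) (ofLex l)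
  let u' : A ⊕ₗ D → ℕ → oddCotangent 𝒟 := fun l =>
    Sum.elim (fun a n => W (UA a n)) UD (ofLex l)
  have : WellFoundedLT (A ⊕ₗ D) := ⟨Sum.lex_wf wellFounded_lt wellFounded_lt⟩
  have hu : ∀ l, Submodule.span k (Set.range (u l)) = (C l).map (oddClass 𝒜) := by
    rintro (a | d)
    · exact hUA a
    · change Submodule.span k (Set.range fun _ : ℕ => (0 : oddCotangent 𝒜)) =
        (⊥ : Submodule k A).map (oddClass 𝒜)
      rw [Set.range_const, Submodule.span_zero_singleton, Submodule.map_bot]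
  have hu' : ∀ l, Submodule.span k (Set.range (u' l)) = (C' l).map (oddClass 𝒟) := by
    rintro (a | d)
    · change Submodule.span k (Set.range (W ∘ UA a)) =
        ((CA a).map (f : A →ₐ[k] D).toLinearMap).map (oddClass 𝒟)
      rw [Set.range_comp, ← Submodule.map_span, hUA, ← Submodule.map_comp, ← Submodule.map_comp]
      congr 1
      exact LinearMap.ext fun b => (oddClass_map hf b).symm
    · exact hUD d
  have hcov : ∀ a, ∃ l, a ∈ C l := fun a => ⟨toLex (Sum.inl a), hCA a⟩
  have hcov' : ∀ d, ∃ l, d ∈ C' l := fun d => ⟨toLex (Sum.inr d), hCD d⟩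
  obtain ⟨x, x', hx, hx', hxx⟩ := exists_isEchelon (k := k) (f := W)
    (u := fun s : (A ⊕ₗ D) ×ₗ ℕ => u (ofLex s).1 (ofLex s).2)
    (u' := fun s : (A ⊕ₗ D) ×ₗ ℕ => u' (ofLex s).1 (ofLex s).2)
    (P := fun s => ∃ a, (ofLex s).1 = toLex (Sum.inl a))
    (by
      rintro s t hts ⟨a, ha⟩
      have hle : (ofLex t).1 ≤ toLex (Sum.inl a) := by
        obtain h | ⟨h, -⟩ := Prod.Lex.le_iff.1 hts
        · exact ha ▸ h.le
        · exact (h.trans ha).le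
      revert hle
      generalize (ofLex t).1 = l
      intro hle
      rcases l with b | d
      · exact ⟨b, rfl⟩
      · exact absurd hle Sum.Lex.not_inr_le_inl)
    (by rintro s ⟨a, ha⟩; simp only [ha]; rfl)
    (by
      intro s
      change (¬ ∃ a, (ofLex s).1 = toLex (Sum.inl a)) → u (ofLex s).1 (ofLex s).2 = 0
      generalize (ofLex s).1 = l
      intro hl
      rcases l with b | d
      · exact absurd ⟨b, rfl⟩ hl
      · rfl)
  obtain ⟨v, hv, hv0⟩ := hx.exists_isDualSystem (span_range_eq_top_of_cover hcov hu)
  obtain ⟨v', hv', hv0'⟩ := hx'.exists_isDualSystem (span_range_eq_top_of_cover hcov' hu')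
  obtain ⟨φ, hφ, hφl⟩ := (hx.isAdaptedSystem (S := S) (by
      rintro (a | d)
      · exact hCAfg a
      · exact Submodule.fg_bot) (by
      rintro (a | d)
      · exact hCAst a
      · exact isHopfStable_bot) hcov hu hv hv0).exists_isDecomposition hk hS
  obtain ⟨ψ, hψ, hψl⟩ := (hx'.isAdaptedSystem (S := T) (by
      rintro (a | d)
      · exact (hCAfg a).map _
      · exact hCDfg d) (by
      rintro (a | d)
      · exact (hCAst a).map hS hT f hf
      · exact hCDst d) hcov' hu' hv' hv0').exists_isDecomposition hk hT
  refine ⟨φ, ψ, hφ, hψ, fun a => ?_⟩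
  -- A single finite set computes both sides, which reduces the claim to finite products.
  obtain ⟨F, h1, h2⟩ := ((hφl a).and (hψl (f a))).exists
  rw [← h1, ← h2]
  refine (map_partialDecomp hf (tensorMap_barIncl 𝒜 𝒟 f hf) (fun s => ?_) _ a).symm
  rw [tensorMap_gen]
  refine (hv.comp_eq hv' hxx s).imp (And.imp_right (Or.imp_left fun h => congrArg _ h))
    fun h => ⟨?_, ?_⟩
  · rw [h.1, map_zero]
  · rw [h.2, map_zero]

end Main

end SuperHopf

end

theorem theorem4p1 {k : Type*} [Field k] (hk : (2 : k) ≠ 0)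
    {A : Type*} [Ring A] [Algebra k A] (𝒜 : ZMod 2 → Submodule k A) [GradedAlgebra 𝒜]
    [Coalgebra k A] [IsSuperHopfAlgebra 𝒜] [IsSuperCommutative 𝒜] :
    (∃ φ : A ≃ₐ[k] Bar 𝒜 ⊗[k] ExteriorAlgebra k (oddCotangent 𝒜), IsDecomposition 𝒜 φ) ∧
    (∀ {D : Type*} [Ring D] [Algebra k D] (𝒟 : ZMod 2 → Submodule k D) [GradedAlgebra 𝒟]
      [Coalgebra k D] [IsSuperHopfAlgebra 𝒟] [IsSuperCommutative 𝒟]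
      (f : A →ₐc[k] D) (hf : ∀ (i : ZMod 2), ∀ a ∈ 𝒜 i, f a ∈ 𝒟 i),
      ∃ (φ : A ≃ₐ[k] Bar 𝒜 ⊗[k] ExteriorAlgebra k (oddCotangent 𝒜))
        (ψ : D ≃ₐ[k] Bar 𝒟 ⊗[k] ExteriorAlgebra k (oddCotangent 𝒟)),
        IsDecomposition 𝒜 φ ∧ IsDecomposition 𝒟 ψ ∧
        ∀ a : A, ψ (f a) =
          Algebra.TensorProduct.map (barMap 𝒜 𝒟 f hf)
            (ExteriorAlgebra.map (oddCotangentMap 𝒜 𝒟 f hf)) (φ a)) := by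
  refine ⟨?_, fun 𝒟 _ _ _ _ f hf => exists_compatible_isDecomposition 𝒜 𝒟 hk f hf⟩
  -- Existence alone is the compatible statement for the identity of `A`.
  obtain ⟨φ, -, hφ, -⟩ := exists_compatible_isDecomposition 𝒜 𝒜 hk (BialgHom.id k A)
    fun _ _ ha => ha
  exact ⟨φ, hφ⟩
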